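/- Notation. For $a,b,c,e,f\in\mathbb C$ put $${}_3F_2(a,b,c;e,f)=\sum_{k\ge 0}\frac{(a)_k(b)_k(c)_k}{(e)_k(f)_k\,k!}$$ (unit argument), with excess $s=e+f-a-b-c$. The series converges absolutely for $\Re s>0$, $e,f\notin\{0,-1,-2,\dots\}$. If $\Re s\le 0$, ${}_3F_2(a,b,c;e,f)$ denotes the analytic continuation in the parameters, which exists whenever none of $e,f,s$ is in $\{0,-1,-2,\dots\}$. Powers of $2$ and $4$ are principal. An empty sum is $0$, and $1/\Gamma$ is $0$ at $0,-1,-2,\dots$. Theorem. Let $a,b\in\mathbb C$ and let $n\ge 1$ be an integer. Each of the following equations holds whenever no lower parameter and no excess on its left-hand side is in $\{0,-1,-2,\dots\}$, no Gamma function in a numerator on its right-hand side is at a pole, and no other denominator on its right-hand side vanishes. (6) $${}_3F_2(a,a+\tfrac12,b;\,b+\tfrac32-a,\,b-a+1)=\frac{2^{-b}\sqrt\pi\,\Gamma(2+2b-2a)\Gamma(2+b-4a)}{\Gamma(2+2b-4a)(2a-1)}\left(\frac1{\Gamma(\frac b2)\Gamma(\frac32+\frac b2-2a)}-\frac1{\Gamma(\frac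 b2+\frac12)\Gamma(1+\frac b2-2a)}\right)$$ (7) $${}_3F_2(a,a+\tfrac12,1;\,\tfrac32-a-\tfrac n2,\,2-a-\tfrac n2)=\frac{\Gamma(3-n-2a)\Gamma(2-n-4a)}{\Gamma(3-n-4a)}\left(\frac{2^{-4a-n}\Gamma(1-2a)}{\Gamma(2-n-4a)}+\frac1{2\Gamma(2a)}\sum_{k=0}^{n-1}\frac{(-1)^k\Gamma(2a+k)}{\Gamma(2+k-n-2a)}\right)$$ (8) $${}_3F_2(a,a+\tfrac12,1;\,\tfrac32-a+\tfrac n2,\,1-a+\tfrac n2)=\Gamma(1-2a)\frac{1+n-2a}{1+n-4a}\left(\frac{2^{n-1-4a}\Gamma(1+n-2a)}{\Gamma(1+n-4a)}-\frac1{2\Gamma(2a-n)}\sum_{k=1}^{n-1}\frac{(-1)^k\Gamma(2a-n+k)}{\Gamma(1+k-2a)}\right)$$ In (B.10), (B.22), (B.25) let $\displaystyle A=\sum_{k=0}^{n-1}\frac{(-1)^k\Gamma(1-2a-n+k)}{\Gamma(1+2a+k)}$. In (B.23), (B.26) let $\displaystyle B=\sum_{k=0}^{n-1}\frac{(-1)^k\Gamma(2-2a-n+k)}{\Gamma(2a+k)}$.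 In (B.21), (B.27) let $\displaystyle C=\sum_{k=0}^{n-1}\frac{(-1)^k\Gamma(1-a-\frac n2+k)}{\Gamma(1+a-\frac n2+k)}$. In (B.11), (B.31), (B.34) let $\displaystyle P=\sum_{k=1}^{n-1}\frac{(-1)^k\Gamma(-2a+k)}{\Gamma(1-n+2a+k)}$. In (B.30), (B.33) let $\displaystyle Q=\sum_{k=1}^{n-1}\frac{(-1)^k\Gamma(1-2a+k)}{\Gamma(2a-n+k)}$. In (B.32), (B.35), (B.36) let $\displaystyle R=\sum_{k=1}^{n-1}\frac{(-1)^k\Gamma(1-a-\frac n2+k)}{\Gamma(a-\frac n2+k)}$. (The Gamma functions in the numerators of these sums count as numerators of the right-hand sides.) (B.10) $${}_3F_2(4a+n,a,a+\tfrac12;\,\tfrac12+3a+\tfrac n2,\,1+3a+\tfrac n2)=\frac{\Gamma(1+3a+\frac n2)\Gamma(\frac12+3a+\frac n2)}{\sqrt\pi\,\Gamma(1+4a+n)}\left(\frac{2^{2a}A}{\Gamma(1-2a-n)}+\frac{2^{6a+n-1}\Gamma(2a+n)}{\Gamma(4a+n)}\right)$$ (B.11) $${}_3F_2(1-n+4a,a+\tfrac12,a;\,1-\tfrac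 n2+3a,\,\tfrac32-\tfrac n2+3a)=\frac{(2a+\frac12-\frac n2)\Gamma(1+2a-n)\Gamma(2-n+6a)}{\Gamma(2-n+4a)^2}-\frac{\Gamma(1+2a-n)\,P\,\Gamma(1-\frac n2+3a)\Gamma(\frac32-\frac n2+3a)}{\Gamma(-2a)\Gamma(2-n+4a)\Gamma(a+\frac12)\Gamma(1+a)}$$ (B.21) $${}_3F_2(2a,a,a+\tfrac12;\,\tfrac12+\tfrac32a-\tfrac n4,\,2a+1)=\frac{2^{2a}C\,\Gamma(\frac12+\frac32a-\frac n4)}{\Gamma(\frac12-\frac a2-\frac n4)}+\frac{2^{3a-\frac n2-1}\Gamma(a+\frac n2)\Gamma(\frac12+\frac32a-\frac n4)\Gamma(1-\frac n4-\frac a2)}{\Gamma(2a)\sqrt\pi}$$ (B.22) $${}_3F_2(a,2a+\tfrac n2,\tfrac12-a-\tfrac n2;\,\tfrac12+3a+\tfrac n2,\,1+a)=\frac{A\,\Gamma(\frac12+3a+\frac n2)\Gamma(2a+2)\Gamma(1+\frac n2+2a)}{2\,\Gamma(1-2a-n)\Gamma(1+4a+n)\Gamma(a+\frac32)}+\frac{4^{\frac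 n2-1+3a}\Gamma(2a+n)\Gamma(\frac12+3a+\frac n2)\Gamma(1+\frac n2+2a)\Gamma(1+a)}{\sqrt\pi(2a+\frac n2)\Gamma(4a+n)^2}$$ (B.23) $${}_3F_2(a,2a+\tfrac n2-\tfrac12,1-a-\tfrac n2;\,3a+\tfrac n2-1,\,1+a)=\frac2{\sqrt\pi}\,\Gamma(2a+\tfrac n2-\tfrac12)\Gamma(3a+\tfrac n2-1)\Gamma(1+a)\left(\frac{2^{2a-2}B}{\Gamma(2-2a-n)\Gamma(4a+n-1)}+\frac{4^{\frac n2+3a-3}\Gamma(2a+n-1)}{(2a+\frac n2-1)\Gamma(4a+n-2)^2}\right)$$ (B.24) $${}_3F_2(a,\tfrac a2+\tfrac12,1+\tfrac a2;\,1-\tfrac n4+\tfrac34a,\,1+a)=\frac{\Gamma(1-\frac n4+\frac34a)\Gamma(2+\frac a2-\frac n2)\Gamma(\frac12-\frac n4-\frac a4)}{2\,\Gamma(1-\frac n2-\frac a2)\Gamma(1+\frac a4-\frac n4)\Gamma(\frac32+\frac a4-\frac n4)}\sum_{k=0}^{n-1}\frac{(-1)^k\Gamma(1-\frac n2-\frac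 a2+k)}{\Gamma(1+\frac a2-\frac n2+k)}+\frac{2^{\frac32a-\frac n2-1}\Gamma(\frac a2+\frac n2)\Gamma(1-\frac n4+\frac34a)\Gamma(\frac12-\frac n4-\frac a4)}{\Gamma(a)\sqrt\pi}$$ (B.25) $${}_3F_2(a,\tfrac12+2a+\tfrac n2,1-a-\tfrac n2;\,1+3a+\tfrac n2,\,1+a)=\frac{A\,\Gamma(1+3a+\frac n2)\Gamma(\frac12+2a+\frac n2)\Gamma(2a+2)}{2\,\Gamma(1-2a-n)\Gamma(1+4a+n)\Gamma(a+\frac32)}+\frac{2^{6a+n-2}\Gamma(2a+n)\Gamma(1+3a+\frac n2)\Gamma(\frac12+2a+\frac n2)\Gamma(1+a)}{\sqrt\pi(2a+\frac n2)\Gamma(4a+n)^2}$$ (B.26) $${}_3F_2(a,2a+\tfrac n2,\tfrac32-a-\tfrac n2;\,3a+\tfrac n2-\tfrac12,\,1+a)=\frac{B\,\Gamma(3a+\frac n2-\frac12)\Gamma(2a+\frac n2-1)\Gamma(2a+1)}{2\,\Gamma(2-2a-n)\Gamma(4a+n-1)\Gamma(a+\frac12)}+\frac{2^{6a+n-5}\Gamma(1+a)\Gamma(2a+\frac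 n2-1)\Gamma(2a+n-1)\Gamma(3a+\frac n2-\frac12)}{(2a+\frac n2-1)\sqrt\pi\,\Gamma(4a+n-2)^2}$$ (B.27) $${}_3F_2(a,a+\tfrac12,1;\,2a+1,\,\tfrac a2-\tfrac n4+1)=\frac{\Gamma(\frac12+\frac a2-\frac n4)\Gamma(2+a-\frac n2)}{\Gamma(\frac a2-\frac n4+\frac32)}\left(\frac{2^{2a-2}\Gamma(a+\frac n2)}{\Gamma(2a)}+\frac{C}{2\,\Gamma(1-a-\frac n2)}\right)$$ (B.28) $${}_3F_2(a-\tfrac12,a,1;\,2a-1,\,\tfrac a2-\tfrac n4+1)=\frac{\Gamma(\frac a2-\frac n4+1)\Gamma(\frac a2-\frac n4-\frac12)}{\sqrt\pi}\left(\frac{2^{a-1-\frac n2}}{\Gamma(2-a-\frac n2)}\sum_{k=0}^{n-1}\frac{(-1)^k\Gamma(2-a-\frac n2+k)}{\Gamma(a-\frac n2+k)}+\frac{2^{3a-4-\frac n2}\Gamma(a+\frac n2-1)}{\Gamma(2a-2)}\right)$$ (B.29) $${}_3F_2(2a-1,a,a-\tfrac12;\,\tfrac32a+\tfrac n2-\tfrac12,\,2a)=-\frac{\Gamma(1+a+n)\Gamma(a-n)\Gamma(\frac32a+\frac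 n2-\frac12)\Gamma(1-\frac a2+\frac n2)}{2\,\Gamma(1-a-n)\Gamma(a+n)\Gamma(\frac a2+\frac n2+1)\Gamma(\frac a2+\frac n2+\frac12)}\sum_{k=1}^{2n-1}\frac{(-1)^k\Gamma(1-a-n+k)}{\Gamma(a-n+k)}+\frac{2^{3a+n-3}\Gamma(\frac32a+\frac n2-\frac12)\Gamma(a-n)\Gamma(1-\frac a2+\frac n2)}{\sqrt\pi\,\Gamma(2a-1)}$$ (B.30) $${}_3F_2(a,2a-\tfrac n2,\tfrac12+\tfrac n2-a;\,3a-\tfrac12-\tfrac n2,\,1+a)=-\frac{\Gamma(2a+1)\Gamma(2a-n)\,Q\,\Gamma(3a-\frac12-\frac n2)\Gamma(2a-\frac n2)}{2\,\Gamma(2a)\Gamma(a+\frac12)\Gamma(1-2a)\Gamma(4a-n)}-\frac{2^{6a-3-n}(n-4a+1)\Gamma(1+a)\Gamma(2a-n)\Gamma(3a-\frac12-\frac n2)\Gamma(2a-\frac n2)}{\sqrt\pi\,\Gamma(4a-n)^2}$$ (B.31) $${}_3F_2(a,2a+\tfrac12-\tfrac n2,\tfrac n2-a;\,1+3a-\tfrac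 n2,\,1+a)=-\frac{\Gamma(2a+2)\Gamma(1+2a-n)\,P\,\Gamma(1+3a-\frac n2)\Gamma(\frac32+2a-\frac n2)}{2\,\Gamma(-2a)\Gamma(2-n+4a)\Gamma(2a+1)\Gamma(a+\frac32)}-\frac{2^{6a-n}(n-1-4a)\Gamma(1+2a-n)\Gamma(1+3a-\frac n2)\Gamma(1+a)\Gamma(\frac32+2a-\frac n2)}{\sqrt\pi\,\Gamma(2-n+4a)^2}$$ (B.32) $${}_3F_2(2a-1,a+\tfrac12,a;\,\tfrac32a+\tfrac n4,\,2a)=-\frac{\Gamma(a-\frac n2)\,R\,\Gamma(\frac32a+\frac n4)\Gamma(\frac12-\frac a2+\frac n4)\Gamma(1+a+\frac n2)}{2\,\Gamma(1-a-\frac n2)\Gamma(1+\frac a2+\frac n4)\Gamma(\frac12+\frac a2+\frac n4)\Gamma(a+\frac n2)}+\frac{2^{\frac n2+3a-3}\Gamma(\frac32a+\frac n4)\Gamma(a-\frac n2)\Gamma(\frac12-\frac a2+\frac n4)}{\sqrt\pi\,\Gamma(2a-1)}$$ (B.33) $${}_3F_2(a,2a+\tfrac12-\tfrac n2,\tfrac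 n2+1-a;\,3a-\tfrac n2,\,1+a)=-\frac{\Gamma(2a+1)\Gamma(2a-n)\,Q\,\Gamma(2a-\frac12-\frac n2)\Gamma(3a-\frac n2)}{2\,\Gamma(1-2a)\Gamma(4a-n)\Gamma(2a)\Gamma(a+\frac12)}+\frac{2^{6a-2-n}\Gamma(2a+\frac12-\frac n2)\Gamma(1+a)\Gamma(2a-n)\Gamma(3a-\frac n2)}{\sqrt\pi\,\Gamma(4a-n)^2}$$ (B.34) $${}_3F_2(a,2a+1-\tfrac n2,\tfrac12+\tfrac n2-a;\,3a+\tfrac32-\tfrac n2,\,1+a)=-\frac{\Gamma(2a+2)\Gamma(1+2a-n)\,P\,\Gamma(2a+1-\frac n2)\Gamma(3a+\frac32-\frac n2)}{2\,\Gamma(2a+1)\Gamma(a+\frac32)\Gamma(-2a)\Gamma(2-n+4a)}-\frac{2^{6a-n}(n-1-4a)\Gamma(1+a)\Gamma(1+2a-n)\Gamma(2a+1-\frac n2)\Gamma(3a+\frac32-\frac n2)}{\sqrt\pi\,\Gamma(2-n+4a)^2}$$ (B.35) $${}_3F_2(a,a+\tfrac12,1;\,2a,\,1+\tfrac a2+\tfrac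 n4)=\Gamma(1+a+\tfrac n2)\Gamma(a-\tfrac n2)\left(-\frac{R\,\Gamma(\frac a2+\frac n4-\frac12)}{2\,\Gamma(1-a-\frac n2)\Gamma(a+\frac n2)\Gamma(\frac12+\frac a2+\frac n4)}+\frac{4^{a-1}}{(a+\frac n2-1)\Gamma(2a-1)}\right)$$ (B.36) $${}_3F_2(a-\tfrac12,a,1;\,2a,\,\tfrac12+\tfrac a2+\tfrac n4)=\Gamma(a+\tfrac n2)\Gamma(a-\tfrac n2)\left(-\frac{R\,\sin(\pi(a+\frac n2))}{\pi}+\frac{4^{a-1}}{\Gamma(2a-1)}\right)$$ -/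

import Mathlib

local notation "Γ" => Complex.Gamma

/-- `z` is not one of the points `0, -1, -2, …` (the poles of the Gamma function). -/
def Reg (z : ℂ) : Prop := ∀ m : ℕ, z ≠ -(m : ℂ)

/-- The square root of `π`, as a complex number. -/
noncomputable def sqrtPi : ℂ := (√Real.pi : ℝ)

/-- The alternating finite sum `∑_{k = i}^{j} (-1)^k Γ(x + k) / Γ(y + k)`; it is `0` if `j < i`. -/
noncomputable def altGammaSum (i j : ℕ) (x y : ℂ) : ℂ :=
  ∑ k ∈ Finset.Icc i j, (-1 : ℂ) ^ k * Γ (x + k) / Γ (y + k)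

/-- The `k`-th term `(a)_k (b)_k (c)_k / ((e)_k (f)_k k!)` of the series `₃F₂(a, b, c; e, f; 1)`. -/
noncomputable def hyp3F2OneTerm (a b c e f : ℂ) (k : ℕ) : ℂ :=
  ((ascPochhammer ℂ k).eval a * (ascPochhammer ℂ k).eval b * (ascPochhammer ℂ k).eval c) /
    ((ascPochhammer ℂ k).eval e * (ascPochhammer ℂ k).eval f * (k.factorial : ℂ))

/-- `HasHyp3F2One a b c e f v` : the value of `₃F₂(a, b, c; e, f; 1)` is defined and equal to `v`.

With the excess `s = e + f - a - b - c`, the lower parameters `e`, `f` and the excess must not be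
nonpositive integers. If `0 < Re s`, the value is the sum of the series. Otherwise it is the value
at `f` of the analytic continuation, in the second lower parameter `z`, of the sum of the series
from the half plane of convergence `0 < Re (e + z - a - b - c)` to the connected open set of all
`z` for which neither `z` nor `e + z - a - b - c` is a nonpositive integer. -/
def HasHyp3F2One (a b c e f v : ℂ) : Prop :=
  Reg e ∧ Reg f ∧ Reg (e + f - a - b - c) ∧
    ∃ g : ℂ → ℂ,
      DifferentiableOn ℂ g {z : ℂ | Reg z ∧ Reg (e + z - a - b - c)} ∧
      (∀ z : ℂ, Reg z → 0 < (e + z - a - b - c).re →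
        HasSum (hyp3F2OneTerm a b c e z) (g z)) ∧
      g f = v

/-! Divided by Γ(e)Γ(f)Γ(s), with s the excess, ₃F₂(a,b,c;e,f) becomes an entire function `reg3F2`
of all five parameters. An identity between such functions may therefore be proved where series and
integrals converge and extended by the identity theorem; singularities only come back through the
Gamma prefactors.

The core object is `quadOne x c`, the regularized ₃F₂(x/2, (x+1)/2, 1; c/2, (c+1)/2). With a general
third upper parameter b, duplication turns the parameter pairs into (x)_{2k}/(c)_{2k}, so the series
is an Euler integral of t^{x-1}(1-t)^{c-x-1}(1-t²)^{-b}. For c = 2b-x+2 the substitution t =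
(1-√u)/(1+√u) reduces it to a difference of two Beta integrals. This is `reg3F2_quadratic`,
equivalent to the two-parameter evaluation of the theorem. For b = 1 it gives c = 4-x. For b = 1
there is moreover a first-order inhomogeneous recurrence c ↦ c+1 (`quadOne_contiguous`). Iterated
downwards or upwards from c = 3-x it adds one Gamma quotient per step, and solving it gives the
alternating finite sums (`quadOne_down`, `quadOne_up`).

The remaining series come from Thomae's transformation (`reg3F2_thomae`, and `reg3F2_thomae'` for
its second form), obtained by summing an absolutely convergent double series in both orders with
Gauss's theorem. In each of them the excess, an upper parameter, or a difference of a lower and an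
upper parameter equals 1, and a suitable Thomae relation makes it the unit upper parameter of a
`quadOne`. Formulas that share a sum are evaluations of one and the same value of `quadOne`.

The passage from that value to the stated right-hand side uses duplication and recursion of Γ. It is
done for non-real a, where no Gamma argument meets a pole, and is extended to every admissible a by
continuity (`hasHyp3F2One_of_im_ne_zero`). -/

section RegularizedHypergeometric

open Filter Topology

/-! ### Reciprocal Gamma function, rising factorials, regularized terms. -/

/-- The reciprocal Gamma function, an entire function. -/
noncomputable def rGamma (z : ℂ) : ℂ := (Γ z)⁻¹

theorem rGamma_differentiable : Differentiable ℂ rGamma := Complex.differentiable_one_div_Gamma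

theorem rGamma_eq_mul (z : ℂ) : rGamma z = z * rGamma (z + 1) :=
  Complex.one_div_Gamma_eq_self_mul_one_div_Gamma_add_one z

theorem Differentiable.rGamma_comp {g : ℂ → ℂ} (hg : Differentiable ℂ g) :
    Differentiable ℂ fun w => rGamma (g w) :=
  rGamma_differentiable.comp hg

/-- The `k`-th rising factorial of `a`. -/
noncomputable def poch (a : ℂ) (k : ℕ) : ℂ := (ascPochhammer ℂ k).eval a

theorem poch_zero (a : ℂ) : poch a 0 = 1 := by simp [poch]

theorem poch_succ (a : ℂ) (k : ℕ) : poch a (k + 1) = poch a k * (a + k) := by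
  simp [poch, ascPochhammer_succ_right]

theorem Differentiable.poch_comp {g : ℂ → ℂ} (hg : Differentiable ℂ g) (k : ℕ) :
    Differentiable ℂ fun w => poch (g w) k :=
  (Polynomial.differentiable (ascPochhammer ℂ k)).comp hg

/-- The terms `(a)_k (b)_k (c)_k / (Γ(e + k) Γ(f + k) k!)` of the regularized series `₃F₂(1)`. -/
noncomputable def regTerm (a b c e f : ℂ) (k : ℕ) : ℂ :=
  poch a k * poch b k * poch c k * rGamma (e + k) * rGamma (f + k) / (k.factorial : ℂ)

theorem regTerm_succ (a b c e f : ℂ) (k : ℕ) :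
    regTerm a b c e f (k + 1) * ((e + k) * (f + k) * (k + 1)) =
      regTerm a b c e f k * ((a + k) * (b + k) * (c + k)) := by
  have hk : ((k : ℂ) + 1) ≠ 0 := by exact_mod_cast Nat.succ_ne_zero k
  have hf : (k.factorial : ℂ) ≠ 0 := by exact_mod_cast k.factorial_ne_zero
  simp only [regTerm, poch_succ, Nat.factorial_succ, Nat.cast_mul, Nat.cast_succ]
  rw [rGamma_eq_mul (e + k), rGamma_eq_mul (f + k), ← add_assoc, ← add_assoc]
  field_simp

theorem Differentiable.regTerm_comp {a b c e f : ℂ → ℂ} (ha : Differentiable ℂ a)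
    (hb : Differentiable ℂ b) (hc : Differentiable ℂ c) (he : Differentiable ℂ e)
    (hf : Differentiable ℂ f) (k : ℕ) :
    Differentiable ℂ fun w => regTerm (a w) (b w) (c w) (e w) (f w) k := by
  unfold regTerm
  exact (((((ha.poch_comp k).mul (hb.poch_comp k)).mul (hc.poch_comp k)).mul
    (he.add_const (k : ℂ)).rGamma_comp).mul (hf.add_const (k : ℂ)).rGamma_comp).div_const _

/-! ### Raabe's test and holomorphy of the regularized series. -/

/-- A sequence with `(k + 1) x_{k+1} ≤ (k - δ) x_k` for large `k` is summable (Raabe's test). -/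
theorem summable_of_raabe {x : ℕ → ℝ} {δ : ℝ} (hδ : 0 < δ) {K : ℕ} (hx : ∀ k, 0 ≤ x k)
    (h : ∀ k ≥ K, (k + 1) * x (k + 1) ≤ (k - δ) * x k) : Summable x := by
  rw [← summable_nat_add_iff K]
  refine summable_of_sum_range_le (c := K * x K / δ) (fun k => hx _) fun n => ?_
  -- The hypothesis reads δ x_k ≤ k x_k - (k+1) x_{k+1}, which telescopes.
  have key : δ * ∑ i ∈ Finset.range n, x (i + K) ≤ K * x K - (n + K : ℕ) * x (n + K) := by
    induction n with
    | zero => simp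
    | succ n ih =>
      rw [Finset.sum_range_succ, mul_add]
      have := h (n + K) (by omega)
      push_cast at this ih ⊢
      have e : n + 1 + K = n + K + 1 := by omega
      rw [e]
      linarith
  rw [le_div_iff₀ hδ, mul_comm]
  have : 0 ≤ ((n + K : ℕ) : ℝ) * x (n + K) := mul_nonneg (Nat.cast_nonneg _) (hx _)
  linarith

/-- Eventually k x_k decreases to some l ≥ 0, and l > 0 would give x_k ≥ l/k, against summability.
This removes the boundary terms at infinity in telescoping arguments. -/
theorem tendsto_mul_zero_of_raabe {x : ℕ → ℝ} {δ : ℝ} (hδ : 0 < δ) {K : ℕ} (hx : ∀ k, 0 ≤ x k)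
    (h : ∀ k ≥ K, (k + 1) * x (k + 1) ≤ (k - δ) * x k) :
    Tendsto (fun k : ℕ => (k : ℝ) * x k) atTop (𝓝 0) := by
  have hs := summable_of_raabe hδ hx h
  have hanti : Antitone fun k : ℕ => ((k + K : ℕ) : ℝ) * x (k + K) := by
    refine antitone_nat_of_succ_le fun k => ?_
    have := h (k + K) (by omega)
    have e : k + 1 + K = k + K + 1 := by omega
    rw [e]
    push_cast at this ⊢
    nlinarith [hx (k + K)]
  have hbdd : BddBelow (Set.range fun k : ℕ => ((k + K : ℕ) : ℝ) * x (k + K)) :=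
    ⟨0, by rintro _ ⟨k, rfl⟩; exact mul_nonneg (Nat.cast_nonneg _) (hx _)⟩
  have hlim := tendsto_atTop_ciInf hanti hbdd
  set l := ⨅ k : ℕ, ((k + K : ℕ) : ℝ) * x (k + K) with hl
  have hl0 : 0 ≤ l := le_ciInf fun k => mul_nonneg (Nat.cast_nonneg _) (hx _)
  have hle : ∀ k : ℕ, l ≤ ((k + K : ℕ) : ℝ) * x (k + K) := fun k => ciInf_le hbdd k
  rw [← tendsto_add_atTop_iff_nat K]
  rcases hl0.eq_or_lt with h0 | h0
  · rwa [h0]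
  · exfalso
    have h1 : Summable fun k : ℕ => l * ((k + (K + 1) : ℕ) : ℝ)⁻¹ := by
      refine Summable.of_nonneg_of_le (fun k => by positivity) (fun k => ?_)
        ((summable_nat_add_iff (K + 1)).2 hs)
      have := hle (k + 1)
      have e : k + 1 + K = k + (K + 1) := by omega
      rw [e] at this
      have hp : (0 : ℝ) < ((k + (K + 1) : ℕ) : ℝ) := by positivity
      rw [← div_eq_mul_inv, div_le_iff₀ hp]
      linarith
    rw [summable_mul_left_iff h0.ne', summable_nat_add_iff (f := fun k : ℕ => ((k : ℝ))⁻¹)] at h1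
    exact Real.not_summable_natCast_inv h1

theorem norm_sq_one_add_mul (a : ℂ) (t : ℝ) :
    ‖1 + a * t‖ ^ 2 = 1 + t * (2 * a.re + ‖a‖ ^ 2 * t) := by
  rw [Complex.sq_norm, Complex.sq_norm, Complex.normSq_apply, Complex.normSq_apply]
  simp
  ring

/-- For t = 1/k these norms make up the ratio of consecutive terms. Squared, a factor is 1 + t(2 Re
a + O(t)), so to first order the claim compares 2 Re(a+b+c) with 2 Re(e+f) - 2δ. Working near (w₀,
0) in both variables yields one threshold for k that serves all parameters near w₀. -/
theorem eventually_ratio_le {a b c e f : ℂ → ℂ} {w₀ : ℂ} (ha : ContinuousAt a w₀)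
    (hb : ContinuousAt b w₀) (hc : ContinuousAt c w₀) (he : ContinuousAt e w₀)
    (hf : ContinuousAt f w₀) {δ : ℝ} (hδ : δ < (e w₀ + f w₀ - a w₀ - b w₀ - c w₀).re) :
    ∀ᶠ q : ℂ × ℝ in 𝓝 (w₀, 0), 0 < q.2 →
      1 + e q.1 * q.2 ≠ 0 ∧ 1 + f q.1 * q.2 ≠ 0 ∧
      ‖1 + a q.1 * q.2‖ * ‖1 + b q.1 * q.2‖ * ‖1 + c q.1 * q.2‖ ≤
        ‖1 + e q.1 * q.2‖ * ‖1 + f q.1 * q.2‖ * (1 - δ * q.2) := by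
  let l : (ℂ → ℂ) → ℂ × ℝ → ℝ := fun g q => 2 * (g q.1).re + ‖g q.1‖ ^ 2 * q.2
  have hl : ∀ g : ℂ → ℂ, ContinuousAt g w₀ → ContinuousAt (l g) (w₀, 0) := by
    intro g hg
    have h1 : ContinuousAt (fun q : ℂ × ℝ => g q.1) (w₀, 0) :=
      ContinuousAt.comp (f := Prod.fst) (x := (w₀, (0 : ℝ))) hg continuousAt_fst
    exact (continuousAt_const.mul (Complex.continuous_re.continuousAt.comp h1)).add
      ((h1.norm.pow 2).mul continuousAt_snd)
  -- `d` and `T` are read off from (1-δt)² = 1 + t d and (1+tx)(1+ty)(1+tz) = 1 + t T.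
  let d : ℂ × ℝ → ℝ := fun q => -2 * δ + δ ^ 2 * q.2
  have hd : ContinuousAt d (w₀, 0) := by fun_prop
  let T : (ℂ × ℝ → ℝ) → (ℂ × ℝ → ℝ) → (ℂ × ℝ → ℝ) → ℂ × ℝ → ℝ := fun x y z q =>
    x q + y q + z q + q.2 * (x q * y q + x q * z q + y q * z q) + q.2 ^ 2 * (x q * y q * z q)
  have hT : ∀ x y z, ContinuousAt x (w₀, (0 : ℝ)) → ContinuousAt y (w₀, (0 : ℝ)) →
      ContinuousAt z (w₀, (0 : ℝ)) → ContinuousAt (T x y z) (w₀, 0) := by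
    intro x y z hx hy hz
    fun_prop
  have h1 : ContinuousAt (fun q => T (l e) (l f) d q - T (l a) (l b) (l c) q) (w₀, 0) :=
    (hT _ _ _ (hl e he) (hl f hf) hd).sub (hT _ _ _ (hl a ha) (hl b hb) (hl c hc))
  have e1 : ∀ᶠ q : ℂ × ℝ in 𝓝 (w₀, 0), 0 < T (l e) (l f) d q - T (l a) (l b) (l c) q := by
    refine h1.eventually_const_lt ?_
    simp [T, l, d] at hδ ⊢
    linarith
  have hnz : ∀ g : ℂ → ℂ, ContinuousAt g w₀ → ∀ᶠ q : ℂ × ℝ in 𝓝 (w₀, 0), 1 + g q.1 * q.2 ≠ 0 := by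
    intro g hg
    have h1 : ContinuousAt (fun q : ℂ × ℝ => g q.1) (w₀, 0) :=
      ContinuousAt.comp (f := Prod.fst) (x := (w₀, (0 : ℝ))) hg continuousAt_fst
    have : ContinuousAt (fun q : ℂ × ℝ => 1 + g q.1 * q.2) (w₀, 0) := by fun_prop
    exact this.eventually_ne (by simp)
  have hδ1 : ∀ᶠ q : ℂ × ℝ in 𝓝 (w₀, 0), 0 < 1 - δ * q.2 := by
    have : ContinuousAt (fun q : ℂ × ℝ => 1 - δ * q.2) (w₀, 0) := by fun_prop
    exact this.eventually_const_lt (by simp)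
  filter_upwards [e1, hnz e he, hnz f hf, hδ1] with q hq h2 h3 h4 hpos
  refine ⟨h2, h3, ?_⟩
  refine (sq_le_sq₀ (by positivity) (by positivity)).1 ?_
  rw [mul_pow, mul_pow, mul_pow, mul_pow]
  simp only [norm_sq_one_add_mul]
  have := mul_pos hpos hq
  simp only [T, l, d] at this
  nlinarith

theorem eventually_regTerm_raabe {a b c e f : ℂ → ℂ} {w₀ : ℂ} (ha : ContinuousAt a w₀)
    (hb : ContinuousAt b w₀) (hc : ContinuousAt c w₀) (he : ContinuousAt e w₀)
    (hf : ContinuousAt f w₀) {δ : ℝ} (hδ : δ < (e w₀ + f w₀ - a w₀ - b w₀ - c w₀).re) :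
    ∃ K : ℕ, ∀ᶠ w in 𝓝 w₀, ∀ k ≥ K,
      ((k : ℝ) + 1) * ‖regTerm (a w) (b w) (c w) (e w) (f w) (k + 1)‖ ≤
        (k - δ) * ‖regTerm (a w) (b w) (c w) (e w) (f w) k‖ := by
  have h := eventually_ratio_le ha hb hc he hf hδ
  rw [nhds_prod_eq, eventually_prod_iff] at h
  obtain ⟨pa, hpa, pb, hpb, H⟩ := h
  have ht : Tendsto (fun k : ℕ => ((k : ℝ))⁻¹) atTop (𝓝 0) := tendsto_inv_atTop_nhds_zero_nat
  obtain ⟨K, hK⟩ := eventually_atTop.1 (ht.eventually hpb)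
  refine ⟨K + 1, hpa.mono fun w hw k hk => ?_⟩
  have hk0 : (0 : ℝ) < k := by exact_mod_cast (by omega : 0 < k)
  obtain ⟨h1, h2, h3⟩ := H hw (hK k (by omega)) (inv_pos.2 hk0)
  have hkc : (k : ℂ) ≠ 0 := by exact_mod_cast hk0.ne'
  have conv : ∀ z : ℂ, z + k = (1 + z * ((k : ℝ)⁻¹ : ℝ)) * k := by
    intro z
    push_cast
    field_simp
    ring
  have convn : ∀ z : ℂ, ‖z + k‖ = ‖1 + z * ((k : ℝ)⁻¹ : ℝ)‖ * k := by
    intro z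
    rw [conv z, norm_mul, Complex.norm_natCast]
  have hrec := congrArg norm (regTerm_succ (a w) (b w) (c w) (e w) (f w) k)
  have hk1 : ‖(k : ℂ) + 1‖ = k + 1 := by
    have : ((k : ℂ) + 1) = ((k + 1 : ℕ) : ℂ) := by push_cast; ring
    rw [this, Complex.norm_natCast]
    push_cast
    ring
  simp only [norm_mul, convn, hk1] at hrec
  have p1 : 0 < ‖1 + e w * ((k : ℝ)⁻¹ : ℝ)‖ := norm_pos_iff.2 h1
  have p2 : 0 < ‖1 + f w * ((k : ℝ)⁻¹ : ℝ)‖ := norm_pos_iff.2 h2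
  simp only at h3
  set E := ‖1 + e w * ((k : ℝ)⁻¹ : ℝ)‖
  set F := ‖1 + f w * ((k : ℝ)⁻¹ : ℝ)‖
  set A := ‖1 + a w * ((k : ℝ)⁻¹ : ℝ)‖
  set B := ‖1 + b w * ((k : ℝ)⁻¹ : ℝ)‖
  set C := ‖1 + c w * ((k : ℝ)⁻¹ : ℝ)‖
  set u := ‖regTerm (a w) (b w) (c w) (e w) (f w) k‖
  have hu : 0 ≤ u := norm_nonneg _
  have h4 : A * B * C * k ≤ E * F * (k - δ) := by
    have := mul_le_mul_of_nonneg_right h3 hk0.le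
    calc A * B * C * k ≤ E * F * (1 - δ * (k : ℝ)⁻¹) * k := this
      _ = E * F * (k - δ) := by field_simp
  refine le_of_mul_le_mul_left ?_ (mul_pos (mul_pos p1 p2) (mul_pos hk0 hk0))
  have h5 := mul_le_mul_of_nonneg_right h4 (mul_nonneg hu (mul_nonneg hk0.le hk0.le))
  nlinarith

theorem exists_regTerm_raabe {a b c e f : ℂ} {δ : ℝ} (hδ : δ < (e + f - a - b - c).re) :
    ∃ K : ℕ, ∀ k ≥ K, ((k : ℝ) + 1) * ‖regTerm a b c e f (k + 1)‖ ≤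
      (k - δ) * ‖regTerm a b c e f k‖ := by
  obtain ⟨K, hK⟩ := eventually_regTerm_raabe (a := fun _ => a) (b := fun _ => b) (c := fun _ => c)
    (e := fun _ => e) (f := fun _ => f) (w₀ := 0) continuousAt_const continuousAt_const
    continuousAt_const continuousAt_const continuousAt_const hδ
  exact ⟨K, hK.self_of_nhds⟩

theorem summable_norm_regTerm {a b c e f : ℂ} (hs : 0 < (e + f - a - b - c).re) :
    Summable fun k => ‖regTerm a b c e f k‖ := by
  obtain ⟨δ, h0, h1⟩ := exists_between hs
  obtain ⟨K, hK⟩ := exists_regTerm_raabe h1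
  exact summable_of_raabe h0 (fun k => norm_nonneg _) hK

theorem summable_regTerm {a b c e f : ℂ} (hs : 0 < (e + f - a - b - c).re) :
    Summable (regTerm a b c e f) := (summable_norm_regTerm hs).of_norm

theorem tendsto_mul_regTerm {a b c e f : ℂ} (hs : 0 < (e + f - a - b - c).re) :
    Tendsto (fun k : ℕ => (k : ℂ) * regTerm a b c e f k) atTop (𝓝 0) := by
  obtain ⟨δ, h0, h1⟩ := exists_between hs
  obtain ⟨K, hK⟩ := exists_regTerm_raabe h1
  rw [tendsto_zero_iff_norm_tendsto_zero]
  simpa using tendsto_mul_zero_of_raabe h0 (fun k => norm_nonneg _) hK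

/-- The sum of the regularized series `₃F₂(1)`. -/
noncomputable def regSum (a b c e f : ℂ) : ℂ := ∑' k, regTerm a b c e f k

theorem continuous_excess_re {a b c e f : ℂ → ℂ} (ha : Differentiable ℂ a)
    (hb : Differentiable ℂ b) (hc : Differentiable ℂ c) (he : Differentiable ℂ e)
    (hf : Differentiable ℂ f) : Continuous fun w => (e w + f w - a w - b w - c w).re :=
  Complex.continuous_re.comp
    ((((he.add hf).sub ha).sub hb).sub hc).continuous

/-- Raabe's inequality holds with the same δ and K near w₀, so the tails have a common summable
majorant and Weierstrass's theorem applies. -/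
theorem differentiableAt_regSum {a b c e f : ℂ → ℂ} {w₀ : ℂ} (ha : Differentiable ℂ a)
    (hb : Differentiable ℂ b) (hc : Differentiable ℂ c) (he : Differentiable ℂ e)
    (hf : Differentiable ℂ f) (hs : 0 < (e w₀ + f w₀ - a w₀ - b w₀ - c w₀).re) :
    DifferentiableAt ℂ (fun w => regSum (a w) (b w) (c w) (e w) (f w)) w₀ := by
  obtain ⟨δ, h0, h1⟩ := exists_between hs
  obtain ⟨K, hK⟩ := eventually_regTerm_raabe ha.continuous.continuousAt
    hb.continuous.continuousAt hc.continuous.continuousAt he.continuous.continuousAt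
    hf.continuous.continuousAt h1
  let t : ℕ → ℂ → ℂ := fun k w => regTerm (a w) (b w) (c w) (e w) (f w) k
  have htd : ∀ k, Differentiable ℂ (t k) := fun k =>
    Differentiable.regTerm_comp ha hb hc he hf k
  -- L ≥ δ keeps the Raabe factors nonnegative from index L on.
  obtain ⟨L, hKL, hδL⟩ : ∃ L : ℕ, K ≤ L ∧ δ ≤ L := by
    obtain ⟨m, hm⟩ := exists_nat_ge δ
    exact ⟨max K m, le_max_left _ _, hm.trans (by exact_mod_cast le_max_right _ _)⟩
  -- The majorant satisfies Raabe's recursion with equality; the 1 added to its initial value leaves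
  -- room for w to vary near w₀.
  let m : ℕ → ℝ := fun j => Nat.rec (‖t L w₀‖ + 1) (fun j x => ((L + j : ℕ) - δ) / ((L + j : ℕ) + 1) * x) j
  have hm0 : m 0 = ‖t L w₀‖ + 1 := rfl
  have hms : ∀ j, m (j + 1) = ((L + j : ℕ) - δ) / ((L + j : ℕ) + 1) * m j := fun j => rfl
  have hsub : ∀ j : ℕ, (0 : ℝ) ≤ (L + j : ℕ) - δ := by
    intro j
    push_cast
    have : (0 : ℝ) ≤ j := Nat.cast_nonneg j
    linarith
  have hmn : ∀ j, 0 ≤ m j := by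
    intro j
    induction j with
    | zero => rw [hm0]; positivity
    | succ j ih =>
      rw [hms]
      exact mul_nonneg (div_nonneg (hsub j) (by positivity)) ih
  let x : ℕ → ℝ := fun k => if k < L then 0 else m (k - L)
  have hx : Summable x := by
    refine summable_of_raabe (K := L) h0 (fun k => ?_) fun k hk => ?_
    · simp only [x]
      split_ifs
      exacts [le_rfl, hmn _]
    · obtain ⟨j, rfl⟩ := Nat.exists_eq_add_of_le hk
      have e1 : L + j + 1 - L = j + 1 := by omega
      have e2 : L + j - L = j := by omega
      simp only [x, if_neg (by omega : ¬ L + j + 1 < L), if_neg (by omega : ¬ L + j < L), e1, e2,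
        hms]
      have : (0 : ℝ) < (L + j : ℕ) + 1 := by positivity
      apply le_of_eq
      field_simp
  have hmsum : Summable m := by
    have := (summable_nat_add_iff L).2 hx
    simpa [x] using this
  have hU : ∀ᶠ w in 𝓝 w₀, (∀ k ≥ K, ((k : ℝ) + 1) * ‖t (k + 1) w‖ ≤ (k - δ) * ‖t k w‖) ∧
      ‖t L w‖ < ‖t L w₀‖ + 1 :=
    hK.and ((htd L).continuous.norm.continuousAt.eventually_lt_const (by simp))
  obtain ⟨U, hUp, hUo, hUw⟩ := eventually_nhds_iff.1
    (hU.and ((continuous_excess_re ha hb hc he hf).continuousAt.eventually_const_lt hs))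
  have hbound : ∀ j, ∀ w ∈ U, ‖t (j + L) w‖ ≤ m j := by
    intro j w hw
    induction j with
    | zero => simpa [hm0] using (hUp w hw).1.2.le
    | succ j ih =>
      have h2 := (hUp w hw).1.1 (j + L) (by omega)
      rw [hms, div_mul_eq_mul_div, le_div_iff₀ (by positivity)]
      have e1 : j + 1 + L = j + L + 1 := by omega
      have e2 : L + j = j + L := by omega
      rw [e1, mul_comm, e2]
      refine h2.trans (mul_le_mul_of_nonneg_left ih ?_)
      rw [← e2]
      exact hsub j
  have htail : DifferentiableOn ℂ (fun w => ∑' j, t (j + L) w) U :=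
    Complex.differentiableOn_tsum_of_summable_norm hmsum (fun j => (htd _).differentiableOn) hUo hbound
  have heq : ∀ w ∈ U, regSum (a w) (b w) (c w) (e w) (f w) =
      (∑ k ∈ Finset.range L, t k w) + ∑' j, t (j + L) w := fun w hw =>
    ((summable_regTerm (hUp w hw).2).sum_add_tsum_nat_add L).symm
  have hd : DifferentiableAt ℂ (fun w => (∑ k ∈ Finset.range L, t k w) + ∑' j, t (j + L) w) w₀ :=
    (DifferentiableAt.fun_sum fun k _ => htd k w₀).add (htail.differentiableAt (hUo.mem_nhds hUw))
  exact hd.congr_of_eventuallyEq (eventually_of_mem (hUo.mem_nhds hUw) heq)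

/-! ### Contiguous relation and entire continuation of the regularized series. -/

/-- The coefficients of the contiguous relation in the second lower parameter. -/
noncomputable def contigOne (a b c e f : ℂ) : ℂ :=
  (a - f) * (b - f) * (c - f) + f * (e - f - 1) - (a - f - 1) * (b - f - 1) * (c - f - 1)

noncomputable def contigTwo (a b c f : ℂ) : ℂ := (a - f - 1) * (b - f - 1) * (c - f - 1)

/-- The termwise combination is the difference of `G k`, which vanishes at k = 0. It tends to 0
because (f+k) times the term for f+1 is the term for f, so one of the two factors k is absorbed.
Both series on the right have larger excess, which is what continues the left side. -/
theorem regSum_contiguous {a b c e f : ℂ} (hs : 0 < (e + f - a - b - c).re) :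
    (e + f - a - b - c) * regSum a b c e f =
      contigOne a b c e f * regSum a b c e (f + 1) +
        contigTwo a b c f * regSum a b c e (f + 2) := by
  have s1 := (summable_regTerm hs).hasSum
  have hs1 : 0 < (e + (f + 1) - a - b - c).re := by simp at hs ⊢; linarith
  have hs2 : 0 < (e + (f + 2) - a - b - c).re := by simp at hs ⊢; linarith
  have s2 := (summable_regTerm hs1).hasSum
  have s3 := (summable_regTerm hs2).hasSum
  let G : ℕ → ℂ := fun k => (k : ℂ) * (e + k - 1) * regTerm a b c e (f + 1) k
  have hG0 : G 0 = 0 := by simp [G]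
  have hstep : ∀ k, G (k + 1) - G k = -(e + f - a - b - c) * regTerm a b c e f k +
      contigOne a b c e f * regTerm a b c e (f + 1) k +
        contigTwo a b c f * regTerm a b c e (f + 2) k := by
    intro k
    have hk : ((k : ℂ) + 1) ≠ 0 := by exact_mod_cast Nat.succ_ne_zero k
    have hf : (k.factorial : ℂ) ≠ 0 := by exact_mod_cast k.factorial_ne_zero
    simp only [G, regTerm, poch_succ, Nat.factorial_succ, Nat.cast_mul, Nat.cast_succ,
      contigOne, contigTwo]
    have r1 : rGamma (f + k) = (f + k) * ((f + k + 1) * rGamma (f + 2 + k)) := by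
      rw [rGamma_eq_mul (f + k), rGamma_eq_mul (f + k + 1)]
      ring_nf
    have r2 : rGamma (f + 1 + k) = (f + k + 1) * rGamma (f + 2 + k) := by
      rw [rGamma_eq_mul (f + 1 + k)]
      ring_nf
    have r3 : rGamma (f + 1 + (k + 1)) = rGamma (f + 2 + k) := by ring_nf
    have r4 : rGamma (e + k) = (e + k) * rGamma (e + (k + 1)) := by
      rw [rGamma_eq_mul (e + k)]
      ring_nf
    rw [r1, r2, r3, r4]
    field_simp
    ring
  have hlim : Tendsto G atTop (𝓝 0) := by
    have h1 := tendsto_mul_regTerm hs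
    have h2 : Tendsto (fun k : ℕ => ((f + k) + (e - 1 - f)) * ((k : ℂ) * regTerm a b c e (f + 1) k))
        atTop (𝓝 (0 + (e - 1 - f) * 0)) := by
      simp only [add_mul]
      refine Tendsto.add ?_ ((tendsto_mul_regTerm hs1).const_mul _)
      refine h1.congr fun k => ?_
      simp only [regTerm]
      rw [rGamma_eq_mul (f + k), show f + k + 1 = f + 1 + k by ring]
      ring
    simp only [mul_zero, add_zero] at h2
    refine h2.congr fun k => ?_
    simp only [G]
    ring
  have hsum := ((s1.mul_left (-(e + f - a - b - c))).add (s2.mul_left (contigOne a b c e f))).add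
    (s3.mul_left (contigTwo a b c f))
  have htel : Tendsto (fun n => ∑ k ∈ Finset.range n, (G (k + 1) - G k)) atTop (𝓝 0) := by
    simp only [Finset.sum_range_sub, hG0, sub_zero]
    exact hlim
  have := tendsto_nhds_unique hsum.tendsto_sum_nat (htel.congr fun n =>
    Finset.sum_congr rfl fun k _ => hstep k)
  simp only [regSum]
  linear_combination -this

/-- The function `₃F₂(a, b, c; e, f; 1) / (Γ(e) Γ(f) Γ(s))` for `-N < Re s`, where `s` is the
excess. -/
noncomputable def reg3F2Aux : ℕ → ℂ → ℂ → ℂ → ℂ → ℂ → ℂ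
  | 0, a, b, c, e, f => rGamma (e + f - a - b - c) * regSum a b c e f
  | N + 1, a, b, c, e, f => contigOne a b c e f * reg3F2Aux N a b c e (f + 1) +
      contigTwo a b c f * (e + f - a - b - c + 1) * reg3F2Aux N a b c e (f + 2)

/-- Multiplied by 1/Γ(s+1), the contiguous relation has s/Γ(s+1) = 1/Γ(s) on the left and
(s+1)/Γ(s+2) in its last term. Thus the recursion defining `reg3F2Aux` needs no division by s. -/
theorem reg3F2Aux_succ {N : ℕ} {a b c e f : ℂ} (hs : -N < (e + f - a - b - c).re) :
    reg3F2Aux (N + 1) a b c e f = reg3F2Aux N a b c e f := by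
  induction N generalizing f with
  | zero =>
    have h := regSum_contiguous (by simpa using hs : 0 < (e + f - a - b - c).re)
    simp only [reg3F2Aux]
    have r1 : rGamma (e + f - a - b - c) =
        (e + f - a - b - c) * rGamma (e + (f + 1) - a - b - c) := by
      rw [rGamma_eq_mul (e + f - a - b - c)]
      ring_nf
    have r2 : rGamma (e + (f + 1) - a - b - c) =
        (e + f - a - b - c + 1) * rGamma (e + (f + 2) - a - b - c) := by
      rw [rGamma_eq_mul (e + (f + 1) - a - b - c)]
      ring_nf
    rw [r1]
    rw [r2] at *
    linear_combination -((e + f - a - b - c + 1) * rGamma (e + (f + 2) - a - b - c)) * h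
  | succ N ih =>
    have unf : ∀ M, reg3F2Aux (M + 1) a b c e f =
        contigOne a b c e f * reg3F2Aux M a b c e (f + 1) +
          contigTwo a b c f * (e + f - a - b - c + 1) * reg3F2Aux M a b c e (f + 2) := fun _ => rfl
    rw [unf, unf, ih (f := f + 1), ih (f := f + 2)]
    all_goals
      simp at hs ⊢
      linarith

theorem reg3F2Aux_of_le {N M : ℕ} (hNM : N ≤ M) {a b c e f : ℂ}
    (hs : -N < (e + f - a - b - c).re) : reg3F2Aux M a b c e f = reg3F2Aux N a b c e f := by
  induction M, hNM using Nat.le_induction with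
  | base => rfl
  | succ M hM ih =>
    have : (N : ℝ) ≤ M := by exact_mod_cast hM
    rw [reg3F2Aux_succ (by linarith), ih]

/-- The entire function `₃F₂(a, b, c; e, f; 1) / (Γ(e) Γ(f) Γ(s))` of the five parameters, where
`s = e + f - a - b - c` is the excess. -/
noncomputable def reg3F2 (a b c e f : ℂ) : ℂ :=
  reg3F2Aux (⌊-(e + f - a - b - c).re⌋₊ + 1) a b c e f

/-- The depth chosen in `reg3F2` is immaterial. Near a given point one fixed depth serves, hence
holomorphy. -/
theorem reg3F2_eq_aux {N : ℕ} {a b c e f : ℂ} (hs : -N < (e + f - a - b - c).re) :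
    reg3F2 a b c e f = reg3F2Aux N a b c e f := by
  unfold reg3F2
  set M := ⌊-(e + f - a - b - c).re⌋₊ + 1
  have hM : -(M : ℝ) < (e + f - a - b - c).re := by
    have := Nat.lt_floor_add_one (-(e + f - a - b - c).re)
    simp only [M]
    push_cast
    linarith
  rcases le_total N M with h | h
  · exact reg3F2Aux_of_le h hs
  · exact (reg3F2Aux_of_le h hM).symm

theorem reg3F2_eq_regSum {a b c e f : ℂ} (hs : 0 < (e + f - a - b - c).re) :
    reg3F2 a b c e f = rGamma (e + f - a - b - c) * regSum a b c e f :=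
  reg3F2_eq_aux (N := 0) (by simpa using hs)

theorem differentiableAt_reg3F2Aux {N : ℕ} {a b c e f : ℂ → ℂ} {w₀ : ℂ} (ha : Differentiable ℂ a)
    (hb : Differentiable ℂ b) (hc : Differentiable ℂ c) (he : Differentiable ℂ e)
    (hf : Differentiable ℂ f) (hs : -N < (e w₀ + f w₀ - a w₀ - b w₀ - c w₀).re) :
    DifferentiableAt ℂ (fun w => reg3F2Aux N (a w) (b w) (c w) (e w) (f w)) w₀ := by
  induction N generalizing f with
  | zero =>
    have h1 : Differentiable ℂ fun w => e w + f w - a w - b w - c w := by fun_prop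
    exact (h1.rGamma_comp w₀).mul (differentiableAt_regSum ha hb hc he hf (by simpa using hs))
  | succ N ih =>
    simp only [reg3F2Aux, contigOne, contigTwo]
    have d1 := ih (hf.add_const (1 : ℂ)) (by simp at hs ⊢; linarith)
    have d2 := ih (hf.add_const (2 : ℂ)) (by simp at hs ⊢; linarith)
    refine DifferentiableAt.add (DifferentiableAt.mul ?_ d1) (DifferentiableAt.mul ?_ d2) <;>
      fun_prop

theorem Differentiable.reg3F2_comp {a b c e f : ℂ → ℂ} (ha : Differentiable ℂ a)
    (hb : Differentiable ℂ b) (hc : Differentiable ℂ c) (he : Differentiable ℂ e)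
    (hf : Differentiable ℂ f) :
    Differentiable ℂ fun w => reg3F2 (a w) (b w) (c w) (e w) (f w) := by
  intro w₀
  obtain ⟨N, hN⟩ := exists_nat_gt (-(e w₀ + f w₀ - a w₀ - b w₀ - c w₀).re)
  have hN' : -(N : ℝ) < (e w₀ + f w₀ - a w₀ - b w₀ - c w₀).re := by linarith
  refine (differentiableAt_reg3F2Aux ha hb hc he hf hN').congr_of_eventuallyEq ?_
  filter_upwards [(continuous_excess_re ha hb hc he hf).continuousAt.eventually_const_lt hN'] with w hw
  exact reg3F2_eq_aux hw

/-! ### Identity theorem and permutations of the parameters. -/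

/-- Typical use: shift some parameters by w, prove the identity for large Re w, where everything
converges, and evaluate at w = 0. -/
theorem eq_of_eqOn_halfPlane {F G : ℂ → ℂ} (hF : Differentiable ℂ F) (hG : Differentiable ℂ G)
    (R : ℝ) (h : ∀ w : ℂ, R < w.re → F w = G w) (w : ℂ) : F w = G w := by
  have hFa : AnalyticOnNhd ℂ F Set.univ := fun z _ => hF.analyticAt z
  have hGa : AnalyticOnNhd ℂ G Set.univ := fun z _ => hG.analyticAt z
  have hev : F =ᶠ[𝓝 ((R + 1 : ℝ) : ℂ)] G := by
    filter_upwards [Complex.continuous_re.continuousAt.eventually_const_lt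
      (show R < Complex.re ((R + 1 : ℝ) : ℂ) by simp)] with z hz using h z hz
  exact congrFun (hFa.eq_of_eventuallyEq hGa hev) w

theorem regTerm_swap_lower (a b c e f : ℂ) : regTerm a b c e f = regTerm a b c f e := by
  ext k
  simp only [regTerm]
  ring

theorem regTerm_swap_left (a b c e f : ℂ) : regTerm a b c e f = regTerm b a c e f := by
  ext k
  simp only [regTerm]
  ring

theorem regTerm_swap_right (a b c e f : ℂ) : regTerm a b c e f = regTerm a c b e f := by
  ext k
  simp only [regTerm]
  ring

/-- Adding w to the second lower parameter adds w to the excess, so it is enough to compare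
convergent series. -/
theorem reg3F2_eq_of_regSum_eq {a b c e f a' b' c' e' f' : ℂ}
    (hs : e' + f' - a' - b' - c' = e + f - a - b - c)
    (h : ∀ w : ℂ, 0 < (e + f - a - b - c + w).re →
      regSum a b c e (f + w) = regSum a' b' c' (e' + 0) (f' + w)) :
    reg3F2 a b c e f = reg3F2 a' b' c' e' f' := by
  have hd : ∀ a b c e f : ℂ, Differentiable ℂ fun w => reg3F2 a b c e (f + w) := by
    intro a b c e f
    exact Differentiable.reg3F2_comp (by fun_prop) (by fun_prop) (by fun_prop) (by fun_prop)
      (by fun_prop)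
  have := eq_of_eqOn_halfPlane (hd a b c e f) (hd a' b' c' e' f') (-(e + f - a - b - c).re)
    (fun w hw => ?_) 0
  · simpa using this
  · have h1 : e + (f + w) - a - b - c = e + f - a - b - c + w := by ring
    have h2 : e' + (f' + w) - a' - b' - c' = e + f - a - b - c + w := by rw [← hs]; ring
    have h3 : 0 < (e + f - a - b - c + w).re := by rw [Complex.add_re]; linarith
    rw [reg3F2_eq_regSum (by rwa [h1]), reg3F2_eq_regSum (by rwa [h2]), h1, h2, h w h3, add_zero]

theorem reg3F2_swap_left (a b c e f : ℂ) : reg3F2 a b c e f = reg3F2 b a c e f :=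
  reg3F2_eq_of_regSum_eq (by ring) fun w _ => by simp only [regSum, add_zero, regTerm_swap_left]

theorem reg3F2_swap_right (a b c e f : ℂ) : reg3F2 a b c e f = reg3F2 a c b e f :=
  reg3F2_eq_of_regSum_eq (by ring) fun w _ => by simp only [regSum, add_zero, regTerm_swap_right]

/-- The shifted parameter sits in different lower slots on the two sides, so the continuation is
carried out separately here. -/
theorem reg3F2_swap_lower (a b c e f : ℂ) : reg3F2 a b c e f = reg3F2 a b c f e := by
  have hd1 : Differentiable ℂ fun w => reg3F2 a b c e (f + w) :=
    Differentiable.reg3F2_comp (by fun_prop) (by fun_prop) (by fun_prop) (by fun_prop) (by fun_prop)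
  have hd2 : Differentiable ℂ fun w => reg3F2 a b c (f + w) e :=
    Differentiable.reg3F2_comp (by fun_prop) (by fun_prop) (by fun_prop) (by fun_prop) (by fun_prop)
  have := eq_of_eqOn_halfPlane hd1 hd2 (-(e + f - a - b - c).re) (fun w hw => ?_) 0
  · simpa using this
  · have h1 : e + (f + w) - a - b - c = e + f - a - b - c + w := by ring
    have h2 : f + w + e - a - b - c = e + f - a - b - c + w := by ring
    have h3 : 0 < (e + f - a - b - c + w).re := by rw [Complex.add_re]; linarith
    rw [reg3F2_eq_regSum (by rwa [h1]), reg3F2_eq_regSum (by rwa [h2]), h1, h2]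
    simp only [regSum]
    rw [regTerm_swap_lower]

/-! ### Return from the regularized function to the hypergeometric value. -/

theorem Reg.Gamma_ne_zero {z : ℂ} (h : Reg z) : Γ z ≠ 0 := Complex.Gamma_ne_zero h

theorem Gamma_mul_rGamma {z : ℂ} (h : Reg z) : Γ z * rGamma z = 1 :=
  mul_inv_cancel₀ h.Gamma_ne_zero

theorem reg_of_re_pos {z : ℂ} (h : 0 < z.re) : Reg z := by
  intro m hm
  rw [hm] at h
  have : (0 : ℝ) ≤ m := Nat.cast_nonneg m
  simp at h
  linarith

/-- In terms of 1/Γ the recursion has no exceptional z. -/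
theorem poch_mul_rGamma (z : ℂ) (k : ℕ) : poch z k * rGamma (z + k) = rGamma z := by
  induction k with
  | zero => simp [poch_zero]
  | succ k ih =>
    rw [← ih, poch_succ, rGamma_eq_mul (z + k)]
    push_cast
    rw [add_assoc z]
    ring

theorem Reg.poch_ne_zero {z : ℂ} (h : Reg z) (k : ℕ) : poch z k ≠ 0 := by
  intro h0
  have := poch_mul_rGamma z k
  rw [h0, zero_mul] at this
  exact inv_ne_zero h.Gamma_ne_zero this.symm

theorem Reg.add_nat {z : ℂ} (h : Reg z) (k : ℕ) : Reg (z + k) := by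
  intro m hm
  apply h (m + k)
  push_cast
  linear_combination hm

theorem Reg.Gamma_add_nat {z : ℂ} (h : Reg z) (k : ℕ) : Γ (z + k) = Γ z * poch z k := by
  have h1 := poch_mul_rGamma z k
  have h2 := Gamma_mul_rGamma h
  have h3 := Gamma_mul_rGamma (h.add_nat k)
  linear_combination (-Γ (z + k)) * h2 + Γ z * poch z k * h3 - Γ (z + k) * Γ z * h1

theorem hyp3F2OneTerm_eq {a b c e f : ℂ} (he : Reg e) (hf : Reg f) (k : ℕ) :
    hyp3F2OneTerm a b c e f k = Γ e * Γ f * regTerm a b c e f k := by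
  have h1 : rGamma (e + k) * Γ e * poch e k = 1 := by
    rw [mul_assoc, ← he.Gamma_add_nat, mul_comm]
    exact Gamma_mul_rGamma (he.add_nat k)
  have h2 : rGamma (f + k) * Γ f * poch f k = 1 := by
    rw [mul_assoc, ← hf.Gamma_add_nat, mul_comm]
    exact Gamma_mul_rGamma (hf.add_nat k)
  have hk : (k.factorial : ℂ) ≠ 0 := by exact_mod_cast k.factorial_ne_zero
  have he0 := he.poch_ne_zero k
  have hf0 := hf.poch_ne_zero k
  change poch a k * poch b k * poch c k / (poch e k * poch f k * k.factorial) = _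
  rw [regTerm]
  field_simp
  linear_combination -(poch a k * poch b k * poch c k) * h1 - (poch a k * poch b k * poch c k) *
    (rGamma (e + k) * Γ e * poch e k) * h2

theorem Reg.differentiableAt_Gamma {z : ℂ} (h : Reg z) : DifferentiableAt ℂ Γ z :=
  Complex.differentiableAt_Gamma z h

/-- The continuation is explicit: Γ(e)Γ(z)Γ(s(z)) times an entire function of z. Its only possible
singularities are the poles of Γ(z) and Γ(s(z)), which the domain excludes, and Γ(s) cancels the
regularizing 1/Γ(s) in the half plane of convergence. -/
theorem hasHyp3F2One_of_reg3F2 {a b c e f v : ℂ} (he : Reg e) (hf : Reg f)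
    (hs : Reg (e + f - a - b - c))
    (hv : v = Γ e * Γ f * Γ (e + f - a - b - c) * reg3F2 a b c e f) :
    HasHyp3F2One a b c e f v := by
  refine ⟨he, hf, hs, fun z => Γ e * Γ z * Γ (e + z - a - b - c) * reg3F2 a b c e z, ?_, ?_,
    hv.symm⟩
  · rintro z ⟨hz, hz'⟩
    have h1 : Differentiable ℂ fun z => reg3F2 a b c e z :=
      Differentiable.reg3F2_comp (by fun_prop) (by fun_prop) (by fun_prop) (by fun_prop)
        (by fun_prop)
    have h2 : DifferentiableAt ℂ (fun z => Γ (e + z - a - b - c)) z :=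
      DifferentiableAt.comp (g := Γ) z hz'.differentiableAt_Gamma (by fun_prop)
    have h3 := hz.differentiableAt_Gamma
    exact (((h3.const_mul _).mul h2).mul (h1 z)).differentiableWithinAt
  · intro z hz hzs
    have h1 : hyp3F2OneTerm a b c e z = fun k => Γ e * Γ z * regTerm a b c e z k :=
      funext fun k => hyp3F2OneTerm_eq he hz k
    have h2 := Gamma_mul_rGamma (reg_of_re_pos hzs)
    have h3 : Γ e * Γ z * Γ (e + z - a - b - c) * (rGamma (e + z - a - b - c) * regSum a b c e z) =
        Γ e * Γ z * regSum a b c e z := by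
      linear_combination Γ e * Γ z * regSum a b c e z * h2
    simp only [h1, reg3F2_eq_regSum hzs, h3]
    exact (summable_regTerm hzs).hasSum.mul_left _

/-! ### Binomial series, Beta integrals and Gauss's theorem. -/

theorem hasSum_poch_mul_pow (b : ℂ) {x : ℂ} (hx : ‖x‖ < 1) :
    HasSum (fun k : ℕ => poch b k / (k.factorial : ℂ) * x ^ k) ((1 - x) ^ (-b)) := by
  have h := (Complex.one_div_one_sub_cpow_hasFPowerSeriesOnBall_zero b).hasSum
    (y := x) (by simpa [Metric.mem_eball, edist_zero_right, ← ofReal_norm] using hx)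
  simp only [zero_add, FormalMultilinearSeries.ofScalars_apply_eq, smul_eq_mul] at h
  rw [Complex.cpow_neg, ← one_div]
  have heq : (fun k : ℕ => poch b k / (k.factorial : ℂ) * x ^ k) =
      fun k : ℕ => Ring.choose (b + k - 1) k * x ^ k := by
    funext k
    rw [← Ring.multichoose_eq]
    have h1 := Ring.factorial_nsmul_multichoose_eq_ascPochhammer b k
    rw [Polynomial.ascPochhammer_smeval_eq_eval, nsmul_eq_mul] at h1
    have hk : (k.factorial : ℂ) ≠ 0 := by exact_mod_cast k.factorial_ne_zero
    rw [poch, ← h1]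
    field_simp
  rw [heq]
  exact h

open MeasureTheory in
/-- Termwise integration of the binomial series of `(1 - t ^ r) ^ (-b)` against a Beta density. -/
theorem hasSum_betaIntegral {A D b : ℂ} (hA : 0 < A.re) (hD : 0 < D.re) {r : ℕ} (hr : 0 < r)
    (hsum : Summable fun k : ℕ =>
      ‖poch b k / (k.factorial : ℂ) * Complex.betaIntegral (A.re + r * k : ℝ) (D.re : ℝ)‖) :
    HasSum (fun k : ℕ => poch b k / (k.factorial : ℂ) * Complex.betaIntegral (A + r * k) D)
      (∫ t in Set.Ioo (0 : ℝ) 1,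
        (t : ℂ) ^ (A - 1) * (1 - (t : ℂ)) ^ (D - 1) * (1 - (t : ℂ) ^ r) ^ (-b)) := by
  let F : ℕ → ℝ → ℂ := fun k t => poch b k / (k.factorial : ℂ) *
    ((t : ℂ) ^ (A + r * k - 1) * (1 - (t : ℂ)) ^ (D - 1))
  have hbeta : ∀ u v : ℂ, Complex.betaIntegral u v =
      ∫ t in Set.Ioo (0 : ℝ) 1, (t : ℂ) ^ (u - 1) * (1 - (t : ℂ)) ^ (v - 1) := by
    intro u v
    rw [Complex.betaIntegral, intervalIntegral.integral_of_le zero_le_one, integral_Ioc_eq_integral_Ioo]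
  have hint : ∀ u v : ℂ, 0 < u.re → 0 < v.re → IntegrableOn
      (fun t : ℝ => (t : ℂ) ^ (u - 1) * (1 - (t : ℂ)) ^ (v - 1)) (Set.Ioo 0 1) := by
    intro u v hu hv
    have := Complex.betaIntegral_convergent hu hv
    rw [intervalIntegrable_iff_integrableOn_Ioo_of_le zero_le_one] at this
    exact this
  have hAk : ∀ k : ℕ, 0 < (A + r * k).re := by
    intro k
    have : (0 : ℝ) ≤ r * k := by positivity
    simp
    linarith
  have hFint : ∀ k, Integrable (F k) (volume.restrict (Set.Ioo 0 1)) := fun k =>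
    (hint _ _ (hAk k) hD).const_mul _
  have hFI : ∀ k, ∫ t in Set.Ioo (0 : ℝ) 1, F k t =
      poch b k / (k.factorial : ℂ) * Complex.betaIntegral (A + r * k) D := by
    intro k
    simp only [F]
    rw [integral_const_mul, ← hbeta]
  -- Absolute values replace the exponents by their real parts, so the L¹ norms are again Beta
  -- integrals. This explains the form of `hsum`.
  have hFnorm : ∀ k, ∫ t in Set.Ioo (0 : ℝ) 1, ‖F k t‖ ≤
      ‖poch b k / (k.factorial : ℂ) * Complex.betaIntegral (A.re + r * k : ℝ) (D.re : ℝ)‖ := by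
    intro k
    have h1 : ∀ t ∈ Set.Ioo (0 : ℝ) 1, ((‖F k t‖ : ℝ) : ℂ) =
        (‖poch b k / (k.factorial : ℂ)‖ : ℂ) *
          ((t : ℂ) ^ (((A.re + r * k : ℝ) : ℂ) - 1) * (1 - (t : ℂ)) ^ (((D.re : ℝ) : ℂ) - 1)) := by
      intro t ht
      have ht1 : 0 < 1 - t := by linarith [ht.2]
      have e1 : (1 - (t : ℂ)) = ((1 - t : ℝ) : ℂ) := by push_cast; ring
      have e2 : ((A.re + r * k : ℝ) : ℂ) - 1 = ((A.re + r * k - 1 : ℝ) : ℂ) := by push_cast; ring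
      have e3 : ((D.re : ℝ) : ℂ) - 1 = ((D.re - 1 : ℝ) : ℂ) := by push_cast; ring
      simp only [F]
      rw [norm_mul, norm_mul, e1, e2, e3, Complex.norm_cpow_eq_rpow_re_of_pos ht.1,
        Complex.norm_cpow_eq_rpow_re_of_pos ht1, ← Complex.ofReal_cpow ht.1.le,
        ← Complex.ofReal_cpow ht1.le]
      simp
    have h2 : ((∫ t in Set.Ioo (0 : ℝ) 1, ‖F k t‖ : ℝ) : ℂ) =
        (‖poch b k / (k.factorial : ℂ)‖ : ℂ) *
          Complex.betaIntegral (A.re + r * k : ℝ) (D.re : ℝ) := by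
      rw [← integral_complex_ofReal, setIntegral_congr_fun measurableSet_Ioo h1,
        integral_const_mul, ← hbeta]
    have h3 := congrArg norm h2
    rw [norm_mul, Complex.norm_real, Complex.norm_real, norm_norm, ← norm_mul] at h3
    rw [← h3]
    exact Real.le_norm_self _
  have := hasSum_integral_of_summable_integral_norm hFint
    (Summable.of_nonneg_of_le (fun k => integral_nonneg fun t => norm_nonneg _) hFnorm hsum)
  simp only [hFI] at this
  have hlast : ∀ t ∈ Set.Ioo (0 : ℝ) 1, (t : ℂ) ^ (A - 1) * (1 - (t : ℂ)) ^ (D - 1) *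
      (1 - (t : ℂ) ^ r) ^ (-b) = ∑' k, F k t := by
    intro t ht
    have ht0 : (t : ℂ) ≠ 0 := by exact_mod_cast ht.1.ne'
    have hx : ‖(t : ℂ) ^ r‖ < 1 := by
      rw [norm_pow, Complex.norm_real, Real.norm_eq_abs, abs_of_pos ht.1]
      exact pow_lt_one₀ ht.1.le ht.2 hr.ne'
    have h1 := (hasSum_poch_mul_pow b hx).mul_left ((t : ℂ) ^ (A - 1) * (1 - (t : ℂ)) ^ (D - 1))
    rw [← h1.tsum_eq]
    refine tsum_congr fun k => ?_
    simp only [F]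
    have e : A + r * k - 1 = (A - 1) + ((r * k : ℕ) : ℂ) := by push_cast; ring
    rw [e, Complex.cpow_add _ _ ht0, Complex.cpow_natCast, pow_mul]
    ring
  rw [setIntegral_congr_fun measurableSet_Ioo hlast]
  exact this

theorem betaIntegral_eq {u v : ℂ} (hu : 0 < u.re) (hv : 0 < v.re) :
    Complex.betaIntegral u v = Γ u * Γ v * rGamma (u + v) := by
  have h := Gamma_mul_rGamma (reg_of_re_pos (z := u + v) (by simp; linarith))
  rw [Complex.Gamma_mul_Gamma_eq_betaIntegral hu hv]
  linear_combination -(Complex.betaIntegral u v) * h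

theorem poch_one_mul_rGamma (k : ℕ) : poch 1 k * rGamma (1 + k) = 1 := by
  rw [poch_mul_rGamma, rGamma, Complex.Gamma_one, inv_one]

/-- An upper and a lower parameter 1 cancel; in this way ₂F₁(1) is treated as a ₃F₂(1). -/
theorem regTerm_one_one (x y z : ℂ) (k : ℕ) :
    regTerm x y 1 z 1 k = poch x k / (k.factorial : ℂ) * (poch y k * rGamma (z + k)) := by
  rw [regTerm]
  linear_combination poch x k * poch y k * rGamma (z + k) / (k.factorial : ℂ) *
    poch_one_mul_rGamma k

/-- Gauss's theorem. -/
theorem reg3F2_gauss (x y z : ℂ) : reg3F2 x y 1 z 1 = rGamma (z - x) * rGamma (z - y) := by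
  -- Euler's integral: (1-t)^{-x} against the density of parameters y, z-y gives a Beta integral of
  -- parameters y, z-y-x.
  have main : ∀ {y z : ℂ}, 0 < y.re → 0 < (z - y).re → 0 < (z - y - x).re →
      reg3F2 x y 1 z 1 = rGamma (z - x) * rGamma (z - y) := by
    intro y z hy hzy hs
    have hterm : ∀ {u v : ℂ}, 0 < u.re → 0 < v.re → ∀ k : ℕ,
        poch x k / (k.factorial : ℂ) * Complex.betaIntegral (u + (1 : ℕ) * k) v =
          Γ u * Γ v * regTerm x u 1 (u + v) 1 k := by
      intro u v hu hv k
      have h0 : (0 : ℝ) ≤ k := Nat.cast_nonneg k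
      rw [betaIntegral_eq (by simp; linarith) hv, regTerm_one_one, Nat.cast_one, one_mul,
        (reg_of_re_pos hu).Gamma_add_nat, add_right_comm]
      ring
    have hsum : Summable fun k : ℕ => ‖poch x k / (k.factorial : ℂ) *
        Complex.betaIntegral (y.re + (1 : ℕ) * k : ℝ) ((z - y).re : ℝ)‖ := by
      have h1 : Summable fun k => ‖Γ y.re * Γ (z - y).re * regTerm x y.re 1 (y.re + (z - y).re) 1 k‖ := by
        simp only [norm_mul _ (regTerm _ _ _ _ _ _)]
        refine (summable_norm_regTerm ?_).mul_left _
        simp at hs ⊢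
        linarith
      refine h1.congr fun k => ?_
      rw [← hterm (by simpa using hy) (by simpa using hzy)]
      push_cast
      rfl
    have h := hasSum_betaIntegral hy hzy one_pos hsum
    simp only [hterm hy hzy, add_sub_cancel, pow_one] at h
    have hint : (∫ t in Set.Ioo (0 : ℝ) 1, (t : ℂ) ^ (y - 1) * (1 - (t : ℂ)) ^ (z - y - 1) *
        (1 - (t : ℂ)) ^ (-x)) = Complex.betaIntegral y (z - y - x) := by
      rw [Complex.betaIntegral, intervalIntegral.integral_of_le zero_le_one,
        MeasureTheory.integral_Ioc_eq_integral_Ioo]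
      refine MeasureTheory.setIntegral_congr_fun measurableSet_Ioo fun t ht => ?_
      have h1 : (1 - (t : ℂ)) ≠ 0 := by
        have : (1 - t : ℝ) ≠ 0 := by linarith [ht.2]
        exact_mod_cast this
      rw [mul_assoc, ← Complex.cpow_add _ _ h1]
      congr 2
      ring
    rw [hint, betaIntegral_eq hy hs] at h
    have hs' : 0 < (z + 1 - x - y - 1).re := by simp at hs ⊢; linarith
    have h2 := ((summable_regTerm hs').hasSum.mul_left (Γ y * Γ (z - y))).unique h
    rw [reg3F2_eq_regSum hs', show z + 1 - x - y - 1 = z - y - x by ring, regSum]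
    have g1 := Gamma_mul_rGamma (reg_of_re_pos hy)
    have g2 := Gamma_mul_rGamma (reg_of_re_pos hzy)
    have g3 := Gamma_mul_rGamma (reg_of_re_pos hs)
    rw [show y + (z - y - x) = z - x by ring] at h2
    set T := ∑' b, regTerm x y 1 z 1 b
    linear_combination rGamma (z - y - x) * rGamma y * rGamma (z - y) * h2 +
      (-rGamma (z - y - x) * T * Γ (z - y) * rGamma (z - y) +
        Γ (z - y - x) * rGamma (z - x) * rGamma (z - y) * rGamma (z - y - x)) * g1 -
      rGamma (z - y - x) * T * g2 + rGamma (z - x) * rGamma (z - y) * g3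
  -- Shifting y by w and z by 2w adds w to each of y, z-y and z-y-x, so all the conditions of `main`
  -- hold eventually.
  have hd : Differentiable ℂ fun w => reg3F2 x (y + w) 1 (z + 2 * w) 1 :=
    Differentiable.reg3F2_comp (by fun_prop) (by fun_prop) (by fun_prop) (by fun_prop) (by fun_prop)
  have hd2 : Differentiable ℂ fun w => rGamma (z + 2 * w - x) * rGamma (z + 2 * w - (y + w)) :=
    (Differentiable.rGamma_comp (by fun_prop)).mul (Differentiable.rGamma_comp (by fun_prop))
  have := eq_of_eqOn_halfPlane hd hd2 (|y.re| + |z.re| + |x.re|) (fun w hw => ?_) 0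
  · simpa using this
  · have a1 := neg_abs_le y.re
    have a2 := neg_abs_le z.re
    have a3 := le_abs_self x.re
    have a4 := le_abs_self y.re
    have a5 := abs_nonneg x.re
    have a6 := abs_nonneg y.re
    have a7 := abs_nonneg z.re
    apply main <;> simp <;> linarith

theorem regSum_gauss {x y z : ℂ} (hs : 0 < (z - x - y).re) :
    regSum x y 1 z 1 = Γ (z - x - y) * rGamma (z - x) * rGamma (z - y) := by
  have h := reg3F2_gauss x y z
  have e : z + 1 - x - y - 1 = z - x - y := by ring
  rw [reg3F2_eq_regSum (by rwa [e]), e] at h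
  have g := Gamma_mul_rGamma (reg_of_re_pos hs)
  linear_combination Γ (z - x - y) * h - regSum x y 1 z 1 * g

/-! ### Absolutely convergent double series and Thomae's transformation. -/

theorem norm_poch_le (x : ℂ) (k : ℕ) : ‖poch x k‖ ≤ ‖poch (‖x‖ : ℂ) k‖ := by
  induction k with
  | zero => simp [poch_zero]
  | succ k ih =>
    rw [poch_succ, poch_succ, norm_mul, norm_mul]
    refine mul_le_mul ih ?_ (norm_nonneg _) (norm_nonneg _)
    have : ((‖x‖ : ℂ) + k) = ((‖x‖ + k : ℝ) : ℂ) := by push_cast; ring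
    rw [this, Complex.norm_real, Real.norm_eq_abs, abs_of_nonneg (by positivity)]
    simpa using norm_add_le x k

/-- Passing from k to k+1 divides the two sides by |z+k| and by Re z + k, and |z+k| ≥ Re z + k. With
`norm_poch_le` it reduces absolute convergence to nonnegative upper and positive lower parameters.
-/
theorem norm_rGamma_add_nat_le {z : ℂ} (hz : 0 < z.re) (k : ℕ) :
    ‖rGamma (z + k)‖ ≤ ‖rGamma z‖ * ‖Γ z.re‖ * ‖rGamma ((z.re : ℂ) + k)‖ := by
  induction k with
  | zero =>
    have h := congrArg norm (Gamma_mul_rGamma (reg_of_re_pos (z := (z.re : ℂ)) (by simpa using hz)))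
    rw [norm_mul, norm_one] at h
    simp only [Nat.cast_zero, add_zero]
    rw [mul_assoc, h, mul_one]
  | succ k ih =>
    have hk : (0 : ℝ) ≤ k := Nat.cast_nonneg k
    rw [rGamma_eq_mul (z + k), rGamma_eq_mul ((z.re : ℂ) + k), norm_mul, norm_mul] at ih
    have e : ((z.re : ℂ) + k) = ((z.re + k : ℝ) : ℂ) := by push_cast; ring
    have h1 : ‖((z.re : ℂ) + k)‖ = z.re + k := by
      rw [e, Complex.norm_real, Real.norm_eq_abs, abs_of_pos (by linarith)]
    have h2 : z.re + k ≤ ‖z + k‖ := by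
      have := Complex.re_le_norm (z + k)
      simpa using this
    rw [h1] at ih
    push_cast
    rw [← add_assoc, ← add_assoc]
    have hpos : 0 < z.re + k := by linarith
    refine le_of_mul_le_mul_left ?_ hpos
    calc (z.re + k) * ‖rGamma (z + k + 1)‖ ≤ ‖z + k‖ * ‖rGamma (z + k + 1)‖ :=
          mul_le_mul_of_nonneg_right h2 (norm_nonneg _)
      _ ≤ _ := ih
      _ = _ := by ring

theorem poch_ofReal {x : ℝ} (hx : 0 ≤ x) (k : ℕ) : poch x k = (‖poch (x : ℂ) k‖ : ℂ) := by
  induction k with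
  | zero => simp [poch_zero]
  | succ k ih =>
    have : ((x : ℂ) + k) = ((x + k : ℝ) : ℂ) := by push_cast; ring
    rw [poch_succ, norm_mul, Complex.ofReal_mul, ← ih, this, Complex.norm_real, Real.norm_eq_abs,
      abs_of_nonneg (by positivity)]

theorem rGamma_ofReal {x : ℝ} (hx : 0 < x) : rGamma x = (‖rGamma (x : ℂ)‖ : ℂ) := by
  rw [rGamma, Complex.Gamma_ofReal, ← Complex.ofReal_inv, Complex.norm_real, Real.norm_eq_abs,
    abs_of_nonneg (inv_nonneg.2 (Real.Gamma_pos_of_pos hx).le)]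

theorem regTerm_one_one_ofReal {x y z : ℝ} (hx : 0 ≤ x) (hy : 0 ≤ y) (hz : 0 < z) (k : ℕ) :
    regTerm x y 1 z 1 k = (‖regTerm (x : ℂ) y 1 z 1 k‖ : ℂ) := by
  have hk : (0 : ℝ) ≤ k := Nat.cast_nonneg k
  have e : ((z : ℂ) + k) = ((z + k : ℝ) : ℂ) := by push_cast; ring
  rw [regTerm_one_one, e]
  simp only [norm_mul, norm_div, Complex.norm_natCast]
  push_cast
  have h3 := rGamma_ofReal (x := z + k) (by linarith)
  push_cast at h3
  rw [← poch_ofReal hx, ← poch_ofReal hy, ← h3]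

/-- All terms are nonnegative here, so Gauss's theorem computes the sum of the norms. -/
theorem tsum_norm_regTerm_gauss {x y z : ℝ} (hx : 0 ≤ x) (hy : 0 ≤ y) (hz : 0 < z)
    (hs : 0 < z - x - y) :
    ∑' k, ‖regTerm (x : ℂ) y 1 z 1 k‖ =
      ‖Γ (z - x - y : ℂ) * rGamma (z - x : ℂ) * rGamma (z - y : ℂ)‖ := by
  have hs' : 0 < ((z : ℂ) - x - y).re := by simpa using hs
  rw [← regSum_gauss hs', regSum, tsum_congr (regTerm_one_one_ofReal hx hy hz),
    ← Complex.ofReal_tsum, Complex.norm_real, Real.norm_eq_abs, abs_of_nonneg]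
  exact tsum_nonneg fun k => norm_nonneg _

/-- The terms of the double series whose two iterated sums give Thomae's transformation. -/
noncomputable def doubleTerm (b c x y Z : ℂ) (n m : ℕ) : ℂ :=
  poch b n * poch c n / (n.factorial : ℂ) *
    (poch x m / (m.factorial : ℂ) * (poch y m * rGamma (Z + n + m)))

/-- Replace b, c, x, y by their moduli and Z by its real part. Gauss's theorem sums the inner series
of the majorant, as |x|+|y| < Re Z, and the outer series becomes a ₃F₂(1) with excess Re Z - |b| -
|c|. -/
theorem summable_doubleTerm {b c x y Z : ℂ} (hZ : ‖x‖ + ‖y‖ < Z.re) (hZ' : ‖b‖ + ‖c‖ < Z.re) :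
    Summable (Function.uncurry (doubleTerm b c x y Z)) := by
  have hZ0 : 0 < Z.re := by linarith [norm_nonneg x, norm_nonneg y]
  set C := ‖rGamma Z‖ * ‖Γ Z.re‖ with hC
  have hC0 : 0 ≤ C := by positivity
  let g : ℕ × ℕ → ℝ := fun q =>
    C * ‖poch (‖b‖ : ℂ) q.1 * poch (‖c‖ : ℂ) q.1 / (q.1.factorial : ℂ)‖ *
      ‖regTerm (‖x‖ : ℂ) ‖y‖ 1 ((Z.re + q.1 : ℝ) : ℂ) 1 q.2‖
  have hg0 : 0 ≤ g := fun q => by positivity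
  have hn : ∀ n : ℕ, (0 : ℝ) ≤ n := fun n => Nat.cast_nonneg n
  have hgs : Summable g := by
    rw [summable_prod_of_nonneg hg0]
    constructor
    · intro n
      simp only [g]
      refine Summable.mul_left _ (summable_norm_regTerm ?_)
      have := hn n
      simp
      linarith
    · have h1 : ∀ n : ℕ, ∑' m, g (n, m) = C * ‖Γ (Z.re - ‖x‖ - ‖y‖ : ℝ)‖ *
          ‖regTerm ‖b‖ ‖c‖ ((Z.re - ‖x‖ - ‖y‖ : ℝ) : ℂ) ((Z.re - ‖x‖ : ℝ) : ℂ)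
            ((Z.re - ‖y‖ : ℝ) : ℂ) n‖ := by
        intro n
        have hn0 := hn n
        have h2 := (reg_of_re_pos (z := ((Z.re - ‖x‖ - ‖y‖ : ℝ) : ℂ))
          (by simp; linarith)).Gamma_add_nat n
        have key : poch (‖b‖ : ℂ) n * poch (‖c‖ : ℂ) n / (n.factorial : ℂ) *
            (Γ (((Z.re + n : ℝ) : ℂ) - (‖x‖ : ℝ) - (‖y‖ : ℝ)) *
              rGamma (((Z.re + n : ℝ) : ℂ) - (‖x‖ : ℝ)) *
              rGamma (((Z.re + n : ℝ) : ℂ) - (‖y‖ : ℝ))) = Γ (Z.re - ‖x‖ - ‖y‖ : ℝ) *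
          regTerm ‖b‖ ‖c‖ ((Z.re - ‖x‖ - ‖y‖ : ℝ) : ℂ) ((Z.re - ‖x‖ : ℝ) : ℂ)
            ((Z.re - ‖y‖ : ℝ) : ℂ) n := by
          unfold regTerm
          push_cast at h2 ⊢
          rw [show (Z.re : ℂ) + n - ‖x‖ - ‖y‖ = Z.re - ‖x‖ - ‖y‖ + n by ring, h2,
            show (Z.re : ℂ) + n - ‖x‖ = Z.re - ‖x‖ + n by ring,
            show (Z.re : ℂ) + n - ‖y‖ = Z.re - ‖y‖ + n by ring]
          ring
        simp only [g]
        rw [tsum_mul_left, tsum_norm_regTerm_gauss (norm_nonneg x) (norm_nonneg y) (by linarith)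
          (by linarith), mul_assoc, ← norm_mul, key, norm_mul, ← mul_assoc]
      simp only [h1]
      refine (summable_norm_regTerm ?_).mul_left _
      simp
      linarith
  refine Summable.of_norm_bounded hgs fun q => ?_
  have hre : (Z + q.1).re = Z.re + q.1 := by simp
  have hcast : ((Z.re + q.1 : ℝ) : ℂ) + q.2 = (Z.re : ℂ) + ((q.1 + q.2 : ℕ) : ℂ) := by
    push_cast; ring
  simp only [g, Function.uncurry, doubleTerm]
  rw [regTerm_one_one, hcast, add_assoc Z, ← Nat.cast_add]
  simp only [norm_mul, norm_div]
  have h1 := norm_rGamma_add_nat_le hZ0 (q.1 + q.2)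
  rw [← hC] at h1
  have hb := norm_poch_le b q.1
  have hc := norm_poch_le c q.1
  have hx := norm_poch_le x q.2
  have hy := norm_poch_le y q.2
  calc _ ≤ ‖poch (‖b‖ : ℂ) q.1‖ * ‖poch (‖c‖ : ℂ) q.1‖ / ‖(q.1.factorial : ℂ)‖ *
        (‖poch (‖x‖ : ℂ) q.2‖ / ‖(q.2.factorial : ℂ)‖ * (‖poch (‖y‖ : ℂ) q.2‖ *
          (C * ‖rGamma ((Z.re : ℂ) + ((q.1 + q.2 : ℕ) : ℂ))‖))) := by gcongr
    _ = _ := by ring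

/-- The double series `doubleTerm b c (f - a) (e - a) (e + f - a)` is summed by Gauss in each index
first: rows give Γ(a) times the left series, columns Γ(s) times the right one. The right series has
excess a, so the two regularizing factors match and no prefactor is left. -/
theorem reg3F2_thomae (a b c e f : ℂ) :
    reg3F2 a b c e f = reg3F2 (e - a) (f - a) (e + f - a - b - c) (e + f - a - c) (e + f - a - b) := by
  have main : ∀ {a e f : ℂ}, 0 < a.re → 0 < (e + f - a - b - c).re →
      ‖f - a‖ + ‖e - a‖ < (e + f - a).re → ‖b‖ + ‖c‖ < (e + f - a).re →
      reg3F2 a b c e f =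
        reg3F2 (e - a) (f - a) (e + f - a - b - c) (e + f - a - c) (e + f - a - b) := by
    intro a e f ha hs h1 h2
    have hsw := (summable_doubleTerm h1 h2).tsum_comm
    have hn : ∀ n : ℕ, (0 : ℝ) ≤ n := fun n => Nat.cast_nonneg n
    have row : ∀ n : ℕ, ∑' m : ℕ, doubleTerm b c (f - a) (e - a) (e + f - a) n m =
        Γ a * regTerm a b c e f n := by
      intro n
      simp only [doubleTerm]
      have hg := regSum_gauss (x := f - a) (y := e - a) (z := e + f - a + n)
        (by have := hn n; simp; linarith)
      rw [regSum, tsum_congr (regTerm_one_one _ _ _)] at hg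
      rw [tsum_mul_left, hg, show e + f - a + n - (f - a) - (e - a) = a + n by ring,
        (reg_of_re_pos ha).Gamma_add_nat, show e + f - a + n - (f - a) = e + n by ring,
        show e + f - a + n - (e - a) = f + n by ring, regTerm]
      ring
    have col : ∀ m : ℕ, ∑' n : ℕ, doubleTerm b c (f - a) (e - a) (e + f - a) n m =
        Γ (e + f - a - b - c) *
          regTerm (e - a) (f - a) (e + f - a - b - c) (e + f - a - c) (e + f - a - b) m := by
      intro m
      have hg := regSum_gauss (x := b) (y := c) (z := e + f - a + m)
        (by have := hn m; simp at hs ⊢; linarith)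
      rw [regSum, tsum_congr (regTerm_one_one _ _ _)] at hg
      have h3 : ∀ n : ℕ, doubleTerm b c (f - a) (e - a) (e + f - a) n m =
        poch (f - a) m / (m.factorial : ℂ) * poch (e - a) m *
          (poch b n / (n.factorial : ℂ) * (poch c n * rGamma (e + f - a + m + n))) := by
        intro n
        rw [doubleTerm, add_right_comm]
        ring
      rw [tsum_congr h3, tsum_mul_left, hg,
        show e + f - a + m - b - c = e + f - a - b - c + m by ring,
        (reg_of_re_pos hs).Gamma_add_nat, show e + f - a + m - b = e + f - a - b + m by ring,
        show e + f - a + m - c = e + f - a - c + m by ring, regTerm]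
      ring
    simp only [row, col, tsum_mul_left] at hsw
    have hs2 : e + f - a - c + (e + f - a - b) - (e - a) - (f - a) - (e + f - a - b - c) = a := by
      ring
    rw [reg3F2_eq_regSum hs, reg3F2_eq_regSum (by rwa [hs2]), hs2, regSum, regSum]
    have g1 := Gamma_mul_rGamma (reg_of_re_pos ha)
    have g2 := Gamma_mul_rGamma (reg_of_re_pos hs)
    set S1 := ∑' k, regTerm a b c e f k
    set S2 := ∑' k, regTerm (e - a) (f - a) (e + f - a - b - c) (e + f - a - c) (e + f - a - b) k
    linear_combination -rGamma a * rGamma (e + f - a - b - c) * hsw -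
      rGamma (e + f - a - b - c) * S1 * g1 + rGamma a * S2 * g2
  -- Adding w to a, e and f fixes e-a and f-a, while a, the excess and e+f-a all grow by w, as
  -- `main` requires.
  have hd1 : Differentiable ℂ fun w => reg3F2 (a + w) b c (e + w) (f + w) :=
    Differentiable.reg3F2_comp (by fun_prop) (by fun_prop) (by fun_prop) (by fun_prop) (by fun_prop)
  have hd2 : Differentiable ℂ fun w => reg3F2 (e + w - (a + w)) (f + w - (a + w))
      (e + w + (f + w) - (a + w) - b - c) (e + w + (f + w) - (a + w) - c)
      (e + w + (f + w) - (a + w) - b) :=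
    Differentiable.reg3F2_comp (by fun_prop) (by fun_prop) (by fun_prop) (by fun_prop) (by fun_prop)
  have := eq_of_eqOn_halfPlane hd1 hd2
    (‖f - a‖ + ‖e - a‖ + ‖b‖ + ‖c‖ + ‖a‖ + ‖e + f - a‖) (fun w hw => ?_) 0
  · simpa using this
  · have e1 : e + w + (f + w) - (a + w) = (e + f - a) + w := by ring
    have e2 : f + w - (a + w) = f - a := by ring
    have e3 : e + w - (a + w) = e - a := by ring
    have n1 := neg_le_of_abs_le (Complex.abs_re_le_norm (e + f - a))
    have n2 := neg_le_of_abs_le (Complex.abs_re_le_norm a)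
    have n3 := Complex.re_le_norm b
    have n4 := Complex.re_le_norm c
    have m1 := norm_nonneg (f - a)
    have m2 := norm_nonneg (e - a)
    have m3 := norm_nonneg (e + f - a)
    have m4 := norm_nonneg a
    have m5 := norm_nonneg b
    have m6 := norm_nonneg c
    apply main
    · rw [Complex.add_re]; linarith
    · rw [e1, Complex.sub_re, Complex.sub_re, Complex.add_re]; linarith
    · rw [e1, e2, e3, Complex.add_re]; linarith
    · rw [e1, Complex.add_re]; linarith

/-- Thomae's transformation twice, the second time with f-a as the distinguished parameter. This
second form keeps one upper and one lower parameter. -/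
theorem reg3F2_thomae' (a b c e f : ℂ) :
    reg3F2 a b c e f = reg3F2 a (e - b) (e - c) e (e + f - b - c) := by
  rw [reg3F2_swap_lower, reg3F2_thomae a b c f e, reg3F2_thomae (f - a),
    show f + e - a - c - (f - a) = e - c by ring, show f + e - a - b - (f - a) = e - b by ring,
    show f + e - a - c + (f + e - a - b) - (f - a) - (e - a) - (f + e - a - b - c) = a by ring,
    show f + e - a - c + (f + e - a - b) - (f - a) - (f + e - a - b - c) = e by ring,
    show f + e - a - c + (f + e - a - b) - (f - a) - (e - a) = e + f - b - c by ring,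
    reg3F2_swap_right, reg3F2_swap_left, reg3F2_swap_right]

/-! ### Duplication and the quadratic evaluation. -/

theorem sqrtPi_ne_zero : sqrtPi ≠ 0 := by
  rw [sqrtPi, Complex.ofReal_ne_zero]
  exact (Real.sqrt_pos.2 Real.pi_pos).ne'

theorem Gamma_duplication (z : ℂ) : Γ z * Γ (z + 1 / 2) = Γ (2 * z) * 2 ^ (1 - 2 * z) * sqrtPi :=
  Complex.Gamma_mul_Gamma_add_half z

theorem rGamma_duplication (z : ℂ) :
    rGamma z * rGamma (z + 1 / 2) = rGamma (2 * z) * 2 ^ (2 * z - 1) / sqrtPi := by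
  have h := congrArg Inv.inv (Gamma_duplication z)
  simp only [mul_inv] at h
  rw [rGamma, rGamma, h, ← Complex.cpow_neg, neg_sub, rGamma, div_eq_mul_inv]

theorem poch_duplication (x : ℂ) (k : ℕ) :
    poch (x / 2) k * poch (x / 2 + 1 / 2) k * 4 ^ k = poch x (2 * k) := by
  induction k with
  | zero => simp [poch_zero]
  | succ k ih =>
    rw [show 2 * (k + 1) = 2 * k + 1 + 1 by ring, poch_succ x, poch_succ x, ← ih, poch_succ,
      poch_succ]
    push_cast
    ring

/-- Duplication upstairs and downstairs: the factors 4^k cancel and only (x)_{2k}/Γ(c+2k) remains.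
-/
theorem regTerm_quadratic (x b c : ℂ) (k : ℕ) :
    regTerm (x / 2) (x / 2 + 1 / 2) b (c / 2) (c / 2 + 1 / 2) k =
      2 ^ (c - 1) / sqrtPi * (poch b k / (k.factorial : ℂ) *
        (poch x (2 * k) * rGamma (c + 2 * k))) := by
  have h1 := rGamma_duplication (c / 2 + k)
  have h2 : (2 : ℂ) ^ (2 * (c / 2 + k) - 1) = 2 ^ (c - 1) * 4 ^ k := by
    rw [show 2 * (c / 2 + k) - 1 = (c - 1) + ((2 * k : ℕ) : ℂ) by push_cast; ring,
      Complex.cpow_add _ _ two_ne_zero, Complex.cpow_natCast, pow_mul]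
    norm_num
  rw [h2, show 2 * (c / 2 + (k : ℂ)) = c + 2 * k by ring] at h1
  rw [regTerm, add_right_comm (c / 2), ← poch_duplication]
  linear_combination (poch (x / 2) k * poch (x / 2 + 1 / 2) k * poch b k / (k.factorial : ℂ)) * h1

/-- In the binomial series of (1-t²)^{-b}, the power t^{2k} integrates against the Beta density of
parameters x, c-x to a multiple of (x)_{2k}/Γ(c+2k). -/
theorem regSum_quadratic {x b c : ℂ} (hx : 0 < x.re) (hc : 0 < (c - x).re)
    (hs : 0 < (c - x - b).re) :
    regSum (x / 2) (x / 2 + 1 / 2) b (c / 2) (c / 2 + 1 / 2) * (Γ x * Γ (c - x)) =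
      2 ^ (c - 1) / sqrtPi * ∫ t in Set.Ioo (0 : ℝ) 1,
        (t : ℂ) ^ (x - 1) * (1 - (t : ℂ)) ^ (c - x - 1) * (1 - (t : ℂ) ^ 2) ^ (-b) := by
  have h2 : ∀ z : ℂ, (2 : ℂ) ^ z ≠ 0 := fun z => by simp [Complex.cpow_eq_zero_iff]
  have hterm : ∀ {u v : ℂ}, 0 < u.re → 0 < v.re → ∀ k : ℕ,
      Γ u * Γ v * regTerm (u / 2) (u / 2 + 1 / 2) b ((u + v) / 2) ((u + v) / 2 + 1 / 2) k =
        2 ^ (u + v - 1) / sqrtPi *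
          (poch b k / (k.factorial : ℂ) * Complex.betaIntegral (u + (2 : ℕ) * k) v) := by
    intro u v hu hv k
    have h0 : (0 : ℝ) ≤ k := Nat.cast_nonneg k
    have h1 := (reg_of_re_pos hu).Gamma_add_nat (2 * k)
    push_cast at h1 ⊢
    rw [betaIntegral_eq (by simp; linarith) hv, regTerm_quadratic, h1, add_right_comm]
    ring
  have hsum : Summable fun k : ℕ => ‖poch b k / (k.factorial : ℂ) *
      Complex.betaIntegral (x.re + (2 : ℕ) * k : ℝ) ((c - x).re : ℝ)‖ := by
    have hx' : 0 < ((x.re : ℝ) : ℂ).re := hx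
    have hc' : 0 < (((c - x).re : ℝ) : ℂ).re := hc
    have h1 := summable_norm_regTerm (a := ((x.re : ℝ) : ℂ) / 2) (b := ((x.re : ℝ) : ℂ) / 2 + 1 / 2)
      (c := b) (e := (((x.re : ℝ) : ℂ) + ((c - x).re : ℝ)) / 2)
      (f := (((x.re : ℝ) : ℂ) + ((c - x).re : ℝ)) / 2 + 1 / 2) (by
        rw [show (((x.re : ℝ) : ℂ) + ((c - x).re : ℝ)) / 2 +
          ((((x.re : ℝ) : ℂ) + ((c - x).re : ℝ)) / 2 + 1 / 2) - ((x.re : ℝ) : ℂ) / 2 -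
          (((x.re : ℝ) : ℂ) / 2 + 1 / 2) - b = ((c - x).re : ℝ) - b by ring]
        simp at hs ⊢
        linarith)
    have h3 := h1.mul_left ‖Γ ((x.re : ℝ) : ℂ) * Γ (((c - x).re : ℝ) : ℂ) *
      (2 ^ ((((x.re : ℝ) : ℂ) + ((c - x).re : ℝ)) - 1) / sqrtPi)⁻¹‖
    refine h3.congr fun k => ?_
    rw [← norm_mul, mul_right_comm, hterm hx' hc']
    push_cast
    have hp := sqrtPi_ne_zero
    have hp2 := h2 (((x.re : ℝ) : ℂ) + ((c - x).re : ℝ) - 1)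
    congr 1
    field_simp
  have h := (hasSum_betaIntegral hx hc two_pos hsum).mul_left (2 ^ (c - 1) / sqrtPi)
  have hs' : 0 < (c / 2 + (c / 2 + 1 / 2) - x / 2 - (x / 2 + 1 / 2) - b).re := by
    rwa [show c / 2 + (c / 2 + 1 / 2) - x / 2 - (x / 2 + 1 / 2) - b = c - x - b by ring]
  have h4 := (summable_regTerm hs').hasSum.mul_left (Γ x * Γ (c - x))
  have h5 := hterm hx hc
  simp only [add_sub_cancel] at h5
  simp only [h5] at h4
  rw [← h4.unique h, regSum, mul_comm]

theorem ofReal_cpow_eq_exp {p : ℝ} (hp : 0 < p) (z : ℂ) :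
    (p : ℂ) ^ z = Complex.exp (Real.log p * z) := by
  rw [Complex.cpow_def_of_ne_zero (by exact_mod_cast hp.ne'), Complex.ofReal_log hp.le]

-- Substitute t = (1-v)/(1+v) with v = √u, so that 1-t = 2v/(1+v) and 1-t² = 4v/(1+v)². The exponent
-- 2b-2x+1 is the one for which the powers of 1+v and 1-v, Jacobian included, combine to
-- (1-v)(1-u)^{x-2}. The factor 1-√u then splits the integral into two Beta integrals.
open MeasureTheory in
theorem integral_quadratic {x b : ℂ} (hx : 1 < x.re) (hb : 0 < (b - 2 * x + 2).re) :
    ∫ t in Set.Ioo (0 : ℝ) 1,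
        (t : ℂ) ^ (x - 1) * (1 - (t : ℂ)) ^ (2 * b - 2 * x + 1) * (1 - (t : ℂ) ^ 2) ^ (-b) =
      2 ^ (1 - 2 * x) * (Complex.betaIntegral (b / 2 + 1 - x) (x - 1) -
        Complex.betaIntegral (b / 2 + 3 / 2 - x) (x - 1)) := by
  let φ : ℝ → ℝ := fun u => (1 - √u) / (1 + √u)
  let φ' : ℝ → ℝ := fun u => -(1 / (√u * (1 + √u) ^ 2))
  have hder : ∀ u ∈ Set.Ioo (0 : ℝ) 1, HasDerivWithinAt φ (φ' u) (Set.Ioo 0 1) u := by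
    intro u hu
    have hv := Real.sqrt_pos.2 hu.1
    have h1 := Real.hasDerivAt_sqrt hu.1.ne'
    have h2 : HasDerivAt φ ((-(1 / (2 * √u)) * (1 + √u) - (1 - √u) * (1 / (2 * √u))) /
        (1 + √u) ^ 2) u :=
      (h1.const_sub 1).div (h1.const_add 1) (by positivity)
    convert! h2.hasDerivWithinAt using 1
    simp only [φ']
    field_simp
    ring
  -- The map v ↦ (1-v)/(1+v) is an involution, which gives both injectivity and surjectivity of `φ`.
  have hinv : ∀ v : ℝ, 0 < v → (1 - (1 - v) / (1 + v)) / (1 + (1 - v) / (1 + v)) = v := by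
    intro v hv
    field_simp
    ring
  have hinj : Set.InjOn φ (Set.Ioo 0 1) := by
    intro u hu w hw h
    have h1 := hinv _ (Real.sqrt_pos.2 hu.1)
    have h2 := hinv _ (Real.sqrt_pos.2 hw.1)
    simp only [φ] at h
    rw [h, h2] at h1
    exact ((Real.sqrt_inj hw.1.le hu.1.le).1 h1).symm
  have himg : φ '' Set.Ioo 0 1 = Set.Ioo 0 1 := by
    ext t
    constructor
    · rintro ⟨u, hu, rfl⟩
      have hv := Real.sqrt_pos.2 hu.1
      have hv1 : √u < 1 := by rw [Real.sqrt_lt' one_pos]; simpa using hu.2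
      simp only [φ]
      constructor
      · exact div_pos (by linarith) (by linarith)
      · rw [div_lt_one (by linarith)]; linarith
    · rintro ⟨ht0, ht1⟩
      have hv : 0 < (1 - t) / (1 + t) := div_pos (by linarith) (by linarith)
      have hv1 : (1 - t) / (1 + t) < 1 := by rw [div_lt_one (by linarith)]; linarith
      refine ⟨((1 - t) / (1 + t)) ^ 2, ⟨by positivity, by nlinarith⟩, ?_⟩
      simp only [φ]
      rw [Real.sqrt_sq hv.le]
      exact hinv t ht0
  have hbeta : ∀ u v : ℂ, Complex.betaIntegral u v =
      ∫ t in Set.Ioo (0 : ℝ) 1, (t : ℂ) ^ (u - 1) * (1 - (t : ℂ)) ^ (v - 1) := by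
    intro u v
    rw [Complex.betaIntegral, intervalIntegral.integral_of_le zero_le_one,
      integral_Ioc_eq_integral_Ioo]
  have hint : ∀ u v : ℂ, 0 < u.re → 0 < v.re → IntegrableOn
      (fun t : ℝ => (t : ℂ) ^ (u - 1) * (1 - (t : ℂ)) ^ (v - 1)) (Set.Ioo 0 1) := by
    intro u v hu hv
    have := Complex.betaIntegral_convergent hu hv
    rw [intervalIntegrable_iff_integrableOn_Ioo_of_le zero_le_one] at this
    exact this
  have hcv := integral_image_eq_integral_abs_deriv_smul measurableSet_Ioo hder hinj
    (fun t : ℝ => (t : ℂ) ^ (x - 1) * (1 - (t : ℂ)) ^ (2 * b - 2 * x + 1) *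
      (1 - (t : ℂ) ^ 2) ^ (-b))
  rw [himg] at hcv
  have hI1 := hint (b / 2 + 1 - x) (x - 1) (by simp at hb ⊢; linarith) (by simpa using hx)
  have hI2 := hint (b / 2 + 3 / 2 - x) (x - 1)
    (by rw [show b / 2 + 3 / 2 - x = (b - 2 * x + 2) / 2 + 1 / 2 by ring]
        simp at hb ⊢; linarith) (by simpa using hx)
  rw [hcv, hbeta, hbeta, ← integral_sub hI1 hI2, ← integral_const_mul]
  refine setIntegral_congr_fun measurableSet_Ioo fun u hu => ?_
  have hv := Real.sqrt_pos.2 hu.1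
  have hv1 : √u < 1 := by rw [Real.sqrt_lt' one_pos]; simpa using hu.2
  obtain ⟨v, hvdef⟩ : ∃ v, v = √u := ⟨_, rfl⟩
  have huv : u = v ^ 2 := by rw [hvdef, Real.sq_sqrt hu.1.le]
  rw [← hvdef] at hv hv1
  have hp1 : 0 < 1 + v := by linarith
  have hm1 : 0 < 1 - v := by linarith
  simp only [φ, φ', huv, Real.sqrt_sq hv.le]
  have e0 : |-(1 / (v * (1 + v) ^ 2))| = 1 / (v * (1 + v) ^ 2) := by
    rw [abs_neg, abs_of_pos (by positivity)]
  have e1 : 1 - (((1 - v) / (1 + v) : ℝ) : ℂ) = ((2 * v / (1 + v) : ℝ) : ℂ) := by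
    rw [← Complex.ofReal_one, ← Complex.ofReal_sub]
    congr 1
    field_simp
    ring
  have e2 : 1 - (((1 - v) / (1 + v) : ℝ) : ℂ) ^ 2 = ((4 * v / (1 + v) ^ 2 : ℝ) : ℂ) := by
    rw [← Complex.ofReal_one, ← Complex.ofReal_pow, ← Complex.ofReal_sub]
    congr 1
    field_simp
    ring
  have e3 : 1 - ((v ^ 2 : ℝ) : ℂ) = (((1 - v) * (1 + v) : ℝ) : ℂ) := by push_cast; ring
  have e4 : ((1 / (v * (1 + v) ^ 2) : ℝ) : ℂ) = Complex.exp (-(Real.log v + 2 * Real.log (1 + v))) := by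
    have : (1 / (v * (1 + v) ^ 2) : ℝ) = Real.exp (-(Real.log v + 2 * Real.log (1 + v))) := by
      rw [Real.exp_neg, Real.exp_add, Real.exp_log hv, two_mul, Real.exp_add, Real.exp_log hp1]
      field_simp
    rw [this]
    push_cast
    rfl
  have e5 : Real.log 4 = 2 * Real.log 2 := by
    rw [show (4 : ℝ) = 2 ^ 2 by norm_num, Real.log_pow]; norm_num
  have e6 : (2 : ℂ) ^ (1 - 2 * x) = Complex.exp (Real.log 2 * (1 - 2 * x)) := by
    rw [← ofReal_cpow_eq_exp two_pos]; norm_num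
  -- All bases are positive, so every power becomes the exponential of a combination of log 2, log v
  -- and log(1±v); comparing exponents is then linear in these.
  rw [e0, Complex.real_smul, e1, e2, e3, e4, e6, ofReal_cpow_eq_exp (by positivity),
    ofReal_cpow_eq_exp (by positivity), ofReal_cpow_eq_exp (by positivity),
    ofReal_cpow_eq_exp (by positivity), ofReal_cpow_eq_exp (by positivity),
    ofReal_cpow_eq_exp (by positivity), Real.log_div hm1.ne' hp1.ne',
    Real.log_div (by positivity) hp1.ne', Real.log_mul two_ne_zero hv.ne',
    Real.log_div (by positivity) (by positivity), Real.log_mul (by norm_num) hv.ne', Real.log_pow,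
    Real.log_pow, Real.log_mul hm1.ne' hp1.ne', e5]
  push_cast
  have e7 : Complex.exp (2 * Real.log v * (b / 2 + 3 / 2 - x - 1)) =
      v * Complex.exp (2 * Real.log v * (b / 2 + 1 - x - 1)) := by
    have : (v : ℂ) = Complex.exp (Real.log v) := by
      rw [← Complex.ofReal_exp, Real.exp_log hv]
    rw [this, ← Complex.exp_add]
    congr 1
    ring
  have e8 : (1 - (v : ℂ)) = Complex.exp (Real.log (1 - v)) := by
    rw [← Complex.ofReal_exp, Real.exp_log hm1]
    push_cast
    rfl
  rw [e7, mul_assoc (v : ℂ), ← one_sub_mul, e8]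
  simp only [← Complex.exp_add]
  congr 1
  ring

/-- Used with p = b/2+1-x: each of the two Gammas in the Beta values becomes the reciprocal of the
other times a common factor, which leaves an expression entire in the parameters. -/
theorem Gamma_ratio_quadratic {p s : ℂ} (hp : s = 2 * p) (hs : 0 < s.re) :
    Γ p = Γ s * 2 ^ (1 - s) * sqrtPi * rGamma (p + 1 / 2) ∧
      Γ (p + 1 / 2) = Γ s * 2 ^ (1 - s) * sqrtPi * rGamma p := by
  subst hp
  have hp : 0 < p.re := by simpa using hs
  have g1 := Gamma_mul_rGamma (reg_of_re_pos hp)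
  have g2 := Gamma_mul_rGamma (reg_of_re_pos (z := p + 1 / 2) (by simp; linarith))
  have h := Gamma_duplication p
  constructor
  · linear_combination rGamma (p + 1 / 2) * h - Γ p * g2
  · linear_combination rGamma p * h - Γ (p + 1 / 2) * g1

/-- The hypotheses make the Euler integral and both Beta integrals converge. Γ(x-1) is common to
both Beta values, and the factor x-1 is what remains of Γ(x) = (x-1)Γ(x-1). -/
theorem reg3F2_quadratic_aux {x b : ℂ} (hx : 1 < x.re) (hb : 0 < (b - 2 * x + 2).re)
    (hb' : 0 < (2 * b - 2 * x + 2).re) :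
    (x - 1) * reg3F2 (x / 2) (x / 2 + 1 / 2) b (b + 1 - x / 2) (b + 3 / 2 - x / 2) =
      2 ^ (b - x + 1) * rGamma (2 * b - 2 * x + 2) *
        (rGamma (b / 2) * rGamma (b / 2 + 3 / 2 - x) -
          rGamma (b / 2 + 1 / 2) * rGamma (b / 2 + 1 - x)) := by
  have hx0 : 0 < x.re := by linarith
  have h := regSum_quadratic (x := x) (b := b) (c := 2 * b - x + 2) hx0
    (by rwa [show 2 * b - x + 2 - x = 2 * b - 2 * x + 2 by ring])
    (by rwa [show 2 * b - x + 2 - x - b = b - 2 * x + 2 by ring])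
  rw [show 2 * b - x + 2 - x - 1 = 2 * b - 2 * x + 1 by ring, integral_quadratic hx hb,
    betaIntegral_eq (by simp at hb ⊢; linarith) (by simpa using hx),
    betaIntegral_eq (by rw [show b / 2 + 3 / 2 - x = (b - 2 * x + 2) / 2 + 1 / 2 by ring]
                        simp at hb ⊢; linarith) (by simpa using hx),
    show b / 2 + 1 - x + (x - 1) = b / 2 by ring,
    show b / 2 + 3 / 2 - x + (x - 1) = b / 2 + 1 / 2 by ring,
    show (2 * b - x + 2) / 2 = b + 1 - x / 2 by ring,
    show b + 1 - x / 2 + 1 / 2 = b + 3 / 2 - x / 2 by ring,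
    show 2 * b - x + 2 - x = 2 * b - 2 * x + 2 by ring] at h
  obtain ⟨d1, d2⟩ := Gamma_ratio_quadratic (p := b / 2 + 1 - x) (s := b - 2 * x + 2) (by ring) hb
  rw [show b / 2 + 1 - x + 1 / 2 = b / 2 + 3 / 2 - x by ring] at d1 d2
  have hxm : 0 < (x - 1).re := by simpa using hx
  have hG : Γ x = (x - 1) * Γ (x - 1) := by
    rw [← Complex.Gamma_add_one _ (fun h0 => by rw [h0] at hxm; simp at hxm), sub_add_cancel]
  have es : b + 1 - x / 2 + (b + 3 / 2 - x / 2) - x / 2 - (x / 2 + 1 / 2) - b = b - 2 * x + 2 := by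
    ring
  rw [reg3F2_eq_regSum (by rwa [es]), es]
  set S := regSum (x / 2) (x / 2 + 1 / 2) b (b + 1 - x / 2) (b + 3 / 2 - x / 2)
  have g1 := Gamma_mul_rGamma (reg_of_re_pos hxm)
  have g2 := Gamma_mul_rGamma (reg_of_re_pos hb')
  have g3 := Gamma_mul_rGamma (reg_of_re_pos hb)
  have hpow : (2 : ℂ) ^ (2 * b - x + 2 - 1) * 2 ^ (1 - 2 * x) * 2 ^ (1 - (b - 2 * x + 2)) =
      2 ^ (b - x + 1) := by
    rw [← Complex.cpow_add _ _ two_ne_zero, ← Complex.cpow_add _ _ two_ne_zero]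
    congr 1
    ring
  have hpi := mul_inv_cancel₀ sqrtPi_ne_zero
  rw [hG, d1, d2, div_eq_mul_inv] at h
  rw [← hpow]
  set P := (2 : ℂ) ^ (2 * b - x + 2 - 1)
  set Q := (2 : ℂ) ^ (1 - 2 * x)
  set W := (2 : ℂ) ^ (1 - (b - 2 * x + 2))
  set B := rGamma (b / 2) * rGamma (b / 2 + 3 / 2 - x) -
          rGamma (b / 2 + 1 / 2) * rGamma (b / 2 + 1 - x)
  have h' : S * ((x - 1) * Γ (x - 1) * Γ (2 * b - 2 * x + 2)) =
      P * Q * W * B * (Γ (b - 2 * x + 2) * Γ (x - 1)) := by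
    linear_combination h + P * Q * W * B * (Γ (b - 2 * x + 2) * Γ (x - 1)) * hpi
  set r1 := rGamma (x - 1)
  set r2 := rGamma (2 * b - 2 * x + 2)
  set r3 := rGamma (b - 2 * x + 2)
  linear_combination r1 * r2 * r3 * h' - S * (x - 1) * r3 * (Γ (2 * b - 2 * x + 2) * r2 * g1 + g2) +
    P * Q * W * B * r2 * (Γ (b - 2 * x + 2) * r3 * g1 + g3)

theorem reg3F2_quadratic (x b : ℂ) :
    (x - 1) * reg3F2 (x / 2) (x / 2 + 1 / 2) b (b + 1 - x / 2) (b + 3 / 2 - x / 2) =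
      2 ^ (b - x + 1) * rGamma (2 * b - 2 * x + 2) *
        (rGamma (b / 2) * rGamma (b / 2 + 3 / 2 - x) -
          rGamma (b / 2 + 1 / 2) * rGamma (b / 2 + 1 - x)) := by
  -- Continuation along the complex line through (2, 10), an interior point of the region already
  -- treated, which reaches (x, b) at w = 1.
  let X : ℂ → ℂ := fun w => 2 + w * (x - 2)
  let B : ℂ → ℂ := fun w => 10 + w * (b - 10)
  have hX : Differentiable ℂ X := by fun_prop
  have hB : Differentiable ℂ B := by fun_prop
  let F : ℂ → ℂ := fun w => (X w - 1) *
    reg3F2 (X w / 2) (X w / 2 + 1 / 2) (B w) (B w + 1 - X w / 2) (B w + 3 / 2 - X w / 2)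
  let G : ℂ → ℂ := fun w => 2 ^ (B w - X w + 1) * rGamma (2 * B w - 2 * X w + 2) *
        (rGamma (B w / 2) * rGamma (B w / 2 + 3 / 2 - X w) -
          rGamma (B w / 2 + 1 / 2) * rGamma (B w / 2 + 1 - X w))
  have hF : Differentiable ℂ F := (by fun_prop : Differentiable ℂ fun w => X w - 1).mul
    (Differentiable.reg3F2_comp (by fun_prop) (by fun_prop) (by fun_prop) (by fun_prop)
      (by fun_prop))
  have hG : Differentiable ℂ G := by
    have e1 : Differentiable ℂ fun w => (2 : ℂ) ^ (B w - X w + 1) :=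
      Differentiable.const_cpow (by fun_prop) (Or.inl two_ne_zero)
    exact (e1.mul (Differentiable.rGamma_comp (by fun_prop))).mul
      (((Differentiable.rGamma_comp (by fun_prop)).mul
        (Differentiable.rGamma_comp (by fun_prop))).sub
        ((Differentiable.rGamma_comp (by fun_prop)).mul
        (Differentiable.rGamma_comp (by fun_prop))))
  have hFa : AnalyticOnNhd ℂ F Set.univ := fun z _ => hF.analyticAt z
  have hGa : AnalyticOnNhd ℂ G Set.univ := fun z _ => hG.analyticAt z
  have hev : F =ᶠ[𝓝 0] G := by
    have c1 : Continuous fun w => (X w).re := Complex.continuous_re.comp hX.continuous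
    have c2 : Continuous fun w => (B w - 2 * X w + 2).re :=
      Complex.continuous_re.comp (by fun_prop)
    have c3 : Continuous fun w => (2 * B w - 2 * X w + 2).re :=
      Complex.continuous_re.comp (by fun_prop)
    filter_upwards [c1.continuousAt.eventually_const_lt (show 1 < (X 0).re by simp [X]),
      c2.continuousAt.eventually_const_lt (show 0 < (B 0 - 2 * X 0 + 2).re by simp [X, B]; norm_num),
      c3.continuousAt.eventually_const_lt
        (show 0 < (2 * B 0 - 2 * X 0 + 2).re by simp [X, B]; norm_num)] with w h1 h2 h3
    exact reg3F2_quadratic_aux h1 h2 h3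
  have := congrFun (hFa.eq_of_eventuallyEq hGa hev) 1
  simpa [F, G, X, B] using this

/-! ### Recurrence in c when the third upper parameter is 1. -/

/-- Contiguous relation for `₃F₂(x/2, (x+1)/2, 1; c/2, (c+1)/2)`. -/
theorem reg3F2_quadratic_one_contiguous (x c : ℂ) :
    (c - x) * (c - x - 1) *
        reg3F2 (x / 2) (x / 2 + 1 / 2) 1 ((c + 1) / 2) ((c + 1) / 2 + 1 / 2) =
      4 * reg3F2 (x / 2) (x / 2 + 1 / 2) 1 (c / 2) (c / 2 + 1 / 2) -
        2 ^ c * rGamma (c - 1) * rGamma (c - x) / sqrtPi := by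
  have main : ∀ {c : ℂ}, 0 < (c - x - 1).re → (c - x) * (c - x - 1) *
        reg3F2 (x / 2) (x / 2 + 1 / 2) 1 ((c + 1) / 2) ((c + 1) / 2 + 1 / 2) =
      4 * reg3F2 (x / 2) (x / 2 + 1 / 2) 1 (c / 2) (c / 2 + 1 / 2) -
        2 ^ c * rGamma (c - 1) * rGamma (c - x) / sqrtPi := by
    intro c hs
    have es : c / 2 + (c / 2 + 1 / 2) - x / 2 - (x / 2 + 1 / 2) - 1 = c - x - 1 := by ring
    have es' : (c + 1) / 2 + ((c + 1) / 2 + 1 / 2) - x / 2 - (x / 2 + 1 / 2) - 1 = c - x := by ring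
    have hs1 : 0 < (c - x).re := by simp at hs ⊢; linarith
    have t1 := (summable_regTerm (by rwa [es])).hasSum
    have t2 := (summable_regTerm (by rwa [es'])).hasSum
    have hone : ∀ k : ℕ, poch 1 k / (k.factorial : ℂ) = 1 := by
      intro k
      have hk : (k.factorial : ℂ) ≠ 0 := by exact_mod_cast k.factorial_ne_zero
      rw [poch, ascPochhammer_eval_one, div_self hk]
    have hT : ∀ c : ℂ, ∀ k : ℕ, regTerm (x / 2) (x / 2 + 1 / 2) 1 (c / 2) (c / 2 + 1 / 2) k =
        2 ^ (c - 1) / sqrtPi * (poch x (2 * k) * rGamma (c + 2 * k)) := by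
      intro c k
      rw [regTerm_quadratic, hone, one_mul]
    -- The terms telescope since (c-x-1)(c+x+4k) = (c-1+2k)(c+2k) - (x+2k)(x+2k+1). The value `G 0`
    -- survives as the inhomogeneous term.
    let G : ℕ → ℂ := fun k => 2 ^ (c - 1) / sqrtPi * (poch x (2 * k) * rGamma (c - 1 + 2 * k))
    have h2c : (2 : ℂ) ^ c = 2 * 2 ^ (c - 1) := by
      rw [Complex.cpow_sub _ _ two_ne_zero, Complex.cpow_one]
      ring
    have hstep : ∀ k : ℕ, (c - x - 1) *
        (2 * regTerm (x / 2) (x / 2 + 1 / 2) 1 (c / 2) (c / 2 + 1 / 2) k) - (c - x - 1) *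
          ((c - x) / 2 * regTerm (x / 2) (x / 2 + 1 / 2) 1 ((c + 1) / 2) ((c + 1) / 2 + 1 / 2) k) =
        G k - G (k + 1) := by
      intro k
      rw [hT, hT, add_sub_cancel_right, h2c]
      simp only [G]
      rw [show 2 * (k + 1) = 2 * k + 1 + 1 by ring, poch_succ, poch_succ,
        rGamma_eq_mul (c - 1 + 2 * k), show c - 1 + 2 * (k : ℂ) + 1 = c + 2 * k by ring,
        rGamma_eq_mul (c + 2 * k), show c - 1 + 2 * ((k + 1 : ℕ) : ℂ) = c + 2 * k + 1 by
          push_cast; ring, show c + 1 + 2 * (k : ℂ) = c + 2 * k + 1 by ring]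
      push_cast
      ring
    have hlim : Tendsto G atTop (𝓝 0) := by
      have h1 := (tendsto_mul_regTerm (a := x / 2) (b := x / 2 + 1 / 2) (c := 1) (e := c / 2)
        (f := c / 2 + 1 / 2) (by rwa [es])).const_mul 2
      have h2 := ((summable_regTerm (a := x / 2) (b := x / 2 + 1 / 2) (c := 1) (e := c / 2)
        (f := c / 2 + 1 / 2) (by rwa [es])).tendsto_atTop_zero).const_mul (c - 1)
      have h3 := h1.add h2
      simp only [mul_zero, add_zero] at h3
      refine h3.congr fun k => ?_
      simp only [hT, G]
      rw [rGamma_eq_mul (c - 1 + 2 * k), show c - 1 + 2 * (k : ℂ) + 1 = c + 2 * k by ring]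
      ring
    have hsum := ((t1.mul_left 2).mul_left (c - x - 1)).sub
      ((t2.mul_left ((c - x) / 2)).mul_left (c - x - 1))
    have htel : Tendsto (fun n => ∑ k ∈ Finset.range n, (G k - G (k + 1))) atTop (𝓝 (G 0)) := by
      simp only [Finset.sum_range_sub']
      simpa using hlim.const_sub (G 0)
    have hfin := tendsto_nhds_unique hsum.tendsto_sum_nat (htel.congr fun n =>
      Finset.sum_congr rfl fun k _ => (hstep k).symm)
    rw [reg3F2_eq_regSum (by rwa [es']), reg3F2_eq_regSum (by rwa [es]), es, es', regSum, regSum]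
    have hG0 : G 0 = 2 ^ (c - 1) / sqrtPi * rGamma (c - 1) := by simp [G, poch_zero]
    rw [hG0] at hfin
    rw [rGamma_eq_mul (c - x - 1), sub_add_cancel, h2c]
    linear_combination (-2 * rGamma (c - x)) * hfin
  have hd : ∀ d : ℂ, Differentiable ℂ fun w =>
      reg3F2 (x / 2) (x / 2 + 1 / 2) 1 ((c + w + d) / 2) ((c + w + d) / 2 + 1 / 2) := fun d =>
    Differentiable.reg3F2_comp (by fun_prop) (by fun_prop) (by fun_prop) (by fun_prop) (by fun_prop)
  have e1 : Differentiable ℂ fun w => (c + w - x) * (c + w - x - 1) *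
        reg3F2 (x / 2) (x / 2 + 1 / 2) 1 ((c + w + 1) / 2) ((c + w + 1) / 2 + 1 / 2) :=
    (by fun_prop : Differentiable ℂ fun w => (c + w - x) * (c + w - x - 1)).mul (hd 1)
  have e2 : Differentiable ℂ fun w =>
      4 * reg3F2 (x / 2) (x / 2 + 1 / 2) 1 ((c + w) / 2) ((c + w) / 2 + 1 / 2) -
        2 ^ (c + w) * rGamma (c + w - 1) * rGamma (c + w - x) / sqrtPi := by
    have h1 := hd 0
    simp only [add_zero] at h1
    have h3 : Differentiable ℂ fun w => (2 : ℂ) ^ (c + w) :=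
      Differentiable.const_cpow (by fun_prop) (Or.inl two_ne_zero)
    exact (h1.const_mul 4).sub (((h3.mul (Differentiable.rGamma_comp (by fun_prop))).mul
      (Differentiable.rGamma_comp (by fun_prop))).div_const _)
  have := eq_of_eqOn_halfPlane e1 e2 (-(c - x - 1).re) (fun w hw => main ?_) 0
  · simpa using this
  · simp at hw ⊢
    linarith

/-! ### Solution of the recurrence by alternating sums, for non-real x. -/

theorem reg_of_im_ne_zero {z : ℂ} (h : z.im ≠ 0) : Reg z := by
  rintro m rfl
  simp at h

/-- Reflection formula together with sin π(x+n) = (-1)^n sin πx. -/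
theorem Gamma_reflection_add_nat (x : ℂ) (n : ℕ) :
    Γ (x + n) * Γ (1 - n - x) = (-1) ^ n * (Γ x * Γ (1 - x)) := by
  have h1 := Complex.Gamma_mul_Gamma_one_sub (x + n)
  rw [show 1 - (x + (n : ℂ)) = 1 - n - x by ring, show (Real.pi : ℂ) * (x + n) =
    Real.pi * x + n * Real.pi by ring, Complex.sin_antiperiodic.add_nat_mul_eq] at h1
  rw [h1, Complex.Gamma_mul_Gamma_one_sub, mul_comm ((-1 : ℂ) ^ n) (Complex.sin _),
    ← div_div, div_eq_mul_inv _ ((-1 : ℂ) ^ n), ← inv_pow, inv_neg_one, mul_comm]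

/-- Summation by parts against (-1)^k; it carries the alternating sum of one level to that of the
next. -/
theorem sum_alternating_sub (p : ℕ → ℂ) (n : ℕ) :
    ∑ k ∈ Finset.range n, (-1 : ℂ) ^ k * (p k - p (k + 1)) =
      2 * ∑ k ∈ Finset.range (n + 1), (-1 : ℂ) ^ k * p k - p 0 - (-1) ^ n * p n := by
  induction n with
  | zero => simp; ring
  | succ n ih =>
    rw [Finset.sum_range_succ, ih, Finset.sum_range_succ _ (n + 1)]
    ring

/-- The function `₃F₂(x/2, (x+1)/2, 1; c/2, (c+1)/2)`, regularized. -/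
noncomputable def quadOne (x c : ℂ) : ℂ :=
  reg3F2 (x / 2) (x / 2 + 1 / 2) 1 (c / 2) (c / 2 + 1 / 2)

theorem quadOne_contiguous (x c : ℂ) :
    (c - x) * (c - x - 1) * quadOne x (c + 1) =
      4 * quadOne x c - 2 ^ c * rGamma (c - 1) * rGamma (c - x) / sqrtPi :=
  reg3F2_quadratic_one_contiguous x c

theorem two_cpow_add_one {y z : ℂ} (h : z = y + 1) : (2 : ℂ) ^ z = 2 * 2 ^ y := by
  rw [h, Complex.cpow_add _ _ two_ne_zero, Complex.cpow_one, mul_comm]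

theorem rGamma_sub_of_eq {y z : ℂ} (h : z = y + 1) : rGamma y = y * rGamma z := by
  rw [h, ← rGamma_eq_mul]

theorem im_ne {x z : ℂ} (hx : x.im ≠ 0) (t : ℝ) (ht : t ≠ 0) (h : z.im = t * x.im) : Reg z :=
  reg_of_im_ne_zero (by rw [h]; exact mul_ne_zero ht hx)

/-- `reg3F2_quadratic` with b = 1 gives c = 4-x. One step down, its 1/Γ(2-x) part cancels the
inhomogeneous term and a single product remains, written here as the case of an empty sum in the
formulas that follow. -/
theorem quadOne_base {x : ℂ} (hx : x.im ≠ 0) :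
    quadOne x (3 - x) * sqrtPi = 2 ^ (1 - x) * rGamma (3 - 2 * x) * rGamma x *
      (2 ^ (1 - 2 * x) * Γ x * Γ (1 - x) * rGamma (2 - 2 * x)) := by
  have h1 := quadOne_contiguous x (3 - x)
  have h2 := reg3F2_quadratic x 1
  have e : quadOne x (3 - x + 1) =
      reg3F2 (x / 2) (x / 2 + 1 / 2) 1 (1 + 1 - x / 2) (1 + 3 / 2 - x / 2) := by
    unfold quadOne
    congr 1 <;> ring
  rw [← e] at h2
  have hG1 : rGamma (1 / 2) = sqrtPi⁻¹ := by
    rw [rGamma, Complex.Gamma_one_half_eq, sqrtPi, Real.sqrt_eq_rpow,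
      Complex.ofReal_cpow Real.pi_pos.le]
    norm_num
  have hG2 : rGamma (1 / 2 + 1 / 2) = 1 := by norm_num [rGamma]
  rw [hG1, hG2, show 2 * (1 : ℂ) - 2 * x + 2 = 4 - 2 * x by ring,
    show (1 : ℂ) / 2 + 3 / 2 - x = 2 - x by ring, show (1 : ℂ) / 2 + 1 - x = 3 / 2 - x by ring] at h2
  rw [show 3 - x - x = 3 - 2 * x by ring, show 3 - 2 * x - 1 = 2 - 2 * x by ring,
    show 3 - x - 1 = 2 - x by ring] at h1
  have hr : rGamma (3 - 2 * x) = (3 - 2 * x) * rGamma (4 - 2 * x) := rGamma_sub_of_eq (by ring)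
  have p1 : (2 : ℂ) ^ (3 - x) = 2 * (2 * 2 ^ (1 - x)) := by
    rw [two_cpow_add_one (y := 2 - x) (by ring), two_cpow_add_one (y := 1 - x) (by ring)]
  have p2 : (2 : ℂ) ^ (1 - x + 1) = 2 * 2 ^ (1 - x) := two_cpow_add_one rfl
  rw [p2] at h2
  rw [p1, div_eq_mul_inv] at h1
  have g1 := Gamma_mul_rGamma (im_ne (z := x) hx 1 one_ne_zero (by simp))
  have g2 := Gamma_mul_rGamma (im_ne (z := 2 - 2 * x) hx (-2) (by norm_num) (by simp))
  have g3 := Gamma_mul_rGamma (im_ne (z := 3 / 2 - x) hx (-1) (by norm_num) (by simp))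
  have hd := Gamma_duplication (1 - x)
  rw [show 1 - x + 1 / 2 = 3 / 2 - x by ring, show 2 * (1 - x) = 2 - 2 * x by ring] at hd
  have p3 : (2 : ℂ) ^ (1 - 2 * x) * 2 ^ (1 - (2 - 2 * x)) = 1 := by
    rw [← Complex.cpow_add _ _ two_ne_zero, show 1 - 2 * x + (1 - (2 - 2 * x)) = 0 by ring,
      Complex.cpow_zero]
  have hpi := mul_inv_cancel₀ sqrtPi_ne_zero
  have key : quadOne x (3 - x) = 2 ^ (1 - x) * rGamma (3 - 2 * x) * rGamma (3 / 2 - x) := by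
    linear_combination (-1 / 4) * h1 + (-(3 - 2 * x) / 2) * h2 + (2 ^ (1 - x) * (rGamma (3 / 2 - x) -
      rGamma (2 - x) * sqrtPi⁻¹)) * hr * (-1)
  have key2 : 2 ^ (1 - 2 * x) * Γ (1 - x) * rGamma (2 - 2 * x) = rGamma (3 / 2 - x) * sqrtPi := by
    linear_combination 2 ^ (1 - 2 * x) * rGamma (2 - 2 * x) * rGamma (3 / 2 - x) * hd -
      2 ^ (1 - 2 * x) * Γ (1 - x) * rGamma (2 - 2 * x) * g3 +
      (rGamma (3 / 2 - x) * sqrtPi * 2 ^ (1 - 2 * x) * 2 ^ (1 - (2 - 2 * x))) * g2 +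
      rGamma (3 / 2 - x) * sqrtPi * p3
  rw [key]
  linear_combination -2 ^ (1 - x) * rGamma (3 - 2 * x) * key2 - (2 ^ (1 - x) * rGamma (3 - 2 * x) *
    (2 ^ (1 - 2 * x) * Γ (1 - x) * rGamma (2 - 2 * x))) * g1

/-- Induction with the recurrence solved for the smaller c. For p_k = Γ(x+k)/Γ(1-n-x+k) the
difference p_k - p_{k+1} is 1-n-2x, a factor free of k, times the summand of level n. Hence
summation by parts produces the sum of level n+1. -/
theorem quadOne_down {x : ℂ} (hx : x.im ≠ 0) (n : ℕ) :
    quadOne x (3 - x - n) * sqrtPi = 2 ^ (1 - x - n) * rGamma (3 - 2 * x - n) * rGamma x *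
      (2 ^ (1 - n - 2 * x) * Γ x * Γ (1 - x) * rGamma (2 - n - 2 * x) +
        ∑ k ∈ Finset.range n, (-1 : ℂ) ^ k * (Γ (x + k) * rGamma (2 - n - x + k))) := by
  induction n with
  | zero => simpa using quadOne_base hx
  | succ n ih =>
    have h1 := quadOne_contiguous x (2 - x - n)
    have hs : (1 - n - 2 * x) *
        ∑ k ∈ Finset.range n, (-1 : ℂ) ^ k * (Γ (x + k) * rGamma (2 - n - x + k)) =
        2 * ∑ k ∈ Finset.range (n + 1), (-1 : ℂ) ^ k * (Γ (x + k) * rGamma (1 - n - x + k)) -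
          2 * (Γ x * rGamma (1 - n - x)) := by
      have h2 := sum_alternating_sub (fun k : ℕ => Γ (x + k) * rGamma (1 - n - x + k)) n
      -- By reflection the two end terms of the summation by parts are equal; together they absorb
      -- the inhomogeneous term.
      have h3 : Γ (x + n) * rGamma (1 - n - x + n) * (-1) ^ n = Γ x * rGamma (1 - n - x) := by
        have g1 := Gamma_mul_rGamma (im_ne (z := 1 - x) hx (-1) (by norm_num) (by simp))
        have g2 := Gamma_mul_rGamma (im_ne (z := 1 - n - x) hx (-1) (by norm_num) (by simp))
        have hr := Gamma_reflection_add_nat x n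
        have hsq : ((-1 : ℂ) ^ n) * (-1) ^ n = 1 := by rw [← mul_pow]; simp
        rw [show 1 - (n : ℂ) - x + n = 1 - x by ring]
        linear_combination (-1) ^ n * rGamma (1 - x) * rGamma (1 - n - x) * hr -
          (Γ (x + n) * rGamma (1 - x) * (-1) ^ n) * g2 +
          Γ x * rGamma (1 - n - x) * (-1) ^ n * (-1) ^ n * g1 + Γ x * rGamma (1 - n - x) * hsq
      simp only [Nat.cast_zero, add_zero] at h2
      have h4 : (1 - n - 2 * x) *
          ∑ k ∈ Finset.range n, (-1 : ℂ) ^ k * (Γ (x + k) * rGamma (2 - n - x + k)) =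
          ∑ k ∈ Finset.range n, (-1 : ℂ) ^ k * (Γ (x + k) * rGamma (1 - n - x + k) -
            Γ (x + (k + 1 : ℕ)) * rGamma (1 - n - x + (k + 1 : ℕ))) := by
        rw [Finset.mul_sum]
        refine Finset.sum_congr rfl fun k _ => ?_
        have h5 : Γ (x + (k + 1 : ℕ)) = (x + k) * Γ (x + k) := by
          push_cast
          rw [← add_assoc]
          refine Complex.Gamma_add_one _ fun h0 => hx ?_
          simpa using congrArg Complex.im h0
        rw [h5, rGamma_sub_of_eq (y := 1 - n - x + k) (z := 2 - n - x + k) (by ring),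
          show 1 - (n : ℂ) - x + (k + 1 : ℕ) = 2 - n - x + k by push_cast; ring]
        ring
      rw [h4, h2]
      linear_combination -h3
    push_cast
    rw [show 3 - x - ((n : ℂ) + 1) = 2 - x - n by ring, show 1 - x - ((n : ℂ) + 1) = -x - n by ring,
      show 3 - 2 * x - ((n : ℂ) + 1) = 2 - 2 * x - n by ring,
      show 1 - ((n : ℂ) + 1) - 2 * x = -n - 2 * x by ring,
      show 2 - ((n : ℂ) + 1) - 2 * x = 1 - n - 2 * x by ring,
      show 2 - ((n : ℂ) + 1) - x = 1 - n - x by ring]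
    rw [show 2 - x - (n : ℂ) + 1 = 3 - x - n by ring,
      show 2 - x - (n : ℂ) - 1 = 1 - n - x by ring,
      show 2 - x - (n : ℂ) - x = 2 - 2 * x - n by ring,
      show 2 - 2 * x - (n : ℂ) - 1 = 1 - n - 2 * x by ring, div_eq_mul_inv] at h1
    have p1 : (2 : ℂ) ^ (1 - x - n) = 2 * 2 ^ (-x - n) := two_cpow_add_one (by ring)
    have p2 : (2 : ℂ) ^ (2 - x - n) = 2 * (2 * 2 ^ (-x - n)) := by
      rw [← p1]; exact two_cpow_add_one (by ring)
    have p3 : (2 : ℂ) ^ (1 - n - 2 * x) = 2 * 2 ^ (-n - 2 * x) := two_cpow_add_one (by ring)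
    have r1 : rGamma (2 - 2 * x - n) = (2 - 2 * x - n) * rGamma (3 - 2 * x - n) :=
      rGamma_sub_of_eq (by ring)
    have r2 : rGamma (1 - n - 2 * x) = (1 - n - 2 * x) * rGamma (2 - n - 2 * x) :=
      rGamma_sub_of_eq (by ring)
    have g1 := Gamma_mul_rGamma (im_ne (z := x) hx 1 one_ne_zero (by simp))
    have hpi := mul_inv_cancel₀ sqrtPi_ne_zero
    rw [p1, p3] at ih
    rw [p2, r1] at h1
    rw [r1, r2]
    set S := ∑ k ∈ Finset.range n, (-1 : ℂ) ^ k * (Γ (x + k) * rGamma (2 - n - x + k))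
    set T := ∑ k ∈ Finset.range (n + 1), (-1 : ℂ) ^ k * (Γ (x + k) * rGamma (1 - n - x + k))
    set R := rGamma (3 - 2 * x - n)
    set E := (2 : ℂ) ^ (-x - (n : ℂ))
    linear_combination (-sqrtPi / 4) * h1 + ((2 - 2 * x - n) * (1 - n - 2 * x) / 4) * ih +
      ((2 - 2 * x - n) * E * R * rGamma x / 2) * hs +
      (2 - 2 * x - n) * E * R * rGamma (1 - n - x) * (hpi - g1)

/-- The mirror induction, with c increasing and Gamma arguments descending. The coefficients
(3-2x+m)(2+m-2x) of the larger c must be cancelled, which is possible because x is not real. -/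
theorem quadOne_up {x : ℂ} (hx : x.im ≠ 0) (m : ℕ) :
    quadOne x (3 - x + m) * sqrtPi = 2 ^ (1 - x + m) * rGamma (3 - 2 * x + m) * rGamma x *
      (2 ^ (1 + m - 2 * x) * Γ x * Γ (1 - x) * rGamma (2 + m - 2 * x) +
        ∑ i ∈ Finset.range m, (-1 : ℂ) ^ i * (Γ (x - (i + 1 : ℕ)) * rGamma (2 + m - x - (i + 1 : ℕ)))) := by
  induction m with
  | zero => simpa using quadOne_base hx
  | succ m ih =>
    have h1 := quadOne_contiguous x (3 - x + m)
    have hs : (2 + m - 2 * x) * ∑ i ∈ Finset.range (m + 1), (-1 : ℂ) ^ i *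
        (Γ (x - (i + 1 : ℕ)) * rGamma (3 + m - x - (i + 1 : ℕ))) =
        2 * ∑ i ∈ Finset.range m, (-1 : ℂ) ^ i *
          (Γ (x - (i + 1 : ℕ)) * rGamma (2 + m - x - (i + 1 : ℕ))) -
          2 * (Γ x * rGamma (2 + m - x)) := by
      have h2 := sum_alternating_sub (fun k : ℕ => Γ (x - k) * rGamma (2 + m - x - k)) (m + 1)
      have h3 : Γ (x - (m + 1 : ℕ)) * rGamma (2 + m - x - (m + 1 : ℕ)) * (-1) ^ (m + 1) =
          Γ x * rGamma (2 + m - x) := by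
        have g1 := Gamma_mul_rGamma (im_ne (z := 1 - x) hx (-1) (by norm_num) (by simp))
        have g2 := Gamma_mul_rGamma (im_ne (z := 2 + m - x) hx (-1) (by norm_num) (by simp))
        have hr := Gamma_reflection_add_nat (x - (m + 1 : ℕ)) (m + 1)
        have hsq : ((-1 : ℂ) ^ (m + 1)) * (-1) ^ (m + 1) = 1 := by rw [← mul_pow]; simp
        rw [sub_add_cancel, show 1 - ((m + 1 : ℕ) : ℂ) - (x - (m + 1 : ℕ)) = 1 - x by ring,
          show 1 - (x - ((m + 1 : ℕ) : ℂ)) = 2 + m - x by push_cast; ring] at hr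
        rw [show 2 + (m : ℂ) - x - (m + 1 : ℕ) = 1 - x by push_cast; ring]
        linear_combination -rGamma (1 - x) * rGamma (2 + m - x) * hr -
          (Γ (x - (m + 1 : ℕ)) * rGamma (1 - x) * (-1) ^ (m + 1)) * g2 +
          Γ x * rGamma (2 + m - x) * g1
      have h7 : ∀ F : ℕ → ℂ, ∑ k ∈ Finset.range (m + 1 + 1), F k =
          ∑ k ∈ Finset.range m, F (k + 1) + F 0 + F (m + 1) := fun F => by
        rw [Finset.sum_range_succ, Finset.sum_range_succ']
      rw [h7] at h2
      simp only [Nat.cast_zero, sub_zero, pow_zero, one_mul] at h2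
      have h4 : (2 + m - 2 * x) * ∑ i ∈ Finset.range (m + 1), (-1 : ℂ) ^ i *
          (Γ (x - (i + 1 : ℕ)) * rGamma (3 + m - x - (i + 1 : ℕ))) =
          -∑ k ∈ Finset.range (m + 1), (-1 : ℂ) ^ k * (Γ (x - k) * rGamma (2 + m - x - k) -
            Γ (x - (k + 1 : ℕ)) * rGamma (2 + m - x - (k + 1 : ℕ))) := by
        rw [Finset.mul_sum, ← Finset.sum_neg_distrib]
        refine Finset.sum_congr rfl fun k _ => ?_
        have h5 : Γ (x - k) = (x - (k + 1 : ℕ)) * Γ (x - (k + 1 : ℕ)) := by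
          rw [← Complex.Gamma_add_one _ (fun h0 => hx (by simpa using congrArg Complex.im h0))]
          push_cast
          ring_nf
        rw [h5, rGamma_sub_of_eq (y := 2 + m - x - (k + 1 : ℕ)) (z := 3 + m - x - (k + 1 : ℕ))
          (by ring), show 2 + (m : ℂ) - x - k = 3 + m - x - (k + 1 : ℕ) by push_cast; ring]
        push_cast
        ring
      have h6 : ∑ k ∈ Finset.range m, (-1 : ℂ) ^ (k + 1) *
          (Γ (x - (k + 1 : ℕ)) * rGamma (2 + m - x - (k + 1 : ℕ))) = -∑ k ∈ Finset.range m,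
          (-1 : ℂ) ^ k * (Γ (x - (k + 1 : ℕ)) * rGamma (2 + m - x - (k + 1 : ℕ))) := by
        rw [← Finset.sum_neg_distrib]
        refine Finset.sum_congr rfl fun k _ => by ring
      rw [h4, h2, h6]
      linear_combination -h3
    have r0 : (((m + 1 : ℕ) : ℂ)) = (m : ℂ) + 1 := by push_cast; ring
    rw [r0, show 3 - x + ((m : ℂ) + 1) = 3 - x + m + 1 by ring,
      show 1 - x + ((m : ℂ) + 1) = 2 - x + m by ring,
      show 3 - 2 * x + ((m : ℂ) + 1) = 4 - 2 * x + m by ring,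
      show 1 + ((m : ℂ) + 1) - 2 * x = 2 + m - 2 * x by ring,
      show 2 + ((m : ℂ) + 1) - 2 * x = 3 + m - 2 * x by ring,
      show 2 + ((m : ℂ) + 1) - x = 3 + m - x by ring]
    rw [show 3 - x + (m : ℂ) - 1 = 2 + m - x by ring,
      show 3 - x + (m : ℂ) - x = 3 - 2 * x + m by ring,
      show 3 - 2 * x + (m : ℂ) - 1 = 2 + m - 2 * x by ring, div_eq_mul_inv] at h1
    have p1 : (2 : ℂ) ^ (2 - x + m) = 2 * 2 ^ (1 - x + m) := two_cpow_add_one (by ring)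
    have p2 : (2 : ℂ) ^ (3 - x + m) = 2 * (2 * 2 ^ (1 - x + m)) := by
      rw [← p1]; exact two_cpow_add_one (by ring)
    have p3 : (2 : ℂ) ^ (2 + m - 2 * x) = 2 * 2 ^ (1 + m - 2 * x) := two_cpow_add_one (by ring)
    have r1 : rGamma (3 - 2 * x + m) = (3 - 2 * x + m) * rGamma (4 - 2 * x + m) :=
      rGamma_sub_of_eq (by ring)
    have r2 : rGamma (2 + m - 2 * x) = (2 + m - 2 * x) * rGamma (3 + m - 2 * x) :=
      rGamma_sub_of_eq (by ring)
    have g1 := Gamma_mul_rGamma (im_ne (z := x) hx 1 one_ne_zero (by simp))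
    have hpi := mul_inv_cancel₀ sqrtPi_ne_zero
    rw [r1, r2] at ih
    rw [p2, r1] at h1
    rw [p1, p3]
    have n1 : (3 - 2 * x + m) ≠ 0 := fun h0 => hx (by simpa using congrArg Complex.im h0)
    have n2 : (2 + m - 2 * x) ≠ 0 := fun h0 => hx (by simpa using congrArg Complex.im h0)
    refine mul_left_cancel₀ (mul_ne_zero n1 n2) ?_
    set T := ∑ i ∈ Finset.range (m + 1), (-1 : ℂ) ^ i *
        (Γ (x - (i + 1 : ℕ)) * rGamma (3 + m - x - (i + 1 : ℕ)))
    set S := ∑ i ∈ Finset.range m, (-1 : ℂ) ^ i *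
          (Γ (x - (i + 1 : ℕ)) * rGamma (2 + m - x - (i + 1 : ℕ)))
    set R := rGamma (4 - 2 * x + m)
    set E := (2 : ℂ) ^ (1 - x + (m : ℂ))
    linear_combination sqrtPi * h1 + 4 * ih - (2 * (3 - 2 * x + m) * E * R * rGamma x) * hs +
      4 * (3 - 2 * x + m) * E * R * rGamma (2 + m - x) * (g1 - hpi)

/-- Evaluation behind the formulas with a sum from `0` to `n - 1`. -/
theorem quadOne_eq_altGammaSum_zero {x : ℂ} (hx : x.im ≠ 0) {n : ℕ} (hn : 0 < n) :
    quadOne x (3 - x - n) = 2 ^ (1 - x - n) / (sqrtPi * Γ (3 - 2 * x - n)) *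
      (2 ^ (1 - n - 2 * x) * Γ (1 - x) / Γ (2 - n - 2 * x) +
        altGammaSum 0 (n - 1) x (2 - n - x) / Γ x) := by
  have h := quadOne_down hx n
  have hsum : altGammaSum 0 (n - 1) x (2 - n - x) =
      ∑ k ∈ Finset.range n, (-1 : ℂ) ^ k * (Γ (x + k) * rGamma (2 - n - x + k)) := by
    rw [altGammaSum]
    have : Finset.Icc 0 (n - 1) = Finset.range n := by ext; simp; omega
    rw [this]
    exact Finset.sum_congr rfl fun k _ => by rw [rGamma, div_eq_mul_inv, mul_assoc]
  have h1 := (im_ne (z := x) hx 1 one_ne_zero (by simp)).Gamma_ne_zero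
  have hpi := sqrtPi_ne_zero
  rw [← hsum] at h
  rw [← mul_left_inj' hpi, h]
  simp only [rGamma]
  field_simp

/-- Evaluation behind the formulas with a sum from `1` to `n - 1`. -/
theorem quadOne_eq_altGammaSum_one {x : ℂ} (hx : x.im ≠ 0) {n : ℕ} (hn : 0 < n) :
    quadOne (x + n) (2 - x) = 2 ^ (-x) / (sqrtPi * Γ (2 - 2 * x - n)) * Γ (1 - x - n) *
      (2 ^ (-n - 2 * x) / Γ (1 - n - 2 * x) -
        altGammaSum 1 (n - 1) x (1 - n - x) / (Γ x * Γ (1 - x))) := by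
  -- Only n-1 upward steps from the base value at x+n are needed, since 3-(x+n)+(n-1) = 2-x.
  obtain ⟨m, rfl⟩ : ∃ m, n = m + 1 := ⟨n - 1, by omega⟩
  have hx' : (x + (m + 1 : ℕ)).im ≠ 0 := by simpa using hx
  have h := quadOne_up hx' m
  have hsq : ((-1 : ℂ) ^ (m + 1)) * (-1) ^ (m + 1) = 1 := by rw [← mul_pow]; simp
  -- Reversing the order makes the Gamma arguments ascend from k = 1, at the cost of a sign.
  have hsum : ∑ i ∈ Finset.range m, (-1 : ℂ) ^ i * (Γ (x + (m + 1 : ℕ) - (i + 1 : ℕ)) *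
      rGamma (2 + m - (x + (m + 1 : ℕ)) - (i + 1 : ℕ))) =
      -(-1) ^ (m + 1) * altGammaSum 1 (m + 1 - 1) x (1 - (m + 1 : ℕ) - x) := by
    rw [altGammaSum, Finset.mul_sum, ← Finset.sum_range_reflect]
    rw [Nat.add_sub_cancel, ← Finset.Ico_add_one_right_eq_Icc, Finset.sum_Ico_eq_sum_range,
      Nat.add_sub_cancel]
    refine Finset.sum_congr rfl fun k hk => ?_
    have hkm : k < m := Finset.mem_range.1 hk
    have e1 : ((m - 1 - k + 1 : ℕ) : ℂ) = m - k := by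
      rw [show m - 1 - k + 1 = m - k by omega, Nat.cast_sub hkm.le]
    rw [e1, rGamma, div_eq_mul_inv]
    push_cast
    rw [show x + ((m : ℂ) + 1) - (m - k) = x + (1 + k) by ring,
      show 2 + (m : ℂ) - (x + (m + 1)) - (m - k) = 1 - (m + 1) - x + (1 + k) by ring]
    have hs : (-1 : ℂ) ^ (m - 1 - k) = -(-1) ^ (m + 1) * (-1) ^ (1 + k) := by
      have : (-1 : ℂ) ^ (m + 1) = (-1) ^ (m - 1 - k) * (-1) ^ (k + 2) := by
        rw [← pow_add]; congr 1; omega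
      have h2 : ((-1 : ℂ) ^ k) * (-1) ^ k = 1 := by rw [← mul_pow]; simp
      rw [this]
      linear_combination -(-1 : ℂ) ^ (m - 1 - k) * h2
    rw [hs]
    ring
  rw [hsum] at h
  have hr := Gamma_reflection_add_nat x (m + 1)
  have h1 := (im_ne (z := x) hx 1 one_ne_zero (by simp)).Gamma_ne_zero
  have h2 := (im_ne (z := 1 - x) hx (-1) (by norm_num) (by simp)).Gamma_ne_zero
  have h3 := (im_ne (z := x + (m + 1 : ℕ)) hx 1 one_ne_zero (by simp)).Gamma_ne_zero
  have hpi := sqrtPi_ne_zero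
  push_cast at h hr h3 ⊢
  rw [show 3 - (x + ((m : ℂ) + 1)) + m = 2 - x by ring,
    show 1 - (x + ((m : ℂ) + 1)) + m = -x by ring,
    show 3 - 2 * (x + ((m : ℂ) + 1)) + m = 2 - 2 * x - (m + 1) by ring,
    show 1 + (m : ℂ) - 2 * (x + (m + 1)) = -(m + 1) - 2 * x by ring,
    show 2 + (m : ℂ) - 2 * (x + (m + 1)) = 1 - (m + 1) - 2 * x by ring,
    show 1 - (x + ((m : ℂ) + 1)) = 1 - x - (m + 1) by ring] at h
  rw [show 1 - ((m : ℂ) + 1) - x = 1 - x - (m + 1) by ring] at hr h ⊢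
  -- Reflection trades 1/Γ(x+n) for Γ(1-x-n); its sign cancels the one from the reversal.
  have hG : rGamma (x + (m + 1)) = (-1) ^ (m + 1) * Γ (1 - x - (m + 1)) / (Γ x * Γ (1 - x)) := by
    rw [rGamma, inv_eq_one_div, div_eq_div_iff h3 (mul_ne_zero h1 h2)]
    linear_combination (-(-1 : ℂ) ^ (m + 1)) * hr - Γ x * Γ (1 - x) * hsq
  have hG' : rGamma (x + (m + 1)) * Γ (x + (m + 1)) = 1 := inv_mul_cancel₀ h3
  refine mul_right_cancel₀ hpi ?_
  rw [h]
  set A := altGammaSum 1 m x (1 - x - ((m : ℂ) + 1))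
  have h7 : rGamma (x + (m + 1)) * (-(-1) ^ (m + 1) * A) =
      -Γ (1 - x - (m + 1)) * A / (Γ x * Γ (1 - x)) := by
    rw [hG]
    linear_combination -(Γ (1 - x - (m + 1)) * A / (Γ x * Γ (1 - x))) * hsq
  rw [mul_assoc, mul_add, h7]
  rw [show rGamma (x + (m + 1)) * (2 ^ (-((m : ℂ) + 1) - 2 * x) * Γ (x + (m + 1)) *
    Γ (1 - x - (m + 1)) * rGamma (1 - (m + 1) - 2 * x)) = 2 ^ (-((m : ℂ) + 1) - 2 * x) *
    Γ (1 - x - (m + 1)) * rGamma (1 - (m + 1) - 2 * x) by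
      linear_combination (2 ^ (-((m : ℂ) + 1) - 2 * x) *
        Γ (1 - x - (m + 1)) * rGamma (1 - (m + 1) - 2 * x)) * hG']
  simp only [rGamma]
  field_simp
  ring

/-! ### Tools for matching parameters, and passage to the limit in a. -/

/-- Here and in the next lemma all arguments are free, tied to x by equations left to `ring`, so
that the evaluation applies to any way of writing the parameters. -/
theorem reg3F2_eq_altGammaSum_zero {x : ℂ} (hx : x.im ≠ 0) {n : ℕ} (hn : 0 < n)
    {a b c e f p q g₁ g₂ g₃ y : ℂ} (ha : a = x / 2 := by ring)
    (hb : b = x / 2 + 1 / 2 := by ring) (hc : c = 1 := by ring)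
    (he : e = (3 - x - n) / 2 := by ring) (hf : f = (3 - x - n) / 2 + 1 / 2 := by ring)
    (hp : p = 1 - x - n := by ring) (hq : q = 1 - n - 2 * x := by ring)
    (h₁ : g₁ = 1 - x := by ring) (h₂ : g₂ = 2 - n - 2 * x := by ring)
    (h₃ : g₃ = 3 - 2 * x - n := by ring) (hy : y = 2 - n - x := by ring) :
    reg3F2 a b c e f = 2 ^ p / (sqrtPi * Γ g₃) *
      (2 ^ q * Γ g₁ / Γ g₂ + altGammaSum 0 (n - 1) x y / Γ x) := by
  subst ha hb hc he hf hp hq h₁ h₂ h₃ hy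
  exact quadOne_eq_altGammaSum_zero hx hn

theorem reg3F2_eq_altGammaSum_one {x : ℂ} (hx : x.im ≠ 0) {n : ℕ} (hn : 0 < n)
    {a b c e f p q g₀ g₁ g₂ g₃ y : ℂ} (ha : a = (x + n) / 2 := by push_cast; ring)
    (hb : b = (x + n) / 2 + 1 / 2 := by push_cast; ring) (hc : c = 1 := by ring)
    (he : e = (2 - x) / 2 := by ring) (hf : f = (2 - x) / 2 + 1 / 2 := by ring)
    (hp : p = -x := by ring) (hq : q = -n - 2 * x := by push_cast; ring)
    (h₀ : g₀ = 1 - x := by ring) (h₁ : g₁ = 1 - x - n := by push_cast; ring)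
    (h₂ : g₂ = 1 - n - 2 * x := by push_cast; ring)
    (h₃ : g₃ = 2 - 2 * x - n := by push_cast; ring) (hy : y = 1 - n - x := by push_cast; ring) :
    reg3F2 a b c e f = 2 ^ p / (sqrtPi * Γ g₃) * Γ g₁ *
      (2 ^ q / Γ g₂ - altGammaSum 1 (n - 1) x y / (Γ x * Γ g₀)) := by
  subst ha hb hc he hf hp hq h₀ h₁ h₂ h₃ hy
  exact quadOne_eq_altGammaSum_one hx hn

theorem affine_im_ne_zero {a : ℂ} (ha : a.im ≠ 0) {z : ℂ} (t u : ℝ)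
    (ht : t ≠ 0 := by norm_num) (h : z = t * a + u := by push_cast; ring) : z.im ≠ 0 := by
  rw [h]
  simpa using ⟨ht, ha⟩

theorem Gamma_affine_ne_zero {a : ℂ} (ha : a.im ≠ 0) {z : ℂ} (t u : ℝ)
    (ht : t ≠ 0 := by norm_num) (h : z = t * a + u := by push_cast; ring) : Γ z ≠ 0 :=
  (reg_of_im_ne_zero (affine_im_ne_zero ha t u ht h)).Gamma_ne_zero

theorem affine_ne_zero {a : ℂ} (ha : a.im ≠ 0) {z : ℂ} (t u : ℝ)
    (ht : t ≠ 0 := by norm_num) (h : z = t * a + u := by push_cast; ring) : z ≠ 0 :=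
  fun h0 => affine_im_ne_zero ha t u ht h (by simp [h0])

/-- Once all powers of 2 are monomials in 2^(a/2) and 2^(n/2), the remaining identities are between
rational functions. -/
theorem two_cpow_affine (x y : ℂ) {z : ℂ} (i j k : ℤ)
    (h : z = i * x + j * y + k := by push_cast; ring) :
    (2 : ℂ) ^ z = (2 ^ x) ^ i * (2 ^ y) ^ j * 2 ^ k := by
  rw [h, Complex.cpow_add _ _ two_ne_zero, Complex.cpow_add _ _ two_ne_zero,
    Complex.cpow_int_mul, Complex.cpow_int_mul, Complex.cpow_intCast]

theorem four_cpow {z w : ℂ} (h : w = 2 * z := by ring) : (4 : ℂ) ^ z = 2 ^ w := by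
  rw [h, show (4 : ℂ) = 2 * 2 by norm_num, two_mul z, Complex.cpow_add _ _ two_ne_zero]
  have h2 := Complex.mul_cpow_ofReal_nonneg (a := 2) (b := 2) (by norm_num) (by norm_num) z
  exact_mod_cast h2

theorem Gamma_eq_of_duplication {x y z p : ℂ} (hx : x = z / 2 := by ring)
    (hy : y = z / 2 + 1 / 2 := by ring) (hp : p = 1 - z := by ring) : Γ z = Γ x * Γ y / (2 ^ p * sqrtPi) := by
  have h := Gamma_duplication (z / 2)
  rw [mul_div_cancel₀ _ (two_ne_zero' ℂ)] at h
  subst hx hy hp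
  have := sqrtPi_ne_zero
  have h2 : (2 : ℂ) ^ (1 - z) ≠ 0 := by simp [Complex.cpow_eq_zero_iff]
  rw [h]
  field_simp

theorem sin_pi_mul_eq_div {z w : ℂ} (hw : w = 1 - z := by ring) :
    Complex.sin (Real.pi * z) = Real.pi / (Γ z * Γ w) := by
  rw [hw, Complex.Gamma_mul_Gamma_one_sub, div_div_cancel₀]
  exact_mod_cast Real.pi_ne_zero

theorem Gamma_eq_mul_of_eq_add_one {y z l : ℂ} (h : y ≠ 0)
    (hz : z = y + 1 := by ring) (hl : l = y := by ring) :
    Γ z = l * Γ y := by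
  rw [hz, hl, Complex.Gamma_add_one _ h]

/-- A pole of Γ(2z) is a pole of Γ(z) for even m and of Γ(z+1/2) for odd m. Thus a numerator Gamma
whose duplication gives the two lower parameters is regular automatically. -/
theorem Reg.two_mul {z w y : ℂ} (hz : Reg z) (hw : Reg w) (h : w = z + 1 / 2 := by ring)
    (hy : y = 2 * z := by ring) :
    Reg y := by
  intro m hm
  rcases Nat.even_or_odd' m with ⟨k, rfl | rfl⟩
  · refine hz k ?_
    push_cast at hm
    linear_combination (hm - hy) / 2
  · refine hw k ?_
    push_cast at hm
    linear_combination h + (hm - hy) / 2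

theorem Reg.congr {z w : ℂ} (hz : Reg z) (h : w = z := by push_cast; ring) : Reg w := h ▸ hz

theorem Reg.ne_zero {z : ℂ} (hz : Reg z) : z ≠ 0 := by simpa using hz 0

theorem inv_Gamma (z : ℂ) : (Γ z)⁻¹ = rGamma z := rfl

theorem two_cpow_ne_zero (z : ℂ) : (2 : ℂ) ^ z ≠ 0 := by simp [Complex.cpow_eq_zero_iff]

@[fun_prop]
theorem ContinuousAt.complexGamma {f : ℂ → ℂ} {a : ℂ} (hf : ContinuousAt f a) (h : Reg (f a)) :
    ContinuousAt (fun z => Γ (f z)) a :=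
  ContinuousAt.comp (f := f) (g := Γ) h.differentiableAt_Gamma.continuousAt hf

@[fun_prop]
theorem ContinuousAt.rGamma {f : ℂ → ℂ} {a : ℂ} (hf : ContinuousAt f a) :
    ContinuousAt (fun z => _root_.rGamma (f z)) a :=
  ContinuousAt.comp (f := f) (g := _root_.rGamma) rGamma_differentiable.continuous.continuousAt hf

-- Only numerators need a regularity condition; denominators enter through the entire function 1/Γ.
@[fun_prop]
theorem ContinuousAt.altGammaSum {i j : ℕ} {x y : ℂ → ℂ} {a : ℂ} (hx : ContinuousAt x a)
    (hy : ContinuousAt y a) (h : ∀ k ∈ Finset.Icc i j, Reg (x a + k)) :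
    ContinuousAt (fun z => _root_.altGammaSum i j (x z) (y z)) a := by
  unfold _root_.altGammaSum
  refine tendsto_finsetSum _ fun k hk => ?_
  simp only [div_eq_mul_inv]
  have h1 := ContinuousAt.complexGamma (f := fun z => x z + k) (by fun_prop) (h k hk)
  have h2 := ContinuousAt.rGamma (f := fun z => y z + k) (a := a) (by fun_prop)
  exact (h1.const_mul _).mul h2

/-- A value of `₃F₂` on a one-parameter family is determined off the real line by continuity. -/
theorem hasHyp3F2One_of_im_ne_zero {A B C E F S V : ℂ → ℂ} {a : ℂ}
    (h : ∀ z : ℂ, z.im ≠ 0 →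
      Γ (E z) * Γ (F z) * Γ (S z) * reg3F2 (A z) (B z) (C z) (E z) (F z) = V z)
    (hE : Reg (E a)) (hF : Reg (F a)) (hS : Reg (S a))
    (hV : ContinuousAt V a := by
      -- Inverse Gammas become `rGamma`, which is continuous everywhere, so only numerator Gammas
      -- and genuine denominators leave side conditions, found among the hypotheses of the caller.
      simp only [div_eq_mul_inv, mul_inv, ← inv_pow, inv_Gamma] at *
      fun_prop (disch := first | assumption | exact Or.inl (by norm_num)))
    (hs : ∀ z, S z = E z + F z - A z - B z - C z := by intro z; ring)
    (dA : Differentiable ℂ A := by fun_prop) (dB : Differentiable ℂ B := by fun_prop)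
    (dC : Differentiable ℂ C := by fun_prop) (dE : Differentiable ℂ E := by fun_prop)
    (dF : Differentiable ℂ F := by fun_prop) :
    HasHyp3F2One (A a) (B a) (C a) (E a) (F a) (V a) := by
  have dS : Differentiable ℂ S := by
    rw [funext hs]
    fun_prop
  refine hasHyp3F2One_of_reg3F2 hE hF (hs a ▸ hS) ?_
  rw [← hs]
  have hc : ∀ {T : ℂ → ℂ}, Differentiable ℂ T → Reg (T a) → ContinuousAt (fun z => Γ (T z)) a :=
    fun hT hr => ContinuousAt.comp (f := _) (g := Γ) hr.differentiableAt_Gamma.continuousAt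
      hT.continuous.continuousAt
  have hL : ContinuousAt (fun z => Γ (E z) * Γ (F z) * Γ (S z) *
      reg3F2 (A z) (B z) (C z) (E z) (F z)) a :=
    (((hc dE hE).mul (hc dF hF)).mul (hc dS hS)).mul
      (Differentiable.reg3F2_comp dA dB dC dE dF).continuous.continuousAt
  have hd : Dense {z : ℂ | z.im ≠ 0} :=
    (dense_compl_singleton (0 : ℝ)).preimage Complex.isOpenMap_im
  have : (𝓝[{z : ℂ | z.im ≠ 0}] a).NeBot := mem_closure_iff_nhdsWithin_neBot.1 (hd a)
  refine tendsto_nhds_unique (l := 𝓝[{z : ℂ | z.im ≠ 0}] a)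
    (hV.tendsto.mono_left nhdsWithin_le_nhds) ((hL.tendsto.mono_left nhdsWithin_le_nhds).congr' ?_)
  filter_upwards [self_mem_nhdsWithin] with z hz using h z hz

/-! ### The closed forms, one series at a time. -/

/-- `reg3F2_quadratic` with x = 2a holds without exception, so no limit in a is needed. Γ(2+2b-2a)
duplicates the Gammas of the two lower parameters. -/
theorem hasHyp3F2One_quadratic (a b : ℂ) (he : Reg (b + 3 / 2 - a)) (hf : Reg (b - a + 1))
    (hs : Reg (2 + b - 4 * a)) (h : 2 * a - 1 ≠ 0) :
    HasHyp3F2One a (a + 1 / 2) b (b + 3 / 2 - a) (b - a + 1)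
      ((2 : ℂ) ^ (-b) * sqrtPi * Γ (2 + 2 * b - 2 * a) * Γ (2 + b - 4 * a)
        / (Γ (2 + 2 * b - 4 * a) * (2 * a - 1)) * (1 / (Γ (b / 2) * Γ (3 / 2 + b / 2 - 2 * a))
        - 1 / (Γ (b / 2 + 1 / 2) * Γ (1 + b / 2 - 2 * a)))) := by
  refine hasHyp3F2One_of_reg3F2 he hf (hs.congr (by ring)) ?_
  have hq := reg3F2_quadratic (2 * a) b
  rw [reg3F2_swap_lower, show 2 * a / 2 = a by ring, 
    show b + 1 - a = b - a + 1 by ring] at hq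
  rw [show b + 3 / 2 - a + (b - a + 1) - a - (a + 1 / 2) - b = 2 + b - 4 * a by ring,
    Gamma_eq_of_duplication (z := 2 + 2 * b - 2 * a) (x := b - a + 1) (y := b + 3 / 2 - a)
      (p := 2 * a - 2 * b - 1)]
  have hp : (2 : ℂ) ^ (b - 2 * a + 1) = 2 ^ (-b) / 2 ^ (2 * a - 2 * b - 1) := by
    rw [← Complex.cpow_sub _ _ two_ne_zero]
    ring_nf
  rw [hp, show 2 * b - 2 * (2 * a) + 2 = 2 + 2 * b - 4 * a by ring,
    show b / 2 + 3 / 2 - 2 * a = 3 / 2 + b / 2 - 2 * a by ring,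
    show b / 2 + 1 - 2 * a = 1 + b / 2 - 2 * a by ring] at hq
  have hpi := sqrtPi_ne_zero
  rw [← mul_right_inj' h, mul_left_comm _ (Γ _ * Γ _ * Γ _), hq]
  have h2 := two_cpow_ne_zero (2 * a - 2 * b - 1)
  simp only [← inv_Gamma]
  generalize Γ (b - a + 1) = y0, (2 : ℂ) ^ (2 * a - 2 * b - 1) = y1, 2 * a - 1 = y2 at *
  simp only [div_eq_mul_inv, mul_inv, one_mul]
  field_simp

/-- This is `quadOne` itself, with x = 2a, on the downward branch. -/
theorem reg3F2_quadratic_unit_sub {a : ℂ} (ha : a.im ≠ 0) {n : ℕ} (hn : 0 < n) :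
    Γ (3 / 2 - a - n / 2) * Γ (2 - a - n / 2) * Γ (2 - n - 4 * a)
        * reg3F2 a (a + 1 / 2) 1 (3 / 2 - a - n / 2) (2 - a - n / 2) =
      (Γ (3 - n - 2 * a) * Γ (2 - n - 4 * a) / Γ (3 - n - 4 * a)
        * ((2 : ℂ) ^ (-4 * a - n) * Γ (1 - 2 * a) / Γ (2 - n - 4 * a) + 1 / (2 * Γ (2 * a))
        * altGammaSum 0 (n - 1) (2 * a) (2 - n - 2 * a))) := by
  have hx : (2 * a).im ≠ 0 := affine_im_ne_zero ha 2 0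
  have h : reg3F2 a (a + 1 / 2) 1 (3 / 2 - a - n / 2) (2 - a - n / 2) = 2 ^ (-2 * a - n + 1)
      / (sqrtPi * Γ (3 - n - 4 * a)) * (2 ^ (-4 * a - n + 1) * Γ (1 - 2 * a) / Γ (2 - n - 4 * a)
      + altGammaSum 0 (n - 1) (2 * a) (2 - n - 2 * a) / Γ (2 * a)) :=
      reg3F2_eq_altGammaSum_zero hx hn
  have e0 : Γ (3 - n - 2 * a) = Γ (3 / 2 - a - n / 2) * Γ (2 - a - n / 2)
      / (2 ^ (2 * a + n - 2) * sqrtPi) := Gamma_eq_of_duplication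
  have p0 := two_cpow_affine (a / 2) (n / 2) (z := (-4 * a - n)) (-8) (-2) 0
  have p1 := two_cpow_affine (a / 2) (n / 2) (z := (-4 * a - n + 1)) (-8) (-2) 1
  have p2 := two_cpow_affine (a / 2) (n / 2) (z := (-2 * a - n + 1)) (-4) (-2) 1
  have p3 := two_cpow_affine (a / 2) (n / 2) (z := (2 * a + n - 2)) 4 2 (-2)
  have g0 : Γ (2 - n - 4 * a) ≠ 0 := Gamma_affine_ne_zero ha (-4) (-n + 2)
  have g1 : Γ (3 - n - 4 * a) ≠ 0 := Gamma_affine_ne_zero ha (-4) (-n + 3)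
  have g2 : Γ (1 - 2 * a) ≠ 0 := Gamma_affine_ne_zero ha (-2) 1
  have g3 : Γ (3 / 2 - a - n / 2) ≠ 0 := Gamma_affine_ne_zero ha (-1) (-n / 2 + 3 / 2)
  have g4 : Γ (2 - a - n / 2) ≠ 0 := Gamma_affine_ne_zero ha (-1) (-n / 2 + 2)
  have g5 : Γ (2 * a) ≠ 0 := Gamma_affine_ne_zero ha 2 0
  have hu : (2 : ℂ) ^ (a / 2) ≠ 0 := two_cpow_ne_zero _
  have hv : (2 : ℂ) ^ ((n : ℂ) / 2) ≠ 0 := two_cpow_ne_zero _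
  have hpi := sqrtPi_ne_zero
  rw [h, e0, p0, p1, p2, p3]
  clear h hx e0 p0 p1 p2 p3
  -- Each Gamma value and each basic power becomes an independent nonzero variable; what remains is
  -- a rational identity.
  generalize Γ (2 - n - 4 * a) = y0, Γ (3 - n - 4 * a) = y1, Γ (1 - 2 * a) = y2,
      Γ (3 / 2 - a - n / 2) = y3, Γ (2 - a - n / 2) = y4, Γ (2 * a) = y5,
      altGammaSum 0 (n - 1) (2 * a) (2 - n - 2 * a) = y6, (2 : ℂ) ^ (a / 2) = y7,
      (2 : ℂ) ^ ((n : ℂ) / 2) = y8 at *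
  field_simp

/-- The upward branch: x = 2a-n, so that (x+n)/2 = a. -/
theorem reg3F2_quadratic_unit_add {a : ℂ} (ha : a.im ≠ 0) {n : ℕ} (hn : 0 < n) :
    Γ (3 / 2 - a + n / 2) * Γ (1 - a + n / 2) * Γ (1 + n - 4 * a)
        * reg3F2 a (a + 1 / 2) 1 (3 / 2 - a + n / 2) (1 - a + n / 2) =
      (Γ (1 - 2 * a) * ((1 + n - 2 * a) / (1 + n - 4 * a)) * ((2 : ℂ) ^ (n - 1 - 4 * a)
        * Γ (1 + n - 2 * a) / Γ (1 + n - 4 * a) - 1 / (2 * Γ (2 * a - n))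
        * altGammaSum 1 (n - 1) (2 * a - n) (1 - 2 * a))) := by
  have hx : (2 * a - n).im ≠ 0 := affine_im_ne_zero ha 2 (-n)
  have h : reg3F2 a (a + 1 / 2) 1 (3 / 2 - a + n / 2) (1 - a + n / 2) = 2 ^ (-2 * a + n)
      / (sqrtPi * Γ (-4 * a + n + 2)) * Γ (1 - 2 * a) * (2 ^ (-4 * a + n) / Γ (1 + n - 4 * a)
      - altGammaSum 1 (n - 1) (2 * a - n) (1 - 2 * a) / (Γ (2 * a - n) * Γ (1 + n - 2 * a))) := by
    rw [reg3F2_swap_lower]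
    exact reg3F2_eq_altGammaSum_one hx hn
  have e0 : Γ (-4 * a + n + 2) = (1 + n - 4 * a) * Γ (1 + n - 4 * a) :=
      Gamma_eq_mul_of_eq_add_one (affine_ne_zero ha (-4) (n + 1))
  have l : 1 + n - 2 * a ≠ 0 := affine_ne_zero ha (-2) (n + 1)
  have e1 : Γ (1 + n - 2 * a) = Γ (1 - a + n / 2) * Γ (3 / 2 - a + n / 2)
      / (2 ^ (2 * a - n - 1) * sqrtPi) / (1 + n - 2 * a) := by
    rw [eq_div_iff l, mul_comm, ← Gamma_eq_mul_of_eq_add_one l rfl rfl]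
    exact Gamma_eq_of_duplication
  have p0 := two_cpow_affine (a / 2) (n / 2) (z := (n - 1 - 4 * a)) (-8) 2 (-1)
  have p1 := two_cpow_affine (a / 2) (n / 2) (z := (-4 * a + n)) (-8) 2 0
  have p2 := two_cpow_affine (a / 2) (n / 2) (z := (-2 * a + n)) (-4) 2 0
  have p3 := two_cpow_affine (a / 2) (n / 2) (z := (2 * a - n - 1)) 4 (-2) (-1)
  have g0 : Γ (1 + n - 4 * a) ≠ 0 := Gamma_affine_ne_zero ha (-4) (n + 1)
  have g1 : Γ (1 - 2 * a) ≠ 0 := Gamma_affine_ne_zero ha (-2) 1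
  have g2 : Γ (1 - a + n / 2) ≠ 0 := Gamma_affine_ne_zero ha (-1) (n / 2 + 1)
  have g3 : Γ (3 / 2 - a + n / 2) ≠ 0 := Gamma_affine_ne_zero ha (-1) (n / 2 + 3 / 2)
  have g4 : Γ (2 * a - n) ≠ 0 := Gamma_affine_ne_zero ha 2 (-n)
  have l0 : 1 + n - 4 * a ≠ 0 := affine_ne_zero ha (-4) (n + 1)
  have l1 : 1 + n - 2 * a ≠ 0 := affine_ne_zero ha (-2) (n + 1)
  have hu : (2 : ℂ) ^ (a / 2) ≠ 0 := two_cpow_ne_zero _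
  have hv : (2 : ℂ) ^ ((n : ℂ) / 2) ≠ 0 := two_cpow_ne_zero _
  have hpi := sqrtPi_ne_zero
  rw [h, e0, e1, p0, p1, p2, p3]
  clear h hx e0 e1 p0 p1 p2 p3
  generalize Γ (1 + n - 4 * a) = y0, Γ (1 - 2 * a) = y1, Γ (1 - a + n / 2) = y2,
      Γ (3 / 2 - a + n / 2) = y3, Γ (2 * a - n) = y4, altGammaSum 1 (n - 1) (2 * a - n) (1 - 2 * a)
      = y5, (2 : ℂ) ^ (a / 2) = y6, (2 : ℂ) ^ ((n : ℂ) / 2) = y7 at *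
  generalize 1 + n - 4 * a = w0, 1 + n - 2 * a = w1 at *
  field_simp

/-- The excess is 1, and Thomae's transformation turns it into the unit upper parameter; x = 1-2a-n.
-/
theorem reg3F2_four_mul_add_nat {a : ℂ} (ha : a.im ≠ 0) {n : ℕ} (hn : 0 < n) :
    Γ (1 / 2 + 3 * a + n / 2) * Γ (1 + 3 * a + n / 2) * Γ 1 * reg3F2 (4 * a + n) a (a + 1 / 2)
        (1 / 2 + 3 * a + n / 2) (1 + 3 * a + n / 2) =
      ((2 : ℂ) ^ (2 * a) * Γ (1 + 3 * a + n / 2) * Γ (1 / 2 + 3 * a + n / 2)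
        * altGammaSum 0 (n - 1) (1 - 2 * a - n) (1 + 2 * a) / (Γ (1 - 2 * a - n) * sqrtPi
        * Γ (1 + 4 * a + n)) + (2 : ℂ) ^ (-1 + 6 * a + n) * Γ (2 * a + n) * Γ (1 + 3 * a + n / 2)
        * Γ (1 / 2 + 3 * a + n / 2) / (Γ (4 * a + n) * sqrtPi * Γ (1 + 4 * a + n))) := by
  have hx : (1 - 2 * a - n).im ≠ 0 := affine_im_ne_zero ha (-2) (-n + 1)
  have h : reg3F2 (4 * a + n) a (a + 1 / 2) (1 / 2 + 3 * a + n / 2) (1 + 3 * a + n / 2) =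
      2 ^ (2 * a) / (sqrtPi * Γ (1 + 4 * a + n)) * (2 ^ (4 * a + n - 1) * Γ (2 * a + n)
      / Γ (4 * a + n) + altGammaSum 0 (n - 1) (1 - 2 * a - n) (1 + 2 * a) / Γ (1 - 2 * a - n)) := by
    rw [reg3F2_thomae]
    exact reg3F2_eq_altGammaSum_zero hx hn
  have e9 : Γ 1 = 1 := Complex.Gamma_one
  have p0 := two_cpow_affine (a / 2) (n / 2) (z := (2 * a)) 4 0 0
  have p1 := two_cpow_affine (a / 2) (n / 2) (z := (4 * a + n - 1)) 8 2 (-1)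
  have p2 := two_cpow_affine (a / 2) (n / 2) (z := (-1 + 6 * a + n)) 12 2 (-1)
  have g0 : Γ (1 - 2 * a - n) ≠ 0 := Gamma_affine_ne_zero ha (-2) (-n + 1)
  have g1 : Γ (2 * a + n) ≠ 0 := Gamma_affine_ne_zero ha 2 n
  have g2 : Γ (1 / 2 + 3 * a + n / 2) ≠ 0 := Gamma_affine_ne_zero ha 3 (n / 2 + 1 / 2)
  have g3 : Γ (1 + 3 * a + n / 2) ≠ 0 := Gamma_affine_ne_zero ha 3 (n / 2 + 1)
  have g4 : Γ (4 * a + n) ≠ 0 := Gamma_affine_ne_zero ha 4 n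
  have g5 : Γ (1 + 4 * a + n) ≠ 0 := Gamma_affine_ne_zero ha 4 (n + 1)
  have hu : (2 : ℂ) ^ (a / 2) ≠ 0 := two_cpow_ne_zero _
  have hv : (2 : ℂ) ^ ((n : ℂ) / 2) ≠ 0 := two_cpow_ne_zero _
  have hpi := sqrtPi_ne_zero
  rw [h, e9, p0, p1, p2]
  clear h hx e9 p0 p1 p2
  generalize Γ (1 - 2 * a - n) = y0, Γ (2 * a + n) = y1, Γ (1 / 2 + 3 * a + n / 2) = y2,
      Γ (1 + 3 * a + n / 2) = y3, Γ (4 * a + n) = y4, Γ (1 + 4 * a + n) = y5,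
      altGammaSum 0 (n - 1) (1 - 2 * a - n) (1 + 2 * a) = y6, (2 : ℂ) ^ (a / 2) = y7,
      (2 : ℂ) ^ ((n : ℂ) / 2) = y8 at *
  field_simp
  ring

/-- Again the excess is 1; x = -2a on the upward branch. -/
theorem reg3F2_four_mul_sub_nat {a : ℂ} (ha : a.im ≠ 0) {n : ℕ} (hn : 0 < n) :
    Γ (1 - n / 2 + 3 * a) * Γ (-n / 2 + 3 * a + 3 / 2) * Γ 1 * reg3F2 (1 - n + 4 * a) (a + 1 / 2) a
        (1 - n / 2 + 3 * a) (-n / 2 + 3 * a + 3 / 2) =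
      ((-n / 2 + 1 / 2 + 2 * a) * Γ (1 + 2 * a - n) * Γ (2 - n + 6 * a) / Γ (2 - n + 4 * a) ^ 2
        - Γ (1 + 2 * a - n) * altGammaSum 1 (n - 1) (-2 * a) (1 - n + 2 * a) * Γ (1 - n / 2 + 3 * a)
        * Γ (-n / 2 + 3 * a + 3 / 2) / (Γ (-2 * a) * Γ (2 - n + 4 * a) * Γ (a + 1 / 2) * Γ (1 + a)))
        := by
  have hx : (-2 * a).im ≠ 0 := affine_im_ne_zero ha (-2) 0
  have h : reg3F2 (1 - n + 4 * a) (a + 1 / 2) a (1 - n / 2 + 3 * a) (-n / 2 + 3 * a + 3 / 2) =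
      2 ^ (2 * a) / (sqrtPi * Γ (2 - n + 4 * a)) * Γ (1 + 2 * a - n)
      * (2 ^ (4 * a - n) / Γ (1 - n + 4 * a) - altGammaSum 1 (n - 1) (-2 * a) (1 - n + 2 * a)
      / (Γ (-2 * a) * Γ (2 * a + 1))) := by
    rw [reg3F2_thomae, reg3F2_swap_lower]
    exact reg3F2_eq_altGammaSum_one hx hn
  have e0 : Γ (2 - n + 4 * a) = (2 * (-n / 2 + 1 / 2 + 2 * a)) * Γ (1 - n + 4 * a) :=
      Gamma_eq_mul_of_eq_add_one (affine_ne_zero ha 4 (-n + 1))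
  have e1 : Γ (2 - n + 6 * a) = Γ (1 - n / 2 + 3 * a) * Γ (-n / 2 + 3 * a + 3 / 2)
      / (2 ^ (-6 * a + n - 1) * sqrtPi) := Gamma_eq_of_duplication
  have e2 : Γ (2 * a + 1) = Γ (a + 1 / 2) * Γ (1 + a) / (2 ^ (-2 * a) * sqrtPi) :=
      Gamma_eq_of_duplication
  have e9 : Γ 1 = 1 := Complex.Gamma_one
  have p0 := two_cpow_affine (a / 2) (n / 2) (z := (-6 * a + n - 1)) (-12) 2 (-1)
  have p1 := two_cpow_affine (a / 2) (n / 2) (z := (-2 * a)) (-4) 0 0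
  have p2 := two_cpow_affine (a / 2) (n / 2) (z := (2 * a)) 4 0 0
  have p3 := two_cpow_affine (a / 2) (n / 2) (z := (4 * a - n)) 8 (-2) 0
  have g0 : Γ (-2 * a) ≠ 0 := Gamma_affine_ne_zero ha (-2) 0
  have g1 : Γ (a + 1 / 2) ≠ 0 := Gamma_affine_ne_zero ha 1 (1 / 2)
  have g2 : Γ (1 + a) ≠ 0 := Gamma_affine_ne_zero ha 1 1
  have g3 : Γ (1 + 2 * a - n) ≠ 0 := Gamma_affine_ne_zero ha 2 (-n + 1)
  have g4 : Γ (1 - n / 2 + 3 * a) ≠ 0 := Gamma_affine_ne_zero ha 3 (-n / 2 + 1)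
  have g5 : Γ (-n / 2 + 3 * a + 3 / 2) ≠ 0 := Gamma_affine_ne_zero ha 3 (-n / 2 + 3 / 2)
  have g6 : Γ (1 - n + 4 * a) ≠ 0 := Gamma_affine_ne_zero ha 4 (-n + 1)
  have l0 : -n / 2 + 1 / 2 + 2 * a ≠ 0 := affine_ne_zero ha 2 (-n / 2 + 1 / 2)
  have hu : (2 : ℂ) ^ (a / 2) ≠ 0 := two_cpow_ne_zero _
  have hv : (2 : ℂ) ^ ((n : ℂ) / 2) ≠ 0 := two_cpow_ne_zero _
  have hpi := sqrtPi_ne_zero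
  rw [h, e0, e1, e2, e9, p0, p1, p2, p3]
  clear h hx e0 e1 e2 e9 p0 p1 p2 p3
  generalize Γ (-2 * a) = y0, Γ (a + 1 / 2) = y1, Γ (1 + a) = y2, Γ (1 + 2 * a - n) = y3,
      Γ (1 - n / 2 + 3 * a) = y4, Γ (-n / 2 + 3 * a + 3 / 2) = y5, Γ (1 - n + 4 * a) = y6,
      altGammaSum 1 (n - 1) (-2 * a) (1 - n + 2 * a) = y7, (2 : ℂ) ^ (a / 2) = y8,
      (2 : ℂ) ^ ((n : ℂ) / 2) = y9 at *
  generalize -n / 2 + 1 / 2 + 2 * a = w0 at *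
  field_simp

/-- With 2a distinguished, Thomae's transformation makes (2a+1) - 2a = 1 an upper parameter; x =
1-a-n/2. -/
theorem reg3F2_two_mul_same_half {a : ℂ} (ha : a.im ≠ 0) {n : ℕ} (hn : 0 < n) :
    Γ (1 / 2 + 3 * a / 2 - n / 4) * Γ (2 * a + 1) * Γ (1 - n / 4 - a / 2)
        * reg3F2 (2 * a) a (a + 1 / 2) (1 / 2 + 3 * a / 2 - n / 4) (2 * a + 1) =
      (altGammaSum 0 (n - 1) (-a - n / 2 + 1) (a - n / 2 + 1) * Γ (1 / 2 + 3 * a / 2 - n / 4)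
        * (2 : ℂ) ^ (2 * a) / Γ (-a / 2 - n / 4 + 1 / 2) + (2 : ℂ) ^ (3 * a - n / 2 - 1)
        * Γ (a + n / 2) * Γ (1 / 2 + 3 * a / 2 - n / 4) * Γ (1 - n / 4 - a / 2)
        / (Γ (2 * a) * sqrtPi)) := by
  have hx : (-a - n / 2 + 1).im ≠ 0 := affine_im_ne_zero ha (-1) (-n / 2 + 1)
  have h : reg3F2 (2 * a) a (a + 1 / 2) (1 / 2 + 3 * a / 2 - n / 4) (2 * a + 1) = 2 ^ (a - n / 2)
      / (sqrtPi * Γ (2 * a + 1)) * (2 ^ (2 * a - 1) * Γ (a + n / 2) / Γ (2 * a)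
      + altGammaSum 0 (n - 1) (-a - n / 2 + 1) (a - n / 2 + 1) / Γ (-a - n / 2 + 1)) := by
    rw [reg3F2_thomae, reg3F2_swap_right]
    exact reg3F2_eq_altGammaSum_zero hx hn
  have e0 : Γ (-a - n / 2 + 1) = Γ (-a / 2 - n / 4 + 1 / 2) * Γ (1 - n / 4 - a / 2)
      / (2 ^ (a + n / 2) * sqrtPi) := Gamma_eq_of_duplication
  have p0 := two_cpow_affine (a / 2) (n / 2) (z := (a - n / 2)) 2 (-1) 0
  have p1 := two_cpow_affine (a / 2) (n / 2) (z := (a + n / 2)) 2 1 0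
  have p2 := two_cpow_affine (a / 2) (n / 2) (z := (2 * a - 1)) 4 0 (-1)
  have p3 := two_cpow_affine (a / 2) (n / 2) (z := (2 * a)) 4 0 0
  have p4 := two_cpow_affine (a / 2) (n / 2) (z := (3 * a - n / 2 - 1)) 6 (-1) (-1)
  have g0 : Γ (-a / 2 - n / 4 + 1 / 2) ≠ 0 := Gamma_affine_ne_zero ha (-1 / 2) (-n / 4 + 1 / 2)
  have g1 : Γ (1 - n / 4 - a / 2) ≠ 0 := Gamma_affine_ne_zero ha (-1 / 2) (-n / 4 + 1)
  have g2 : Γ (a + n / 2) ≠ 0 := Gamma_affine_ne_zero ha 1 (n / 2)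
  have g3 : Γ (1 / 2 + 3 * a / 2 - n / 4) ≠ 0 := Gamma_affine_ne_zero ha (3 / 2) (-n / 4 + 1 / 2)
  have g4 : Γ (2 * a) ≠ 0 := Gamma_affine_ne_zero ha 2 0
  have g5 : Γ (2 * a + 1) ≠ 0 := Gamma_affine_ne_zero ha 2 1
  have hu : (2 : ℂ) ^ (a / 2) ≠ 0 := two_cpow_ne_zero _
  have hv : (2 : ℂ) ^ ((n : ℂ) / 2) ≠ 0 := two_cpow_ne_zero _
  have hpi := sqrtPi_ne_zero
  rw [h, e0, p0, p1, p2, p3, p4]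
  clear h hx e0 p0 p1 p2 p3 p4
  generalize Γ (-a / 2 - n / 4 + 1 / 2) = y0, Γ (1 - n / 4 - a / 2) = y1, Γ (a + n / 2) = y2,
      Γ (1 / 2 + 3 * a / 2 - n / 4) = y3, Γ (2 * a) = y4, Γ (2 * a + 1) = y5,
      altGammaSum 0 (n - 1) (-a - n / 2 + 1) (a - n / 2 + 1) = y6, (2 : ℂ) ^ (a / 2) = y7,
      (2 : ℂ) ^ ((n : ℂ) / 2) = y8 at *
  field_simp
  ring

/-- Here the unit is (1+a) - a, and `reg3F2_thomae'` keeps 1+a and the upper parameter 1/2-a-n/2.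
The `quadOne` value is that of `reg3F2_four_mul_add_nat`. -/
theorem reg3F2_add_half_nat_lower {a : ℂ} (ha : a.im ≠ 0) {n : ℕ} (hn : 0 < n) :
    Γ (1 / 2 + 3 * a + n / 2) * Γ (1 + a) * Γ (1 + n / 2 + 2 * a)
        * reg3F2 a (2 * a + n / 2) (1 / 2 - a - n / 2) (1 / 2 + 3 * a + n / 2) (1 + a) =
      (1 / 2 * (altGammaSum 0 (n - 1) (1 - 2 * a - n) (1 + 2 * a) * Γ (1 / 2 + 3 * a + n / 2)
        * Γ (2 * a + 2) * Γ (1 + n / 2 + 2 * a) / (Γ (1 - 2 * a - n) * Γ (1 + 4 * a + n)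
        * Γ (a + 3 / 2))) + (4 : ℂ) ^ (n / 2 - 1 + 3 * a) * Γ (2 * a + n)
        * Γ (1 / 2 + 3 * a + n / 2) * Γ (1 + n / 2 + 2 * a) * Γ (1 + a)
        / (sqrtPi * (2 * a + n / 2) * Γ (4 * a + n) ^ 2)) := by
  have hx : (1 - 2 * a - n).im ≠ 0 := affine_im_ne_zero ha (-2) (-n + 1)
  have h : reg3F2 a (2 * a + n / 2) (1 / 2 - a - n / 2) (1 / 2 + 3 * a + n / 2) (1 + a) =
      2 ^ (2 * a) / (sqrtPi * Γ (1 + 4 * a + n)) * (2 ^ (4 * a + n - 1) * Γ (2 * a + n)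
      / Γ (4 * a + n) + altGammaSum 0 (n - 1) (1 - 2 * a - n) (1 + 2 * a) / Γ (1 - 2 * a - n)) := by
    rw [reg3F2_swap_right, reg3F2_swap_left, reg3F2_swap_lower, reg3F2_thomae', reg3F2_swap_right]
    exact reg3F2_eq_altGammaSum_zero hx hn
  have e0 : Γ (1 + 4 * a + n) = (2 * (2 * a + n / 2)) * Γ (4 * a + n) :=
      Gamma_eq_mul_of_eq_add_one (affine_ne_zero ha 4 n)
  have e1 : Γ (2 * a + 2) = Γ (1 + a) * Γ (a + 3 / 2) / (2 ^ (-2 * a - 1) * sqrtPi) :=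
      Gamma_eq_of_duplication
  have f : (4 : ℂ) ^ (n / 2 - 1 + 3 * a) = 2 ^ (6 * a + n - 2) := four_cpow
  have p0 := two_cpow_affine (a / 2) (n / 2) (z := (-2 * a - 1)) (-4) 0 (-1)
  have p1 := two_cpow_affine (a / 2) (n / 2) (z := (2 * a)) 4 0 0
  have p2 := two_cpow_affine (a / 2) (n / 2) (z := (4 * a + n - 1)) 8 2 (-1)
  have p3 := two_cpow_affine (a / 2) (n / 2) (z := (6 * a + n - 2)) 12 2 (-2)
  have g0 : Γ (1 - 2 * a - n) ≠ 0 := Gamma_affine_ne_zero ha (-2) (-n + 1)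
  have g1 : Γ (1 + a) ≠ 0 := Gamma_affine_ne_zero ha 1 1
  have g2 : Γ (a + 3 / 2) ≠ 0 := Gamma_affine_ne_zero ha 1 (3 / 2)
  have g3 : Γ (1 + n / 2 + 2 * a) ≠ 0 := Gamma_affine_ne_zero ha 2 (n / 2 + 1)
  have g4 : Γ (2 * a + n) ≠ 0 := Gamma_affine_ne_zero ha 2 n
  have g5 : Γ (1 / 2 + 3 * a + n / 2) ≠ 0 := Gamma_affine_ne_zero ha 3 (n / 2 + 1 / 2)
  have g6 : Γ (4 * a + n) ≠ 0 := Gamma_affine_ne_zero ha 4 n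
  have l0 : 2 * a + n / 2 ≠ 0 := affine_ne_zero ha 2 (n / 2)
  have hu : (2 : ℂ) ^ (a / 2) ≠ 0 := two_cpow_ne_zero _
  have hv : (2 : ℂ) ^ ((n : ℂ) / 2) ≠ 0 := two_cpow_ne_zero _
  have hpi := sqrtPi_ne_zero
  rw [h, f, e0, e1, p0, p1, p2, p3]
  clear h hx e0 e1 p0 p1 p2 p3 f
  generalize Γ (1 - 2 * a - n) = y0, Γ (1 + a) = y1, Γ (a + 3 / 2) = y2, Γ (1 + n / 2 + 2 * a) = y3,
      Γ (2 * a + n) = y4, Γ (1 / 2 + 3 * a + n / 2) = y5, Γ (4 * a + n) = y6,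
      altGammaSum 0 (n - 1) (1 - 2 * a - n) (1 + 2 * a) = y7, (2 : ℂ) ^ (a / 2) = y8,
      (2 : ℂ) ^ ((n : ℂ) / 2) = y9 at *
  generalize 2 * a + n / 2 = w0 at *
  field_simp
  ring

/-- The unit is (1+a) - a, with 1+a and 1-a-n/2 kept; x = 2-2a-n. -/
theorem reg3F2_add_half_nat_sub_half {a : ℂ} (ha : a.im ≠ 0) {n : ℕ} (hn : 0 < n) :
    Γ (n / 2 - 1 + 3 * a) * Γ (1 + a) * Γ (-1 / 2 + 2 * a + n / 2)
        * reg3F2 a (-1 / 2 + 2 * a + n / 2) (-a - n / 2 + 1) (n / 2 - 1 + 3 * a) (1 + a) =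
      ((altGammaSum 0 (n - 1) (-2 * a - n + 2) (2 * a) * (2 : ℂ) ^ (2 * a - 2)
        / (Γ (-2 * a - n + 2) * Γ (-1 + 4 * a + n)) + (4 : ℂ) ^ (n / 2 + 3 * a - 3)
        * Γ (-1 + 2 * a + n) / ((-1 + 2 * a + n / 2) * Γ (-2 + 4 * a + n) ^ 2)) * (2 / sqrtPi)
        * Γ (-1 / 2 + 2 * a + n / 2) * Γ (n / 2 - 1 + 3 * a) * Γ (1 + a)) := by
  have hx : (-2 * a - n + 2).im ≠ 0 := affine_im_ne_zero ha (-2) (-n + 2)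
  have h : reg3F2 a (-1 / 2 + 2 * a + n / 2) (-a - n / 2 + 1) (n / 2 - 1 + 3 * a) (1 + a) =
      2 ^ (2 * a - 1) / (sqrtPi * Γ (-1 + 4 * a + n)) * (2 ^ (4 * a + n - 3) * Γ (-1 + 2 * a + n)
      / Γ (-2 + 4 * a + n) + altGammaSum 0 (n - 1) (-2 * a - n + 2) (2 * a) / Γ (-2 * a - n + 2)) :=
      by
    rw [reg3F2_swap_right, reg3F2_swap_left, reg3F2_swap_lower, reg3F2_thomae', reg3F2_swap_right,
        reg3F2_swap_lower]
    exact reg3F2_eq_altGammaSum_zero hx hn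
  have e0 : Γ (-1 + 4 * a + n) = (2 * (-1 + 2 * a + n / 2)) * Γ (-2 + 4 * a + n) :=
      Gamma_eq_mul_of_eq_add_one (affine_ne_zero ha 4 (n - 2))
  have f : (4 : ℂ) ^ (n / 2 + 3 * a - 3) = 2 ^ (6 * a + n - 6) := four_cpow
  have p0 := two_cpow_affine (a / 2) (n / 2) (z := (2 * a - 2)) 4 0 (-2)
  have p1 := two_cpow_affine (a / 2) (n / 2) (z := (2 * a - 1)) 4 0 (-1)
  have p2 := two_cpow_affine (a / 2) (n / 2) (z := (4 * a + n - 3)) 8 2 (-3)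
  have p3 := two_cpow_affine (a / 2) (n / 2) (z := (6 * a + n - 6)) 12 2 (-6)
  have g0 : Γ (-2 * a - n + 2) ≠ 0 := Gamma_affine_ne_zero ha (-2) (-n + 2)
  have g1 : Γ (1 + a) ≠ 0 := Gamma_affine_ne_zero ha 1 1
  have g2 : Γ (-1 / 2 + 2 * a + n / 2) ≠ 0 := Gamma_affine_ne_zero ha 2 (n / 2 - 1 / 2)
  have g3 : Γ (-1 + 2 * a + n) ≠ 0 := Gamma_affine_ne_zero ha 2 (n - 1)
  have g4 : Γ (n / 2 - 1 + 3 * a) ≠ 0 := Gamma_affine_ne_zero ha 3 (n / 2 - 1)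
  have g5 : Γ (-2 + 4 * a + n) ≠ 0 := Gamma_affine_ne_zero ha 4 (n - 2)
  have l0 : -1 + 2 * a + n / 2 ≠ 0 := affine_ne_zero ha 2 (n / 2 - 1)
  have hu : (2 : ℂ) ^ (a / 2) ≠ 0 := two_cpow_ne_zero _
  have hv : (2 : ℂ) ^ ((n : ℂ) / 2) ≠ 0 := two_cpow_ne_zero _
  have hpi := sqrtPi_ne_zero
  rw [h, f, e0, p0, p1, p2, p3]
  clear h hx e0 p0 p1 p2 p3 f
  generalize Γ (-2 * a - n + 2) = y0, Γ (1 + a) = y1, Γ (-1 / 2 + 2 * a + n / 2) = y2,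
      Γ (-1 + 2 * a + n) = y3, Γ (n / 2 - 1 + 3 * a) = y4, Γ (-2 + 4 * a + n) = y5,
      altGammaSum 0 (n - 1) (-2 * a - n + 2) (2 * a) = y6, (2 : ℂ) ^ (a / 2) = y7,
      (2 : ℂ) ^ ((n : ℂ) / 2) = y8 at *
  generalize -1 + 2 * a + n / 2 = w0 at *
  field_simp
  ring

/-- The unit is (1+a) - a with a distinguished; the `quadOne` value is that of
`reg3F2_two_mul_same_half` at a/2. -/
theorem reg3F2_half_arguments {a : ℂ} (ha : a.im ≠ 0) {n : ℕ} (hn : 0 < n) :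
    Γ (1 - n / 4 + 3 * a / 4) * Γ (1 + a) * Γ (-n / 4 - a / 4 + 1 / 2)
        * reg3F2 a (a / 2 + 1 / 2) (1 + a / 2) (1 - n / 4 + 3 * a / 4) (1 + a) =
      (1 / 2 * altGammaSum 0 (n - 1) (-n / 2 - a / 2 + 1) (a / 2 - n / 2 + 1)
        * Γ (1 - n / 4 + 3 * a / 4) * Γ (a / 2 - n / 2 + 2) * Γ (-n / 4 - a / 4 + 1 / 2)
        / (Γ (-n / 2 - a / 2 + 1) * Γ (a / 4 - n / 4 + 1) * Γ (3 / 2 + a / 4 - n / 4))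
        + (2 : ℂ) ^ (3 * a / 2 - n / 2 - 1) * Γ (a / 2 + n / 2) * Γ (1 - n / 4 + 3 * a / 4)
        * Γ (-n / 4 - a / 4 + 1 / 2) / (Γ a * sqrtPi)) := by
  have hx : (-n / 2 - a / 2 + 1).im ≠ 0 := affine_im_ne_zero ha (-1 / 2) (-n / 2 + 1)
  have h : reg3F2 a (a / 2 + 1 / 2) (1 + a / 2) (1 - n / 4 + 3 * a / 4) (1 + a) =
      2 ^ (a / 2 - n / 2) / (sqrtPi * Γ (1 + a)) * (2 ^ (a - 1) * Γ (a / 2 + n / 2) / Γ a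
      + altGammaSum 0 (n - 1) (-n / 2 - a / 2 + 1) (a / 2 - n / 2 + 1) / Γ (-n / 2 - a / 2 + 1)) :=
      by
    rw [reg3F2_thomae, reg3F2_swap_right, reg3F2_swap_left]
    exact reg3F2_eq_altGammaSum_zero hx hn
  have e0 : Γ (a / 2 - n / 2 + 2) = Γ (a / 4 - n / 4 + 1) * Γ (3 / 2 + a / 4 - n / 4)
      / (2 ^ (-a / 2 + n / 2 - 1) * sqrtPi) := Gamma_eq_of_duplication
  have p0 := two_cpow_affine (a / 2) (n / 2) (z := (-a / 2 + n / 2 - 1)) (-1) 1 (-1)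
  have p1 := two_cpow_affine (a / 2) (n / 2) (z := (a / 2 - n / 2)) 1 (-1) 0
  have p2 := two_cpow_affine (a / 2) (n / 2) (z := (a - 1)) 2 0 (-1)
  have p3 := two_cpow_affine (a / 2) (n / 2) (z := (3 * a / 2 - n / 2 - 1)) 3 (-1) (-1)
  have g0 : Γ (-n / 2 - a / 2 + 1) ≠ 0 := Gamma_affine_ne_zero ha (-1 / 2) (-n / 2 + 1)
  have g1 : Γ (-n / 4 - a / 4 + 1 / 2) ≠ 0 := Gamma_affine_ne_zero ha (-1 / 4) (-n / 4 + 1 / 2)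
  have g2 : Γ (a / 4 - n / 4 + 1) ≠ 0 := Gamma_affine_ne_zero ha (1 / 4) (-n / 4 + 1)
  have g3 : Γ (3 / 2 + a / 4 - n / 4) ≠ 0 := Gamma_affine_ne_zero ha (1 / 4) (-n / 4 + 3 / 2)
  have g4 : Γ (a / 2 + n / 2) ≠ 0 := Gamma_affine_ne_zero ha (1 / 2) (n / 2)
  have g5 : Γ (1 - n / 4 + 3 * a / 4) ≠ 0 := Gamma_affine_ne_zero ha (3 / 4) (-n / 4 + 1)
  have g6 : Γ a ≠ 0 := Gamma_affine_ne_zero ha 1 0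
  have g7 : Γ (1 + a) ≠ 0 := Gamma_affine_ne_zero ha 1 1
  have hu : (2 : ℂ) ^ (a / 2) ≠ 0 := two_cpow_ne_zero _
  have hv : (2 : ℂ) ^ ((n : ℂ) / 2) ≠ 0 := two_cpow_ne_zero _
  have hpi := sqrtPi_ne_zero
  rw [h, e0, p0, p1, p2, p3]
  clear h hx e0 p0 p1 p2 p3
  generalize Γ (-n / 2 - a / 2 + 1) = y0, Γ (-n / 4 - a / 4 + 1 / 2) = y1, Γ (a / 4 - n / 4 + 1) =
      y2, Γ (3 / 2 + a / 4 - n / 4) = y3, Γ (a / 2 + n / 2) = y4, Γ (1 - n / 4 + 3 * a / 4) = y5,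
      Γ a = y6, Γ (1 + a) = y7, altGammaSum 0 (n - 1) (-n / 2 - a / 2 + 1) (a / 2 - n / 2 + 1) = y8,
      (2 : ℂ) ^ (a / 2) = y9, (2 : ℂ) ^ ((n : ℂ) / 2) = y10 at *
  field_simp
  ring

/-- Same `quadOne` value as for `reg3F2_add_half_nat_lower`, keeping the other member 1-a-n/2 of the
upper pair. -/
theorem reg3F2_add_half_nat_add_half {a : ℂ} (ha : a.im ≠ 0) {n : ℕ} (hn : 0 < n) :
    Γ (1 + 3 * a + n / 2) * Γ (1 + a) * Γ (1 / 2 + 2 * a + n / 2)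
        * reg3F2 a (1 / 2 + 2 * a + n / 2) (-a - n / 2 + 1) (1 + 3 * a + n / 2) (1 + a) =
      (1 / 2 * altGammaSum 0 (n - 1) (1 - 2 * a - n) (1 + 2 * a) * Γ (1 + 3 * a + n / 2)
        * Γ (1 / 2 + 2 * a + n / 2) * Γ (2 * a + 2) / (Γ (1 - 2 * a - n) * Γ (1 + 4 * a + n)
        * Γ (a + 3 / 2)) + (2 : ℂ) ^ (-2 + n + 6 * a) * Γ (2 * a + n) * Γ (1 + 3 * a + n / 2)
        * Γ (1 / 2 + 2 * a + n / 2) * Γ (1 + a) / (sqrtPi * (2 * a + n / 2) * Γ (4 * a + n) ^ 2)) :=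
        by
  have hx : (1 - 2 * a - n).im ≠ 0 := affine_im_ne_zero ha (-2) (-n + 1)
  have h : reg3F2 a (1 / 2 + 2 * a + n / 2) (-a - n / 2 + 1) (1 + 3 * a + n / 2) (1 + a) =
      2 ^ (2 * a) / (sqrtPi * Γ (1 + 4 * a + n)) * (2 ^ (4 * a + n - 1) * Γ (2 * a + n)
      / Γ (4 * a + n) + altGammaSum 0 (n - 1) (1 - 2 * a - n) (1 + 2 * a) / Γ (1 - 2 * a - n)) := by
    rw [reg3F2_swap_right, reg3F2_swap_left, reg3F2_swap_lower, reg3F2_thomae', reg3F2_swap_right,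
        reg3F2_swap_left]
    exact reg3F2_eq_altGammaSum_zero hx hn
  have e0 : Γ (1 + 4 * a + n) = (2 * (2 * a + n / 2)) * Γ (4 * a + n) :=
      Gamma_eq_mul_of_eq_add_one (affine_ne_zero ha 4 n)
  have e1 : Γ (2 * a + 2) = Γ (1 + a) * Γ (a + 3 / 2) / (2 ^ (-2 * a - 1) * sqrtPi) :=
      Gamma_eq_of_duplication
  have p0 := two_cpow_affine (a / 2) (n / 2) (z := (-2 * a - 1)) (-4) 0 (-1)
  have p1 := two_cpow_affine (a / 2) (n / 2) (z := (2 * a)) 4 0 0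
  have p2 := two_cpow_affine (a / 2) (n / 2) (z := (4 * a + n - 1)) 8 2 (-1)
  have p3 := two_cpow_affine (a / 2) (n / 2) (z := (-2 + n + 6 * a)) 12 2 (-2)
  have g0 : Γ (1 - 2 * a - n) ≠ 0 := Gamma_affine_ne_zero ha (-2) (-n + 1)
  have g1 : Γ (1 + a) ≠ 0 := Gamma_affine_ne_zero ha 1 1
  have g2 : Γ (a + 3 / 2) ≠ 0 := Gamma_affine_ne_zero ha 1 (3 / 2)
  have g3 : Γ (1 / 2 + 2 * a + n / 2) ≠ 0 := Gamma_affine_ne_zero ha 2 (n / 2 + 1 / 2)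
  have g4 : Γ (2 * a + n) ≠ 0 := Gamma_affine_ne_zero ha 2 n
  have g5 : Γ (1 + 3 * a + n / 2) ≠ 0 := Gamma_affine_ne_zero ha 3 (n / 2 + 1)
  have g6 : Γ (4 * a + n) ≠ 0 := Gamma_affine_ne_zero ha 4 n
  have l0 : 2 * a + n / 2 ≠ 0 := affine_ne_zero ha 2 (n / 2)
  have hu : (2 : ℂ) ^ (a / 2) ≠ 0 := two_cpow_ne_zero _
  have hv : (2 : ℂ) ^ ((n : ℂ) / 2) ≠ 0 := two_cpow_ne_zero _
  have hpi := sqrtPi_ne_zero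
  rw [h, e0, e1, p0, p1, p2, p3]
  clear h hx e0 e1 p0 p1 p2 p3
  generalize Γ (1 - 2 * a - n) = y0, Γ (1 + a) = y1, Γ (a + 3 / 2) = y2, Γ (1 / 2 + 2 * a + n / 2) =
      y3, Γ (2 * a + n) = y4, Γ (1 + 3 * a + n / 2) = y5, Γ (4 * a + n) = y6,
      altGammaSum 0 (n - 1) (1 - 2 * a - n) (1 + 2 * a) = y7, (2 : ℂ) ^ (a / 2) = y8,
      (2 : ℂ) ^ ((n : ℂ) / 2) = y9 at *
  generalize 2 * a + n / 2 = w0 at *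
  field_simp
  ring

/-- Companion of `reg3F2_add_half_nat_sub_half`: same `quadOne` value, the other member 3/2-a-n/2 of
the upper pair kept. -/
theorem reg3F2_add_half_nat_three_halves {a : ℂ} (ha : a.im ≠ 0) {n : ℕ} (hn : 0 < n) :
    Γ (-1 / 2 + 3 * a + n / 2) * Γ (1 + a) * Γ (-1 + 2 * a + n / 2)
        * reg3F2 a (2 * a + n / 2) (-a + 3 / 2 - n / 2) (-1 / 2 + 3 * a + n / 2) (1 + a) =
      (1 / 2 * altGammaSum 0 (n - 1) (-2 * a - n + 2) (2 * a) * Γ (-1 / 2 + 3 * a + n / 2)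
        * Γ (-1 + 2 * a + n / 2) * Γ (2 * a + 1) / (Γ (-2 * a - n + 2) * Γ (-1 + 4 * a + n)
        * Γ (a + 1 / 2)) + (2 : ℂ) ^ (-5 + n + 6 * a) * Γ (1 + a) * Γ (-1 + 2 * a + n / 2)
        * Γ (-1 + 2 * a + n) * Γ (-1 / 2 + 3 * a + n / 2) / ((-1 + 2 * a + n / 2) * sqrtPi
        * Γ (-2 + 4 * a + n) ^ 2)) := by
  have hx : (-2 * a - n + 2).im ≠ 0 := affine_im_ne_zero ha (-2) (-n + 2)
  have h : reg3F2 a (2 * a + n / 2) (-a + 3 / 2 - n / 2) (-1 / 2 + 3 * a + n / 2) (1 + a) =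
      2 ^ (2 * a - 1) / (sqrtPi * Γ (-1 + 4 * a + n)) * (2 ^ (4 * a + n - 3) * Γ (-1 + 2 * a + n)
      / Γ (-2 + 4 * a + n) + altGammaSum 0 (n - 1) (-2 * a - n + 2) (2 * a) / Γ (-2 * a - n + 2)) :=
      by
    rw [reg3F2_swap_right, reg3F2_swap_left, reg3F2_swap_lower, reg3F2_thomae', reg3F2_swap_right,
        reg3F2_swap_left, reg3F2_swap_lower]
    exact reg3F2_eq_altGammaSum_zero hx hn
  have e0 : Γ (-1 + 4 * a + n) = (2 * (-1 + 2 * a + n / 2)) * Γ (-2 + 4 * a + n) :=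
      Gamma_eq_mul_of_eq_add_one (affine_ne_zero ha 4 (n - 2))
  have e1 : Γ (2 * a + 1) = Γ (a + 1 / 2) * Γ (1 + a) / (2 ^ (-2 * a) * sqrtPi) :=
      Gamma_eq_of_duplication
  have p0 := two_cpow_affine (a / 2) (n / 2) (z := (-2 * a)) (-4) 0 0
  have p1 := two_cpow_affine (a / 2) (n / 2) (z := (2 * a - 1)) 4 0 (-1)
  have p2 := two_cpow_affine (a / 2) (n / 2) (z := (4 * a + n - 3)) 8 2 (-3)
  have p3 := two_cpow_affine (a / 2) (n / 2) (z := (-5 + n + 6 * a)) 12 2 (-5)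
  have g0 : Γ (-2 * a - n + 2) ≠ 0 := Gamma_affine_ne_zero ha (-2) (-n + 2)
  have g1 : Γ (a + 1 / 2) ≠ 0 := Gamma_affine_ne_zero ha 1 (1 / 2)
  have g2 : Γ (1 + a) ≠ 0 := Gamma_affine_ne_zero ha 1 1
  have g3 : Γ (-1 + 2 * a + n / 2) ≠ 0 := Gamma_affine_ne_zero ha 2 (n / 2 - 1)
  have g4 : Γ (-1 + 2 * a + n) ≠ 0 := Gamma_affine_ne_zero ha 2 (n - 1)
  have g5 : Γ (-1 / 2 + 3 * a + n / 2) ≠ 0 := Gamma_affine_ne_zero ha 3 (n / 2 - 1 / 2)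
  have g6 : Γ (-2 + 4 * a + n) ≠ 0 := Gamma_affine_ne_zero ha 4 (n - 2)
  have l0 : -1 + 2 * a + n / 2 ≠ 0 := affine_ne_zero ha 2 (n / 2 - 1)
  have hu : (2 : ℂ) ^ (a / 2) ≠ 0 := two_cpow_ne_zero _
  have hv : (2 : ℂ) ^ ((n : ℂ) / 2) ≠ 0 := two_cpow_ne_zero _
  have hpi := sqrtPi_ne_zero
  rw [h, e0, e1, p0, p1, p2, p3]
  clear h hx e0 e1 p0 p1 p2 p3
  generalize Γ (-2 * a - n + 2) = y0, Γ (a + 1 / 2) = y1, Γ (1 + a) = y2, Γ (-1 + 2 * a + n / 2) =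
      y3, Γ (-1 + 2 * a + n) = y4, Γ (-1 / 2 + 3 * a + n / 2) = y5, Γ (-2 + 4 * a + n) = y6,
      altGammaSum 0 (n - 1) (-2 * a - n + 2) (2 * a) = y7, (2 : ℂ) ^ (a / 2) = y8,
      (2 : ℂ) ^ ((n : ℂ) / 2) = y9 at *
  generalize -1 + 2 * a + n / 2 = w0 at *
  field_simp
  ring

/-- The unit upper parameter is present from the start. `reg3F2_thomae'` keeps it together with
a/2-n/4+1 and reflects the pair a, a+1/2, which leads to the `quadOne` value of
`reg3F2_two_mul_same_half`. -/
theorem reg3F2_unit_two_mul_add_one {a : ℂ} (ha : a.im ≠ 0) {n : ℕ} (hn : 0 < n) :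
    Γ (2 * a + 1) * Γ (a / 2 - n / 4 + 1) * Γ (1 / 2 + a / 2 - n / 4)
        * reg3F2 a (a + 1 / 2) 1 (2 * a + 1) (a / 2 - n / 4 + 1) =
      ((2 : ℂ) ^ (2 * a - 2) * Γ (1 / 2 + a / 2 - n / 4) * Γ (2 + a - n / 2) * Γ (a + n / 2)
        / (Γ (2 * a) * Γ (a / 2 - n / 4 + 3 / 2)) + 1 / 2 * altGammaSum 0 (n - 1) (-a - n / 2 + 1)
        (a - n / 2 + 1) * Γ (1 / 2 + a / 2 - n / 4) * Γ (2 + a - n / 2)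
        / (Γ (-a - n / 2 + 1) * Γ (a / 2 - n / 4 + 3 / 2))) := by
  have hx : (-a - n / 2 + 1).im ≠ 0 := affine_im_ne_zero ha (-1) (-n / 2 + 1)
  have h : reg3F2 a (a + 1 / 2) 1 (2 * a + 1) (a / 2 - n / 4 + 1) = 2 ^ (a - n / 2)
      / (sqrtPi * Γ (2 * a + 1)) * (2 ^ (2 * a - 1) * Γ (a + n / 2) / Γ (2 * a)
      + altGammaSum 0 (n - 1) (-a - n / 2 + 1) (a - n / 2 + 1) / Γ (-a - n / 2 + 1)) := by
    rw [reg3F2_swap_right, reg3F2_swap_left, reg3F2_swap_lower, reg3F2_thomae', reg3F2_swap_left,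
        reg3F2_swap_right, reg3F2_swap_left]
    exact reg3F2_eq_altGammaSum_zero hx hn
  have e0 : Γ (2 + a - n / 2) = Γ (a / 2 - n / 4 + 1) * Γ (a / 2 - n / 4 + 3 / 2)
      / (2 ^ (-a + n / 2 - 1) * sqrtPi) := Gamma_eq_of_duplication
  have p0 := two_cpow_affine (a / 2) (n / 2) (z := (-a + n / 2 - 1)) (-2) 1 (-1)
  have p1 := two_cpow_affine (a / 2) (n / 2) (z := (a - n / 2)) 2 (-1) 0
  have p2 := two_cpow_affine (a / 2) (n / 2) (z := (2 * a - 2)) 4 0 (-2)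
  have p3 := two_cpow_affine (a / 2) (n / 2) (z := (2 * a - 1)) 4 0 (-1)
  have g0 : Γ (-a - n / 2 + 1) ≠ 0 := Gamma_affine_ne_zero ha (-1) (-n / 2 + 1)
  have g1 : Γ (1 / 2 + a / 2 - n / 4) ≠ 0 := Gamma_affine_ne_zero ha (1 / 2) (-n / 4 + 1 / 2)
  have g2 : Γ (a / 2 - n / 4 + 1) ≠ 0 := Gamma_affine_ne_zero ha (1 / 2) (-n / 4 + 1)
  have g3 : Γ (a / 2 - n / 4 + 3 / 2) ≠ 0 := Gamma_affine_ne_zero ha (1 / 2) (-n / 4 + 3 / 2)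
  have g4 : Γ (a + n / 2) ≠ 0 := Gamma_affine_ne_zero ha 1 (n / 2)
  have g5 : Γ (2 * a) ≠ 0 := Gamma_affine_ne_zero ha 2 0
  have g6 : Γ (2 * a + 1) ≠ 0 := Gamma_affine_ne_zero ha 2 1
  have hu : (2 : ℂ) ^ (a / 2) ≠ 0 := two_cpow_ne_zero _
  have hv : (2 : ℂ) ^ ((n : ℂ) / 2) ≠ 0 := two_cpow_ne_zero _
  have hpi := sqrtPi_ne_zero
  rw [h, e0, p0, p1, p2, p3]
  clear h hx e0 p0 p1 p2 p3
  generalize Γ (-a - n / 2 + 1) = y0, Γ (1 / 2 + a / 2 - n / 4) = y1, Γ (a / 2 - n / 4 + 1) = y2,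
      Γ (a / 2 - n / 4 + 3 / 2) = y3, Γ (a + n / 2) = y4, Γ (2 * a) = y5, Γ (2 * a + 1) = y6,
      altGammaSum 0 (n - 1) (-a - n / 2 + 1) (a - n / 2 + 1) = y7, (2 : ℂ) ^ (a / 2) = y8,
      (2 : ℂ) ^ ((n : ℂ) / 2) = y9 at *
  field_simp

/-- As before with the given unit kept; x = 2-a-n/2. -/
theorem reg3F2_unit_two_mul_sub_one {a : ℂ} (ha : a.im ≠ 0) {n : ℕ} (hn : 0 < n) :
    Γ (2 * a - 1) * Γ (a / 2 - n / 4 + 1) * Γ (a / 2 - n / 4 - 1 / 2)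
        * reg3F2 (a - 1 / 2) a 1 (2 * a - 1) (a / 2 - n / 4 + 1) =
      (((2 : ℂ) ^ (-1 + a - n / 2) * altGammaSum 0 (n - 1) (-n / 2 - a + 2) (a - n / 2)
        * Γ (a / 2 - n / 4 + 1) / (Γ (-a - n / 2 + 2) * sqrtPi) + (2 : ℂ) ^ (3 * a - 4 - n / 2)
        * Γ (-1 + n / 2 + a) * Γ (a / 2 - n / 4 + 1) / (sqrtPi * Γ (2 * a - 2)))
        * Γ (a / 2 - n / 4 - 1 / 2)) := by
  have hx : (-a - n / 2 + 2).im ≠ 0 := affine_im_ne_zero ha (-1) (-n / 2 + 2)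
  have h : reg3F2 (a - 1 / 2) a 1 (2 * a - 1) (a / 2 - n / 4 + 1) = 2 ^ (-1 + a - n / 2)
      / (sqrtPi * Γ (2 * a - 1)) * (2 ^ (2 * a - 3) * Γ (-1 + n / 2 + a) / Γ (2 * a - 2)
      + altGammaSum 0 (n - 1) (-n / 2 - a + 2) (a - n / 2) / Γ (-a - n / 2 + 2)) := by
    rw [reg3F2_swap_right, reg3F2_swap_left, reg3F2_swap_lower, reg3F2_thomae', reg3F2_swap_left,
        reg3F2_swap_right, reg3F2_swap_left, reg3F2_swap_lower, show -(n : ℂ) / 2 - a + 2 = -a - n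
        / 2 + 2 by ring]
    exact reg3F2_eq_altGammaSum_zero hx hn
  have p0 := two_cpow_affine (a / 2) (n / 2) (z := (-1 + a - n / 2)) 2 (-1) (-1)
  have p1 := two_cpow_affine (a / 2) (n / 2) (z := (2 * a - 3)) 4 0 (-3)
  have p2 := two_cpow_affine (a / 2) (n / 2) (z := (3 * a - 4 - n / 2)) 6 (-1) (-4)
  have g0 : Γ (-a - n / 2 + 2) ≠ 0 := Gamma_affine_ne_zero ha (-1) (-n / 2 + 2)
  have g1 : Γ (a / 2 - n / 4 - 1 / 2) ≠ 0 := Gamma_affine_ne_zero ha (1 / 2) (-n / 4 - 1 / 2)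
  have g2 : Γ (a / 2 - n / 4 + 1) ≠ 0 := Gamma_affine_ne_zero ha (1 / 2) (-n / 4 + 1)
  have g3 : Γ (-1 + n / 2 + a) ≠ 0 := Gamma_affine_ne_zero ha 1 (n / 2 - 1)
  have g4 : Γ (2 * a - 2) ≠ 0 := Gamma_affine_ne_zero ha 2 (-2)
  have g5 : Γ (2 * a - 1) ≠ 0 := Gamma_affine_ne_zero ha 2 (-1)
  have hu : (2 : ℂ) ^ (a / 2) ≠ 0 := two_cpow_ne_zero _
  have hv : (2 : ℂ) ^ ((n : ℂ) / 2) ≠ 0 := two_cpow_ne_zero _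
  have hpi := sqrtPi_ne_zero
  rw [h, p0, p1, p2]
  clear h hx p0 p1 p2
  generalize Γ (-a - n / 2 + 2) = y0, Γ (a / 2 - n / 4 - 1 / 2) = y1, Γ (a / 2 - n / 4 + 1) = y2,
      Γ (-1 + n / 2 + a) = y3, Γ (2 * a - 2) = y4, Γ (2 * a - 1) = y5,
      altGammaSum 0 (n - 1) (-n / 2 - a + 2) (a - n / 2) = y6, (2 : ℂ) ^ (a / 2) = y7,
      (2 : ℂ) ^ ((n : ℂ) / 2) = y8 at *
  field_simp
  ring

/-- The unit is 2a - (2a-1). The evaluation is taken with x = 1-a-n and 2n in place of n, because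
(x+2n)/2 = (1-a+n)/2 is the upper parameter produced by Thomae's transformation. -/
theorem reg3F2_two_mul_sub_one_nat {a : ℂ} (ha : a.im ≠ 0) {n : ℕ} (hn : 0 < n) :
    Γ (-1 / 2 + 3 * a / 2 + n / 2) * Γ (2 * a) * Γ (1 - a / 2 + n / 2)
        * reg3F2 (2 * a - 1) a (a - 1 / 2) (-1 / 2 + 3 * a / 2 + n / 2) (2 * a) =
      (-(1 / 2) * (Γ (1 + a + n) * Γ (a - n) * altGammaSum 1 (2 * n - 1) (-a - n + 1) (a - n)
        * Γ (-1 / 2 + 3 * a / 2 + n / 2) * Γ (1 - a / 2 + n / 2)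
        / (Γ (-a - n + 1) * Γ (a + n) * Γ (a / 2 + n / 2 + 1) * Γ (a / 2 + n / 2 + 1 / 2)))
        + (2 : ℂ) ^ (3 * a + n - 3) * Γ (-1 / 2 + 3 * a / 2 + n / 2) * Γ (a - n)
        * Γ (1 - a / 2 + n / 2) / (sqrtPi * Γ (2 * a - 1))) := by
  have hx : (-a - n + 1).im ≠ 0 := affine_im_ne_zero ha (-1) (-n + 1)
  have h : reg3F2 (2 * a - 1) a (a - 1 / 2) (-1 / 2 + 3 * a / 2 + n / 2) (2 * a) = 2 ^ (a + n - 1)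
      / (sqrtPi * Γ (2 * a)) * Γ (a - n) * (2 ^ (2 * a - 2) / Γ (2 * a - 1)
      - altGammaSum 1 (2 * n - 1) (-a - n + 1) (a - n) / (Γ (-a - n + 1) * Γ (a + n))) := by
    rw [reg3F2_thomae, reg3F2_swap_right, reg3F2_swap_lower]
    have h2n : 0 < 2 * n := by omega
    exact reg3F2_eq_altGammaSum_one hx h2n (n := 2 * n)
  have e0 : Γ (1 + a + n) = Γ (a / 2 + n / 2 + 1 / 2) * Γ (a / 2 + n / 2 + 1)
      / (2 ^ (-a - n) * sqrtPi) := Gamma_eq_of_duplication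
  have p0 := two_cpow_affine (a / 2) (n / 2) (z := (-a - n)) (-2) (-2) 0
  have p1 := two_cpow_affine (a / 2) (n / 2) (z := (a + n - 1)) 2 2 (-1)
  have p2 := two_cpow_affine (a / 2) (n / 2) (z := (2 * a - 2)) 4 0 (-2)
  have p3 := two_cpow_affine (a / 2) (n / 2) (z := (3 * a + n - 3)) 6 2 (-3)
  have g0 : Γ (-a - n + 1) ≠ 0 := Gamma_affine_ne_zero ha (-1) (-n + 1)
  have g1 : Γ (1 - a / 2 + n / 2) ≠ 0 := Gamma_affine_ne_zero ha (-1 / 2) (n / 2 + 1)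
  have g2 : Γ (a / 2 + n / 2 + 1 / 2) ≠ 0 := Gamma_affine_ne_zero ha (1 / 2) (n / 2 + 1 / 2)
  have g3 : Γ (a / 2 + n / 2 + 1) ≠ 0 := Gamma_affine_ne_zero ha (1 / 2) (n / 2 + 1)
  have g4 : Γ (a - n) ≠ 0 := Gamma_affine_ne_zero ha 1 (-n)
  have g5 : Γ (a + n) ≠ 0 := Gamma_affine_ne_zero ha 1 n
  have g6 : Γ (-1 / 2 + 3 * a / 2 + n / 2) ≠ 0 := Gamma_affine_ne_zero ha (3 / 2) (n / 2 - 1 / 2)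
  have g7 : Γ (2 * a - 1) ≠ 0 := Gamma_affine_ne_zero ha 2 (-1)
  have g8 : Γ (2 * a) ≠ 0 := Gamma_affine_ne_zero ha 2 0
  have hu : (2 : ℂ) ^ (a / 2) ≠ 0 := two_cpow_ne_zero _
  have hv : (2 : ℂ) ^ ((n : ℂ) / 2) ≠ 0 := two_cpow_ne_zero _
  have hpi := sqrtPi_ne_zero
  rw [h, e0, p0, p1, p2, p3]
  clear h hx e0 p0 p1 p2 p3
  generalize Γ (-a - n + 1) = y0, Γ (1 - a / 2 + n / 2) = y1, Γ (a / 2 + n / 2 + 1 / 2) = y2,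
      Γ (a / 2 + n / 2 + 1) = y3, Γ (a - n) = y4, Γ (a + n) = y5, Γ (-1 / 2 + 3 * a / 2 + n / 2) =
      y6, Γ (2 * a - 1) = y7, Γ (2 * a) = y8, altGammaSum 1 (2 * n - 1) (-a - n + 1) (a - n) = y9,
      (2 : ℂ) ^ (a / 2) = y10, (2 : ℂ) ^ ((n : ℂ) / 2) = y11 at *
  field_simp
  ring

/-- The unit is (1+a) - a, with 1+a and 1/2+n/2-a kept; x = 1-2a on the upward branch. -/
theorem reg3F2_sub_half_nat_lower {a : ℂ} (ha : a.im ≠ 0) {n : ℕ} (hn : 0 < n) :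
    Γ (-1 / 2 - n / 2 + 3 * a) * Γ (1 + a) * Γ (-n / 2 + 2 * a)
        * reg3F2 a (-n / 2 + 2 * a) (1 / 2 + n / 2 - a) (-1 / 2 - n / 2 + 3 * a) (1 + a) =
      (-(1 / 2) * (Γ (2 * a + 1) * Γ (-n + 2 * a) * altGammaSum 1 (n - 1) (1 - 2 * a) (2 * a - n)
        * Γ (-1 / 2 - n / 2 + 3 * a) * Γ (-n / 2 + 2 * a) / (Γ (2 * a) * Γ (a + 1 / 2)
        * Γ (1 - 2 * a) * Γ (4 * a - n))) - (2 : ℂ) ^ (6 * a - 3 - n) * (n - 4 * a + 1) * Γ (1 + a)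
        * Γ (-n + 2 * a) * Γ (-1 / 2 - n / 2 + 3 * a) * Γ (-n / 2 + 2 * a)
        / (sqrtPi * Γ (4 * a - n) ^ 2)) := by
  have hx : (1 - 2 * a).im ≠ 0 := affine_im_ne_zero ha (-2) 1
  have h : reg3F2 a (-n / 2 + 2 * a) (1 / 2 + n / 2 - a) (-1 / 2 - n / 2 + 3 * a) (1 + a) =
      2 ^ (2 * a - 1) / (sqrtPi * Γ (4 * a - n)) * Γ (-n + 2 * a)
      * (2 ^ (4 * a - n - 2) / Γ (4 * a - n - 1) - altGammaSum 1 (n - 1) (1 - 2 * a) (2 * a - n)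
      / (Γ (1 - 2 * a) * Γ (2 * a))) := by
    rw [reg3F2_swap_right, reg3F2_swap_left, reg3F2_swap_lower, reg3F2_thomae', reg3F2_swap_right,
        reg3F2_swap_lower]
    exact reg3F2_eq_altGammaSum_one hx hn
  have e0 : Γ (4 * a - n) = (-(n - 4 * a + 1)) * Γ (4 * a - n - 1) :=
      Gamma_eq_mul_of_eq_add_one (affine_ne_zero ha 4 (-n - 1))
  have e1 : Γ (2 * a + 1) = Γ (a + 1 / 2) * Γ (1 + a) / (2 ^ (-2 * a) * sqrtPi) :=
      Gamma_eq_of_duplication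
  have p0 := two_cpow_affine (a / 2) (n / 2) (z := (-2 * a)) (-4) 0 0
  have p1 := two_cpow_affine (a / 2) (n / 2) (z := (2 * a - 1)) 4 0 (-1)
  have p2 := two_cpow_affine (a / 2) (n / 2) (z := (4 * a - n - 2)) 8 (-2) (-2)
  have p3 := two_cpow_affine (a / 2) (n / 2) (z := (6 * a - 3 - n)) 12 (-2) (-3)
  have g0 : Γ (1 - 2 * a) ≠ 0 := Gamma_affine_ne_zero ha (-2) 1
  have g1 : Γ (a + 1 / 2) ≠ 0 := Gamma_affine_ne_zero ha 1 (1 / 2)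
  have g2 : Γ (1 + a) ≠ 0 := Gamma_affine_ne_zero ha 1 1
  have g3 : Γ (-n + 2 * a) ≠ 0 := Gamma_affine_ne_zero ha 2 (-n)
  have g4 : Γ (-n / 2 + 2 * a) ≠ 0 := Gamma_affine_ne_zero ha 2 (-n / 2)
  have g5 : Γ (2 * a) ≠ 0 := Gamma_affine_ne_zero ha 2 0
  have g6 : Γ (-1 / 2 - n / 2 + 3 * a) ≠ 0 := Gamma_affine_ne_zero ha 3 (-n / 2 - 1 / 2)
  have g7 : Γ (4 * a - n - 1) ≠ 0 := Gamma_affine_ne_zero ha 4 (-n - 1)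
  have l0 : n - 4 * a + 1 ≠ 0 := affine_ne_zero ha (-4) (n + 1)
  have hu : (2 : ℂ) ^ (a / 2) ≠ 0 := two_cpow_ne_zero _
  have hv : (2 : ℂ) ^ ((n : ℂ) / 2) ≠ 0 := two_cpow_ne_zero _
  have hpi := sqrtPi_ne_zero
  rw [h, e0, e1, p0, p1, p2, p3]
  clear h hx e0 e1 p0 p1 p2 p3
  generalize Γ (1 - 2 * a) = y0, Γ (a + 1 / 2) = y1, Γ (1 + a) = y2, Γ (-n + 2 * a) = y3,
      Γ (-n / 2 + 2 * a) = y4, Γ (2 * a) = y5, Γ (-1 / 2 - n / 2 + 3 * a) = y6, Γ (4 * a - n - 1) =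
      y7, altGammaSum 1 (n - 1) (1 - 2 * a) (2 * a - n) = y8, (2 : ℂ) ^ (a / 2) = y9,
      (2 : ℂ) ^ ((n : ℂ) / 2) = y10 at *
  generalize n - 4 * a + 1 = w0 at *
  field_simp
  ring

/-- The unit is (1+a) - a, and the `quadOne` value is that of `reg3F2_four_mul_sub_nat`. -/
theorem reg3F2_sub_half_nat_nonneg {a : ℂ} (ha : a.im ≠ 0) {n : ℕ} (hn : 0 < n) :
    Γ (1 - n / 2 + 3 * a) * Γ (1 + a) * Γ (3 / 2 - n / 2 + 2 * a)
        * reg3F2 a (-n / 2 + 1 / 2 + 2 * a) (-a + n / 2) (1 - n / 2 + 3 * a) (1 + a) =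
      (-(1 / 2) * (Γ (2 * a + 2) * Γ (1 + 2 * a - n) * altGammaSum 1 (n - 1) (-2 * a)
        (1 - n + 2 * a) * Γ (1 - n / 2 + 3 * a) * Γ (3 / 2 - n / 2 + 2 * a)
        / (Γ (-2 * a) * Γ (2 - n + 4 * a) * Γ (2 * a + 1) * Γ (a + 3 / 2))) - (2 : ℂ) ^ (-n + 6 * a)
        * (n - 1 - 4 * a) * Γ (1 + 2 * a - n) * Γ (1 - n / 2 + 3 * a) * Γ (1 + a)
        * Γ (3 / 2 - n / 2 + 2 * a) / (sqrtPi * Γ (2 - n + 4 * a) ^ 2)) := by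
  have hx : (-2 * a).im ≠ 0 := affine_im_ne_zero ha (-2) 0
  have h : reg3F2 a (-n / 2 + 1 / 2 + 2 * a) (-a + n / 2) (1 - n / 2 + 3 * a) (1 + a) = 2 ^ (2 * a)
      / (sqrtPi * Γ (2 - n + 4 * a)) * Γ (1 + 2 * a - n) * (2 ^ (4 * a - n) / Γ (4 * a - n + 1)
      - altGammaSum 1 (n - 1) (-2 * a) (1 - n + 2 * a) / (Γ (-2 * a) * Γ (2 * a + 1))) := by
    rw [reg3F2_swap_right, reg3F2_swap_left, reg3F2_swap_lower, reg3F2_thomae', reg3F2_swap_right]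
    exact reg3F2_eq_altGammaSum_one hx hn
  have e0 : Γ (2 - n + 4 * a) = (-(n - 1 - 4 * a)) * Γ (4 * a - n + 1) :=
      Gamma_eq_mul_of_eq_add_one (affine_ne_zero ha 4 (-n + 1))
  have e1 : Γ (2 * a + 2) = Γ (1 + a) * Γ (a + 3 / 2) / (2 ^ (-2 * a - 1) * sqrtPi) :=
      Gamma_eq_of_duplication
  have p0 := two_cpow_affine (a / 2) (n / 2) (z := (-2 * a - 1)) (-4) 0 (-1)
  have p1 := two_cpow_affine (a / 2) (n / 2) (z := (2 * a)) 4 0 0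
  have p2 := two_cpow_affine (a / 2) (n / 2) (z := (4 * a - n)) 8 (-2) 0
  have p3 := two_cpow_affine (a / 2) (n / 2) (z := (-n + 6 * a)) 12 (-2) 0
  have g0 : Γ (-2 * a) ≠ 0 := Gamma_affine_ne_zero ha (-2) 0
  have g1 : Γ (1 + a) ≠ 0 := Gamma_affine_ne_zero ha 1 1
  have g2 : Γ (a + 3 / 2) ≠ 0 := Gamma_affine_ne_zero ha 1 (3 / 2)
  have g3 : Γ (1 + 2 * a - n) ≠ 0 := Gamma_affine_ne_zero ha 2 (-n + 1)
  have g4 : Γ (3 / 2 - n / 2 + 2 * a) ≠ 0 := Gamma_affine_ne_zero ha 2 (-n / 2 + 3 / 2)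
  have g5 : Γ (2 * a + 1) ≠ 0 := Gamma_affine_ne_zero ha 2 1
  have g6 : Γ (1 - n / 2 + 3 * a) ≠ 0 := Gamma_affine_ne_zero ha 3 (-n / 2 + 1)
  have g7 : Γ (4 * a - n + 1) ≠ 0 := Gamma_affine_ne_zero ha 4 (-n + 1)
  have l0 : n - 1 - 4 * a ≠ 0 := affine_ne_zero ha (-4) (n - 1)
  have hu : (2 : ℂ) ^ (a / 2) ≠ 0 := two_cpow_ne_zero _
  have hv : (2 : ℂ) ^ ((n : ℂ) / 2) ≠ 0 := two_cpow_ne_zero _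
  have hpi := sqrtPi_ne_zero
  rw [h, e0, e1, p0, p1, p2, p3]
  clear h hx e0 e1 p0 p1 p2 p3
  generalize Γ (-2 * a) = y0, Γ (1 + a) = y1, Γ (a + 3 / 2) = y2, Γ (1 + 2 * a - n) = y3,
      Γ (3 / 2 - n / 2 + 2 * a) = y4, Γ (2 * a + 1) = y5, Γ (1 - n / 2 + 3 * a) = y6,
      Γ (4 * a - n + 1) = y7, altGammaSum 1 (n - 1) (-2 * a) (1 - n + 2 * a) = y8, (2 : ℂ) ^ (a / 2)
      = y9, (2 : ℂ) ^ ((n : ℂ) / 2) = y10 at *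
  generalize n - 1 - 4 * a = w0 at *
  field_simp
  ring

/-- The unit is 2a - (2a-1) with 2a-1 distinguished; x = 1-a-n/2. -/
theorem reg3F2_two_mul_sub_one_half_nat {a : ℂ} (ha : a.im ≠ 0) {n : ℕ} (hn : 0 < n) :
    Γ (3 * a / 2 + n / 4) * Γ (2 * a) * Γ (-a / 2 + n / 4 + 1 / 2)
        * reg3F2 (2 * a - 1) (a + 1 / 2) a (3 * a / 2 + n / 4) (2 * a) =
      (-(1 / 2) * Γ (a - n / 2) * altGammaSum 1 (n - 1) (-a - n / 2 + 1) (a - n / 2)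
        * Γ (3 * a / 2 + n / 4) * Γ (-a / 2 + n / 4 + 1 / 2) * Γ (1 + a + n / 2)
        / (Γ (-a - n / 2 + 1) * Γ (1 + a / 2 + n / 4) * Γ (1 / 2 + a / 2 + n / 4) * Γ (a + n / 2))
        + (2 : ℂ) ^ (n / 2 + 3 * a - 3) * Γ (3 * a / 2 + n / 4) * Γ (a - n / 2)
        * Γ (-a / 2 + n / 4 + 1 / 2) / (sqrtPi * Γ (2 * a - 1))) := by
  have hx : (-a - n / 2 + 1).im ≠ 0 := affine_im_ne_zero ha (-1) (-n / 2 + 1)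
  have h : reg3F2 (2 * a - 1) (a + 1 / 2) a (3 * a / 2 + n / 4) (2 * a) = 2 ^ (a + n / 2 - 1)
      / (sqrtPi * Γ (2 * a)) * Γ (a - n / 2) * (2 ^ (2 * a - 2) / Γ (2 * a - 1)
      - altGammaSum 1 (n - 1) (-a - n / 2 + 1) (a - n / 2) / (Γ (-a - n / 2 + 1) * Γ (a + n / 2)))
      := by
    rw [reg3F2_thomae, reg3F2_swap_right, reg3F2_swap_left, reg3F2_swap_lower]
    exact reg3F2_eq_altGammaSum_one hx hn
  have e0 : Γ (1 + a + n / 2) = Γ (1 / 2 + a / 2 + n / 4) * Γ (1 + a / 2 + n / 4)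
      / (2 ^ (-a - n / 2) * sqrtPi) := Gamma_eq_of_duplication
  have p0 := two_cpow_affine (a / 2) (n / 2) (z := (-a - n / 2)) (-2) (-1) 0
  have p1 := two_cpow_affine (a / 2) (n / 2) (z := (a + n / 2 - 1)) 2 1 (-1)
  have p2 := two_cpow_affine (a / 2) (n / 2) (z := (2 * a - 2)) 4 0 (-2)
  have p3 := two_cpow_affine (a / 2) (n / 2) (z := (n / 2 + 3 * a - 3)) 6 1 (-3)
  have g0 : Γ (-a - n / 2 + 1) ≠ 0 := Gamma_affine_ne_zero ha (-1) (-n / 2 + 1)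
  have g1 : Γ (-a / 2 + n / 4 + 1 / 2) ≠ 0 := Gamma_affine_ne_zero ha (-1 / 2) (n / 4 + 1 / 2)
  have g2 : Γ (1 / 2 + a / 2 + n / 4) ≠ 0 := Gamma_affine_ne_zero ha (1 / 2) (n / 4 + 1 / 2)
  have g3 : Γ (1 + a / 2 + n / 4) ≠ 0 := Gamma_affine_ne_zero ha (1 / 2) (n / 4 + 1)
  have g4 : Γ (a - n / 2) ≠ 0 := Gamma_affine_ne_zero ha 1 (-n / 2)
  have g5 : Γ (a + n / 2) ≠ 0 := Gamma_affine_ne_zero ha 1 (n / 2)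
  have g6 : Γ (3 * a / 2 + n / 4) ≠ 0 := Gamma_affine_ne_zero ha (3 / 2) (n / 4)
  have g7 : Γ (2 * a - 1) ≠ 0 := Gamma_affine_ne_zero ha 2 (-1)
  have g8 : Γ (2 * a) ≠ 0 := Gamma_affine_ne_zero ha 2 0
  have hu : (2 : ℂ) ^ (a / 2) ≠ 0 := two_cpow_ne_zero _
  have hv : (2 : ℂ) ^ ((n : ℂ) / 2) ≠ 0 := two_cpow_ne_zero _
  have hpi := sqrtPi_ne_zero
  rw [h, e0, p0, p1, p2, p3]
  clear h hx e0 p0 p1 p2 p3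
  generalize Γ (-a - n / 2 + 1) = y0, Γ (-a / 2 + n / 4 + 1 / 2) = y1, Γ (1 / 2 + a / 2 + n / 4) =
      y2, Γ (1 + a / 2 + n / 4) = y3, Γ (a - n / 2) = y4, Γ (a + n / 2) = y5, Γ (3 * a / 2 + n / 4)
      = y6, Γ (2 * a - 1) = y7, Γ (2 * a) = y8, altGammaSum 1 (n - 1) (-a - n / 2 + 1) (a - n / 2) =
      y9, (2 : ℂ) ^ (a / 2) = y10, (2 : ℂ) ^ ((n : ℂ) / 2) = y11 at *
  field_simp
  ring

/-- Companion of `reg3F2_sub_half_nat_lower`, with n/2+1-a kept instead. -/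
theorem reg3F2_sub_half_nat_one {a : ℂ} (ha : a.im ≠ 0) {n : ℕ} (hn : 0 < n) :
    Γ (-n / 2 + 3 * a) * Γ (1 + a) * Γ (-1 / 2 - n / 2 + 2 * a)
        * reg3F2 a (-n / 2 + 1 / 2 + 2 * a) (n / 2 + 1 - a) (-n / 2 + 3 * a) (1 + a) =
      (-(1 / 2) * (Γ (2 * a + 1) * Γ (-n + 2 * a) * altGammaSum 1 (n - 1) (1 - 2 * a) (2 * a - n)
        * Γ (-1 / 2 - n / 2 + 2 * a) * Γ (-n / 2 + 3 * a) / (Γ (1 - 2 * a) * Γ (4 * a - n)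
        * Γ (2 * a) * Γ (a + 1 / 2))) + (2 : ℂ) ^ (-2 - n + 6 * a) * Γ (-n / 2 + 1 / 2 + 2 * a)
        * Γ (1 + a) * Γ (-n + 2 * a) * Γ (-n / 2 + 3 * a) / (sqrtPi * Γ (4 * a - n) ^ 2)) := by
  have hx : (1 - 2 * a).im ≠ 0 := affine_im_ne_zero ha (-2) 1
  have h : reg3F2 a (-n / 2 + 1 / 2 + 2 * a) (n / 2 + 1 - a) (-n / 2 + 3 * a) (1 + a) =
      2 ^ (2 * a - 1) / (sqrtPi * Γ (4 * a - n)) * Γ (-n + 2 * a)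
      * (2 ^ (4 * a - n - 2) / Γ (4 * a - n - 1) - altGammaSum 1 (n - 1) (1 - 2 * a) (2 * a - n)
      / (Γ (1 - 2 * a) * Γ (2 * a))) := by
    rw [reg3F2_swap_right, reg3F2_swap_left, reg3F2_swap_lower, reg3F2_thomae', reg3F2_swap_right,
        reg3F2_swap_left, reg3F2_swap_lower]
    exact reg3F2_eq_altGammaSum_one hx hn
  have e0 : Γ (-n / 2 + 1 / 2 + 2 * a) = (-1 / 2 - n / 2 + 2 * a) * Γ (-1 / 2 - n / 2 + 2 * a) :=
      Gamma_eq_mul_of_eq_add_one (affine_ne_zero ha 2 (-n / 2 - 1 / 2))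
  have e1 : Γ (4 * a - n) = (2 * (-1 / 2 - n / 2 + 2 * a)) * Γ (4 * a - n - 1) :=
      Gamma_eq_mul_of_eq_add_one (affine_ne_zero ha 4 (-n - 1))
  have e2 : Γ (2 * a + 1) = Γ (a + 1 / 2) * Γ (1 + a) / (2 ^ (-2 * a) * sqrtPi) :=
      Gamma_eq_of_duplication
  have p0 := two_cpow_affine (a / 2) (n / 2) (z := (-2 * a)) (-4) 0 0
  have p1 := two_cpow_affine (a / 2) (n / 2) (z := (2 * a - 1)) 4 0 (-1)
  have p2 := two_cpow_affine (a / 2) (n / 2) (z := (4 * a - n - 2)) 8 (-2) (-2)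
  have p3 := two_cpow_affine (a / 2) (n / 2) (z := (-2 - n + 6 * a)) 12 (-2) (-2)
  have g0 : Γ (1 - 2 * a) ≠ 0 := Gamma_affine_ne_zero ha (-2) 1
  have g1 : Γ (a + 1 / 2) ≠ 0 := Gamma_affine_ne_zero ha 1 (1 / 2)
  have g2 : Γ (1 + a) ≠ 0 := Gamma_affine_ne_zero ha 1 1
  have g3 : Γ (-n + 2 * a) ≠ 0 := Gamma_affine_ne_zero ha 2 (-n)
  have g4 : Γ (-1 / 2 - n / 2 + 2 * a) ≠ 0 := Gamma_affine_ne_zero ha 2 (-n / 2 - 1 / 2)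
  have g5 : Γ (2 * a) ≠ 0 := Gamma_affine_ne_zero ha 2 0
  have g6 : Γ (-n / 2 + 3 * a) ≠ 0 := Gamma_affine_ne_zero ha 3 (-n / 2)
  have g7 : Γ (4 * a - n - 1) ≠ 0 := Gamma_affine_ne_zero ha 4 (-n - 1)
  have l0 : -1 / 2 - n / 2 + 2 * a ≠ 0 := affine_ne_zero ha 2 (-n / 2 - 1 / 2)
  have hu : (2 : ℂ) ^ (a / 2) ≠ 0 := two_cpow_ne_zero _
  have hv : (2 : ℂ) ^ ((n : ℂ) / 2) ≠ 0 := two_cpow_ne_zero _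
  have hpi := sqrtPi_ne_zero
  rw [h, e0, e1, e2, p0, p1, p2, p3]
  clear h hx e0 e1 e2 p0 p1 p2 p3
  generalize Γ (1 - 2 * a) = y0, Γ (a + 1 / 2) = y1, Γ (1 + a) = y2, Γ (-n + 2 * a) = y3,
      Γ (-1 / 2 - n / 2 + 2 * a) = y4, Γ (2 * a) = y5, Γ (-n / 2 + 3 * a) = y6, Γ (4 * a - n - 1) =
      y7, altGammaSum 1 (n - 1) (1 - 2 * a) (2 * a - n) = y8, (2 : ℂ) ^ (a / 2) = y9,
      (2 : ℂ) ^ ((n : ℂ) / 2) = y10 at *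
  generalize -1 / 2 - n / 2 + 2 * a = w0 at *
  field_simp
  ring

/-- Companion of `reg3F2_sub_half_nat_nonneg`, with 1/2+n/2-a kept instead. -/
theorem reg3F2_sub_half_nat_add_one {a : ℂ} (ha : a.im ≠ 0) {n : ℕ} (hn : 0 < n) :
    Γ (-n / 2 + 3 * a + 3 / 2) * Γ (1 + a) * Γ (-n / 2 + 2 * a + 1)
        * reg3F2 a (-n / 2 + 2 * a + 1) (1 / 2 + n / 2 - a) (-n / 2 + 3 * a + 3 / 2) (1 + a) =
      (-(1 / 2) * (Γ (2 * a + 2) * Γ (1 + 2 * a - n) * altGammaSum 1 (n - 1) (-2 * a)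
        (1 - n + 2 * a) * Γ (-n / 2 + 2 * a + 1) * Γ (-n / 2 + 3 * a + 3 / 2)
        / (Γ (2 * a + 1) * Γ (a + 3 / 2) * Γ (-2 * a) * Γ (2 - n + 4 * a))) - (2 : ℂ) ^ (-n + 6 * a)
        * (n - 1 - 4 * a) * Γ (1 + a) * Γ (1 + 2 * a - n) * Γ (-n / 2 + 2 * a + 1)
        * Γ (-n / 2 + 3 * a + 3 / 2) / (sqrtPi * Γ (2 - n + 4 * a) ^ 2)) := by
  have hx : (-2 * a).im ≠ 0 := affine_im_ne_zero ha (-2) 0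
  have h : reg3F2 a (-n / 2 + 2 * a + 1) (1 / 2 + n / 2 - a) (-n / 2 + 3 * a + 3 / 2) (1 + a) =
      2 ^ (2 * a) / (sqrtPi * Γ (2 - n + 4 * a)) * Γ (1 + 2 * a - n)
      * (2 ^ (4 * a - n) / Γ (4 * a - n + 1) - altGammaSum 1 (n - 1) (-2 * a) (1 - n + 2 * a)
      / (Γ (-2 * a) * Γ (2 * a + 1))) := by
    rw [reg3F2_swap_right, reg3F2_swap_left, reg3F2_swap_lower, reg3F2_thomae', reg3F2_swap_right,
        reg3F2_swap_left]
    exact reg3F2_eq_altGammaSum_one hx hn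
  have e0 : Γ (2 - n + 4 * a) = (-(n - 1 - 4 * a)) * Γ (4 * a - n + 1) :=
      Gamma_eq_mul_of_eq_add_one (affine_ne_zero ha 4 (-n + 1))
  have e1 : Γ (2 * a + 2) = Γ (1 + a) * Γ (a + 3 / 2) / (2 ^ (-2 * a - 1) * sqrtPi) :=
      Gamma_eq_of_duplication
  have p0 := two_cpow_affine (a / 2) (n / 2) (z := (-2 * a - 1)) (-4) 0 (-1)
  have p1 := two_cpow_affine (a / 2) (n / 2) (z := (2 * a)) 4 0 0
  have p2 := two_cpow_affine (a / 2) (n / 2) (z := (4 * a - n)) 8 (-2) 0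
  have p3 := two_cpow_affine (a / 2) (n / 2) (z := (-n + 6 * a)) 12 (-2) 0
  have g0 : Γ (-2 * a) ≠ 0 := Gamma_affine_ne_zero ha (-2) 0
  have g1 : Γ (1 + a) ≠ 0 := Gamma_affine_ne_zero ha 1 1
  have g2 : Γ (a + 3 / 2) ≠ 0 := Gamma_affine_ne_zero ha 1 (3 / 2)
  have g3 : Γ (1 + 2 * a - n) ≠ 0 := Gamma_affine_ne_zero ha 2 (-n + 1)
  have g4 : Γ (-n / 2 + 2 * a + 1) ≠ 0 := Gamma_affine_ne_zero ha 2 (-n / 2 + 1)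
  have g5 : Γ (2 * a + 1) ≠ 0 := Gamma_affine_ne_zero ha 2 1
  have g6 : Γ (-n / 2 + 3 * a + 3 / 2) ≠ 0 := Gamma_affine_ne_zero ha 3 (-n / 2 + 3 / 2)
  have g7 : Γ (4 * a - n + 1) ≠ 0 := Gamma_affine_ne_zero ha 4 (-n + 1)
  have l0 : n - 1 - 4 * a ≠ 0 := affine_ne_zero ha (-4) (n - 1)
  have hu : (2 : ℂ) ^ (a / 2) ≠ 0 := two_cpow_ne_zero _
  have hv : (2 : ℂ) ^ ((n : ℂ) / 2) ≠ 0 := two_cpow_ne_zero _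
  have hpi := sqrtPi_ne_zero
  rw [h, e0, e1, p0, p1, p2, p3]
  clear h hx e0 e1 p0 p1 p2 p3
  generalize Γ (-2 * a) = y0, Γ (1 + a) = y1, Γ (a + 3 / 2) = y2, Γ (1 + 2 * a - n) = y3,
      Γ (-n / 2 + 2 * a + 1) = y4, Γ (2 * a + 1) = y5, Γ (-n / 2 + 3 * a + 3 / 2) = y6,
      Γ (4 * a - n + 1) = y7, altGammaSum 1 (n - 1) (-2 * a) (1 - n + 2 * a) = y8, (2 : ℂ) ^ (a / 2)
      = y9, (2 : ℂ) ^ ((n : ℂ) / 2) = y10 at *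
  generalize n - 1 - 4 * a = w0 at *
  field_simp
  ring

/-- The given unit is kept; the `quadOne` value is that of `reg3F2_two_mul_sub_one_half_nat`. -/
theorem reg3F2_unit_two_mul {a : ℂ} (ha : a.im ≠ 0) {n : ℕ} (hn : 0 < n) :
    Γ (2 * a) * Γ (1 + a / 2 + n / 4) * Γ (a / 2 + n / 4 - 1 / 2)
        * reg3F2 a (a + 1 / 2) 1 (2 * a) (1 + a / 2 + n / 4) =
      ((-(1 / 2) * (altGammaSum 1 (n - 1) (-a - n / 2 + 1) (a - n / 2) * Γ (a / 2 + n / 4 - 1 / 2)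
        / (Γ (-a - n / 2 + 1) * Γ (a + n / 2) * Γ (1 / 2 + a / 2 + n / 4))) + (4 : ℂ) ^ (a - 1)
        / ((-1 + n / 2 + a) * Γ (2 * a - 1))) * Γ (1 + a + n / 2) * Γ (a - n / 2)) := by
  have hx : (-a - n / 2 + 1).im ≠ 0 := affine_im_ne_zero ha (-1) (-n / 2 + 1)
  have h : reg3F2 a (a + 1 / 2) 1 (2 * a) (1 + a / 2 + n / 4) = 2 ^ (a + n / 2 - 1)
      / (sqrtPi * Γ (2 * a)) * Γ (a - n / 2) * (2 ^ (2 * a - 2) / Γ (2 * a - 1)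
      - altGammaSum 1 (n - 1) (-a - n / 2 + 1) (a - n / 2) / (Γ (-a - n / 2 + 1) * Γ (a + n / 2)))
      := by
    rw [reg3F2_swap_right, reg3F2_swap_left, reg3F2_swap_lower, reg3F2_thomae', reg3F2_swap_left,
        reg3F2_swap_right, reg3F2_swap_left, reg3F2_swap_lower]
    exact reg3F2_eq_altGammaSum_one hx hn
  have e0 : Γ (1 + a + n / 2) = Γ (1 / 2 + a / 2 + n / 4) * Γ (1 + a / 2 + n / 4)
      / (2 ^ (-a - n / 2) * sqrtPi) := Gamma_eq_of_duplication
  have e1 : Γ (1 / 2 + a / 2 + n / 4) = (1 / 2 * (-1 + n / 2 + a)) * Γ (a / 2 + n / 4 - 1 / 2) :=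
      Gamma_eq_mul_of_eq_add_one (affine_ne_zero ha (1 / 2) (n / 4 - 1 / 2))
  have f : (4 : ℂ) ^ (a - 1) = 2 ^ (2 * a - 2) := four_cpow
  have p0 := two_cpow_affine (a / 2) (n / 2) (z := (-a - n / 2)) (-2) (-1) 0
  have p1 := two_cpow_affine (a / 2) (n / 2) (z := (a + n / 2 - 1)) 2 1 (-1)
  have p2 := two_cpow_affine (a / 2) (n / 2) (z := (2 * a - 2)) 4 0 (-2)
  have g0 : Γ (-a - n / 2 + 1) ≠ 0 := Gamma_affine_ne_zero ha (-1) (-n / 2 + 1)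
  have g1 : Γ (a / 2 + n / 4 - 1 / 2) ≠ 0 := Gamma_affine_ne_zero ha (1 / 2) (n / 4 - 1 / 2)
  have g2 : Γ (1 + a / 2 + n / 4) ≠ 0 := Gamma_affine_ne_zero ha (1 / 2) (n / 4 + 1)
  have g3 : Γ (a - n / 2) ≠ 0 := Gamma_affine_ne_zero ha 1 (-n / 2)
  have g4 : Γ (a + n / 2) ≠ 0 := Gamma_affine_ne_zero ha 1 (n / 2)
  have g5 : Γ (2 * a - 1) ≠ 0 := Gamma_affine_ne_zero ha 2 (-1)
  have g6 : Γ (2 * a) ≠ 0 := Gamma_affine_ne_zero ha 2 0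
  have l0 : -1 + n / 2 + a ≠ 0 := affine_ne_zero ha 1 (n / 2 - 1)
  have hu : (2 : ℂ) ^ (a / 2) ≠ 0 := two_cpow_ne_zero _
  have hv : (2 : ℂ) ^ ((n : ℂ) / 2) ≠ 0 := two_cpow_ne_zero _
  have hpi := sqrtPi_ne_zero
  rw [h, f, e0, e1, p0, p1, p2]
  clear h hx e0 e1 p0 p1 p2 f
  generalize Γ (-a - n / 2 + 1) = y0, Γ (a / 2 + n / 4 - 1 / 2) = y1, Γ (1 + a / 2 + n / 4) = y2,
      Γ (a - n / 2) = y3, Γ (a + n / 2) = y4, Γ (2 * a - 1) = y5, Γ (2 * a) = y6,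
      altGammaSum 1 (n - 1) (-a - n / 2 + 1) (a - n / 2) = y7, (2 : ℂ) ^ (a / 2) = y8,
      (2 : ℂ) ^ ((n : ℂ) / 2) = y9 at *
  generalize -1 + n / 2 + a = w0 at *
  field_simp
  ring

/-- Same `quadOne` value once more; reflection turns 1/(Γ(a+n/2)Γ(1-a-n/2)) into the sine. -/
theorem reg3F2_unit_two_mul_shifted {a : ℂ} (ha : a.im ≠ 0) {n : ℕ} (hn : 0 < n) :
    Γ (2 * a) * Γ (1 / 2 + a / 2 + n / 4) * Γ (a / 2 + n / 4)
        * reg3F2 (a - 1 / 2) a 1 (2 * a) (1 / 2 + a / 2 + n / 4) =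
      ((-(altGammaSum 1 (n - 1) (-a - n / 2 + 1) (a - n / 2) * Complex.sin (Real.pi * (a + n / 2))
        / Real.pi) + (4 : ℂ) ^ (a - 1) / Γ (2 * a - 1)) * Γ (a + n / 2) * Γ (a - n / 2)) := by
  have hx : (-a - n / 2 + 1).im ≠ 0 := affine_im_ne_zero ha (-1) (-n / 2 + 1)
  have h : reg3F2 (a - 1 / 2) a 1 (2 * a) (1 / 2 + a / 2 + n / 4) = 2 ^ (a + n / 2 - 1)
      / (sqrtPi * Γ (2 * a)) * Γ (a - n / 2) * (2 ^ (2 * a - 2) / Γ (2 * a - 1)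
      - altGammaSum 1 (n - 1) (-a - n / 2 + 1) (a - n / 2) / (Γ (-a - n / 2 + 1) * Γ (a + n / 2)))
      := by
    rw [reg3F2_swap_right, reg3F2_swap_left, reg3F2_swap_lower, reg3F2_thomae', reg3F2_swap_left,
        reg3F2_swap_right, reg3F2_swap_left]
    exact reg3F2_eq_altGammaSum_one hx hn
  have es := sin_pi_mul_eq_div (z := a + n / 2) (w := -a - n / 2 + 1)
  have e0 : Γ (a + n / 2) = Γ (a / 2 + n / 4) * Γ (1 / 2 + a / 2 + n / 4)
      / (2 ^ (-a - n / 2 + 1) * sqrtPi) := Gamma_eq_of_duplication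
  have f : (4 : ℂ) ^ (a - 1) = 2 ^ (2 * a - 2) := four_cpow
  have p0 := two_cpow_affine (a / 2) (n / 2) (z := (-a - n / 2 + 1)) (-2) (-1) 1
  have p1 := two_cpow_affine (a / 2) (n / 2) (z := (a + n / 2 - 1)) 2 1 (-1)
  have p2 := two_cpow_affine (a / 2) (n / 2) (z := (2 * a - 2)) 4 0 (-2)
  have g0 : Γ (-a - n / 2 + 1) ≠ 0 := Gamma_affine_ne_zero ha (-1) (-n / 2 + 1)
  have g1 : Γ (a / 2 + n / 4) ≠ 0 := Gamma_affine_ne_zero ha (1 / 2) (n / 4)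
  have g2 : Γ (1 / 2 + a / 2 + n / 4) ≠ 0 := Gamma_affine_ne_zero ha (1 / 2) (n / 4 + 1 / 2)
  have g3 : Γ (a - n / 2) ≠ 0 := Gamma_affine_ne_zero ha 1 (-n / 2)
  have g4 : Γ (2 * a - 1) ≠ 0 := Gamma_affine_ne_zero ha 2 (-1)
  have g5 : Γ (2 * a) ≠ 0 := Gamma_affine_ne_zero ha 2 0
  have hu : (2 : ℂ) ^ (a / 2) ≠ 0 := two_cpow_ne_zero _
  have hv : (2 : ℂ) ^ ((n : ℂ) / 2) ≠ 0 := two_cpow_ne_zero _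
  have hpi := sqrtPi_ne_zero
  have hp : (Real.pi : ℂ) ≠ 0 := by exact_mod_cast Real.pi_ne_zero
  rw [h, es, f, e0, p0, p1, p2]
  clear h hx es e0 p0 p1 p2 f
  generalize Γ (-a - n / 2 + 1) = y0, Γ (a / 2 + n / 4) = y1, Γ (1 / 2 + a / 2 + n / 4) = y2,
      Γ (a - n / 2) = y3, Γ (2 * a - 1) = y4, Γ (2 * a) = y5,
      altGammaSum 1 (n - 1) (-a - n / 2 + 1) (a - n / 2) = y6, (2 : ℂ) ^ (a / 2) = y7,
      (2 : ℂ) ^ ((n : ℂ) / 2) = y8 at *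
  field_simp
  ring

end RegularizedHypergeometric

/-! ### Assembly: admissibility conditions and passage to arbitrary a. -/

theorem mainTheorem8 (a b : ℂ) (n : ℕ) (hn : 0 < n) :
    -- excess 2 + b - 4 a
    (Reg (b + 3 / 2 - a) → Reg (b - a + 1) → Reg (2 + b - 4 * a) → 2 * a - 1 ≠ 0 →
      HasHyp3F2One a (a + 1 / 2) b (b + 3 / 2 - a) (b - a + 1)
        ((2 : ℂ) ^ (-b) * sqrtPi * Γ (2 + 2 * b - 2 * a) * Γ (2 + b - 4 * a)
            / (Γ (2 + 2 * b - 4 * a) * (2 * a - 1)) * (1 / (Γ (b / 2) * Γ (3 / 2 + b / 2 - 2 * a))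
            - 1 / (Γ (b / 2 + 1 / 2) * Γ (1 + b / 2 - 2 * a))))) ∧
    -- excess 2 - n - 4 a
    (Reg (3 / 2 - a - n / 2) → Reg (2 - a - n / 2) → Reg (2 - n - 4 * a) → Reg (1 - 2 * a) →
      Reg (2 * a) →
      HasHyp3F2One a (a + 1 / 2) 1 (3 / 2 - a - n / 2) (2 - a - n / 2)
        (Γ (3 - n - 2 * a) * Γ (2 - n - 4 * a) / Γ (3 - n - 4 * a) * ((2 : ℂ) ^ (-4 * a - n)
            * Γ (1 - 2 * a) / Γ (2 - n - 4 * a) + 1 / (2 * Γ (2 * a))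
            * altGammaSum 0 (n - 1) (2 * a) (2 - n - 2 * a)))) ∧
    -- excess 1 + n - 4 a
    (Reg (3 / 2 - a + n / 2) → Reg (1 - a + n / 2) → Reg (1 + n - 4 * a) → Reg (1 - 2 * a) →
      (∀ k ∈ Finset.Icc 1 (n - 1), Reg (2 * a - n + k)) →
      HasHyp3F2One a (a + 1 / 2) 1 (3 / 2 - a + n / 2) (1 - a + n / 2)
        (Γ (1 - 2 * a) * ((1 + n - 2 * a) / (1 + n - 4 * a)) * ((2 : ℂ) ^ (n - 1 - 4 * a)
            * Γ (1 + n - 2 * a) / Γ (1 + n - 4 * a) - 1 / (2 * Γ (2 * a - n))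
            * altGammaSum 1 (n - 1) (2 * a - n) (1 - 2 * a)))) ∧
    -- excess 1
    (Reg (1 / 2 + 3 * a + n / 2) → Reg (1 + 3 * a + n / 2) → Reg (2 * a + n) →
      Reg (1 - 2 * a - n) →
      HasHyp3F2One (4 * a + n) a (a + 1 / 2) (1 / 2 + 3 * a + n / 2) (1 + 3 * a + n / 2)
        ((2 : ℂ) ^ (2 * a) * Γ (1 + 3 * a + n / 2) * Γ (1 / 2 + 3 * a + n / 2)
            * altGammaSum 0 (n - 1) (1 - 2 * a - n) (1 + 2 * a) / (Γ (1 - 2 * a - n) * sqrtPi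
            * Γ (1 + 4 * a + n))
          + (2 : ℂ) ^ (-1 + 6 * a + n) * Γ (2 * a + n) * Γ (1 + 3 * a + n / 2)
            * Γ (1 / 2 + 3 * a + n / 2) / (Γ (4 * a + n) * sqrtPi * Γ (1 + 4 * a + n)))) ∧
    -- excess 1
    (Reg (1 - n / 2 + 3 * a) → Reg (-n / 2 + 3 * a + 3 / 2) → Reg (1 + 2 * a - n) →
      (∀ k ∈ Finset.Icc 1 (n - 1), Reg (-2 * a + k)) →
      HasHyp3F2One (1 - n + 4 * a) (a + 1 / 2) a (1 - n / 2 + 3 * a) (-n / 2 + 3 * a + 3 / 2)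
        ((-n / 2 + 1 / 2 + 2 * a) * Γ (1 + 2 * a - n) * Γ (2 - n + 6 * a) / Γ (2 - n + 4 * a) ^ 2
          - Γ (1 + 2 * a - n) * altGammaSum 1 (n - 1) (-2 * a) (1 - n + 2 * a)
            * Γ (1 - n / 2 + 3 * a) * Γ (-n / 2 + 3 * a + 3 / 2) / (Γ (-2 * a) * Γ (2 - n + 4 * a)
            * Γ (a + 1 / 2) * Γ (1 + a)))) ∧
    -- excess 1 - n/4 - a/2
    (Reg (1 / 2 + 3 * a / 2 - n / 4) → Reg (2 * a + 1) → Reg (1 - n / 4 - a / 2) →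
      Reg (a + n / 2) → Reg (-a - n / 2 + 1) →
      HasHyp3F2One (2 * a) a (a + 1 / 2) (1 / 2 + 3 * a / 2 - n / 4) (2 * a + 1)
        (altGammaSum 0 (n - 1) (-a - n / 2 + 1) (a - n / 2 + 1) * Γ (1 / 2 + 3 * a / 2 - n / 4)
            * (2 : ℂ) ^ (2 * a) / Γ (-a / 2 - n / 4 + 1 / 2)
          + (2 : ℂ) ^ (3 * a - n / 2 - 1) * Γ (a + n / 2) * Γ (1 / 2 + 3 * a / 2 - n / 4)
            * Γ (1 - n / 4 - a / 2) / (Γ (2 * a) * sqrtPi))) ∧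
    -- excess 1 + n/2 + 2 a
    (Reg (1 / 2 + 3 * a + n / 2) → Reg (1 + a) → Reg (1 + n / 2 + 2 * a) → Reg (2 * a + 2) →
      Reg (2 * a + n) → 2 * a + n / 2 ≠ 0 → Reg (1 - 2 * a - n) →
      HasHyp3F2One a (2 * a + n / 2) (1 / 2 - a - n / 2) (1 / 2 + 3 * a + n / 2) (1 + a)
        (1 / 2 * (altGammaSum 0 (n - 1) (1 - 2 * a - n) (1 + 2 * a) * Γ (1 / 2 + 3 * a + n / 2)
            * Γ (2 * a + 2) * Γ (1 + n / 2 + 2 * a) / (Γ (1 - 2 * a - n) * Γ (1 + 4 * a + n)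
            * Γ (a + 3 / 2)))
          + (4 : ℂ) ^ (n / 2 - 1 + 3 * a) * Γ (2 * a + n) * Γ (1 / 2 + 3 * a + n / 2)
            * Γ (1 + n / 2 + 2 * a) * Γ (1 + a) / (sqrtPi * (2 * a + n / 2)
            * Γ (4 * a + n) ^ 2))) ∧
    -- excess -1/2 + 2 a + n/2
    (Reg (n / 2 - 1 + 3 * a) → Reg (1 + a) → Reg (-1 / 2 + 2 * a + n / 2) → Reg (-1 + 2 * a + n) →
      -1 + 2 * a + n / 2 ≠ 0 → Reg (-2 * a - n + 2) →
      HasHyp3F2One a (-1 / 2 + 2 * a + n / 2) (-a - n / 2 + 1) (n / 2 - 1 + 3 * a) (1 + a)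
        ((altGammaSum 0 (n - 1) (-2 * a - n + 2) (2 * a) * (2 : ℂ) ^ (2 * a - 2)
            / (Γ (-2 * a - n + 2) * Γ (-1 + 4 * a + n)) + (4 : ℂ) ^ (n / 2 + 3 * a - 3)
            * Γ (-1 + 2 * a + n) / ((-1 + 2 * a + n / 2) * Γ (-2 + 4 * a + n) ^ 2)) * (2 / sqrtPi)
            * Γ (-1 / 2 + 2 * a + n / 2) * Γ (n / 2 - 1 + 3 * a) * Γ (1 + a))) ∧
    -- excess 1/2 - n/4 - a/4
    (Reg (1 - n / 4 + 3 * a / 4) → Reg (1 + a) → Reg (-n / 4 - a / 4 + 1 / 2) →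
      Reg (a / 2 - n / 2 + 2) → Reg (a / 2 + n / 2) → Reg (-n / 2 - a / 2 + 1) →
      HasHyp3F2One a (a / 2 + 1 / 2) (1 + a / 2) (1 - n / 4 + 3 * a / 4) (1 + a)
        (1 / 2 * altGammaSum 0 (n - 1) (-n / 2 - a / 2 + 1) (a / 2 - n / 2 + 1)
            * Γ (1 - n / 4 + 3 * a / 4) * Γ (a / 2 - n / 2 + 2) * Γ (-n / 4 - a / 4 + 1 / 2)
            / (Γ (-n / 2 - a / 2 + 1) * Γ (a / 4 - n / 4 + 1) * Γ (3 / 2 + a / 4 - n / 4))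
          + (2 : ℂ) ^ (3 * a / 2 - n / 2 - 1) * Γ (a / 2 + n / 2) * Γ (1 - n / 4 + 3 * a / 4)
            * Γ (-n / 4 - a / 4 + 1 / 2) / (Γ a * sqrtPi))) ∧
    -- excess 1/2 + 2 a + n/2
    (Reg (1 + 3 * a + n / 2) → Reg (1 + a) → Reg (1 / 2 + 2 * a + n / 2) → Reg (2 * a + 2) →
      Reg (2 * a + n) → 2 * a + n / 2 ≠ 0 → Reg (1 - 2 * a - n) →
      HasHyp3F2One a (1 / 2 + 2 * a + n / 2) (-a - n / 2 + 1) (1 + 3 * a + n / 2) (1 + a)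
        (1 / 2 * altGammaSum 0 (n - 1) (1 - 2 * a - n) (1 + 2 * a) * Γ (1 + 3 * a + n / 2)
            * Γ (1 / 2 + 2 * a + n / 2) * Γ (2 * a + 2) / (Γ (1 - 2 * a - n) * Γ (1 + 4 * a + n)
            * Γ (a + 3 / 2))
          + (2 : ℂ) ^ (-2 + n + 6 * a) * Γ (2 * a + n) * Γ (1 + 3 * a + n / 2)
            * Γ (1 / 2 + 2 * a + n / 2) * Γ (1 + a) / (sqrtPi * (2 * a + n / 2)
            * Γ (4 * a + n) ^ 2))) ∧
    -- excess -1 + 2 a + n/2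
    (Reg (-1 / 2 + 3 * a + n / 2) → Reg (1 + a) → Reg (-1 + 2 * a + n / 2) → Reg (2 * a + 1) →
      Reg (-1 + 2 * a + n) → Reg (-2 * a - n + 2) →
      HasHyp3F2One a (2 * a + n / 2) (-a + 3 / 2 - n / 2) (-1 / 2 + 3 * a + n / 2) (1 + a)
        (1 / 2 * altGammaSum 0 (n - 1) (-2 * a - n + 2) (2 * a) * Γ (-1 / 2 + 3 * a + n / 2)
            * Γ (-1 + 2 * a + n / 2) * Γ (2 * a + 1) / (Γ (-2 * a - n + 2) * Γ (-1 + 4 * a + n)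
            * Γ (a + 1 / 2))
          + (2 : ℂ) ^ (-5 + n + 6 * a) * Γ (1 + a) * Γ (-1 + 2 * a + n / 2) * Γ (-1 + 2 * a + n)
            * Γ (-1 / 2 + 3 * a + n / 2) / ((-1 + 2 * a + n / 2) * sqrtPi
            * Γ (-2 + 4 * a + n) ^ 2))) ∧
    -- excess 1/2 + a/2 - n/4
    (Reg (2 * a + 1) → Reg (a / 2 - n / 4 + 1) → Reg (1 / 2 + a / 2 - n / 4) →
      Reg (2 + a - n / 2) → Reg (a + n / 2) → Reg (-a - n / 2 + 1) →
      HasHyp3F2One a (a + 1 / 2) 1 (2 * a + 1) (a / 2 - n / 4 + 1)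
        ((2 : ℂ) ^ (2 * a - 2) * Γ (1 / 2 + a / 2 - n / 4) * Γ (2 + a - n / 2) * Γ (a + n / 2)
            / (Γ (2 * a) * Γ (a / 2 - n / 4 + 3 / 2))
          + 1 / 2 * altGammaSum 0 (n - 1) (-a - n / 2 + 1) (a - n / 2 + 1)
            * Γ (1 / 2 + a / 2 - n / 4) * Γ (2 + a - n / 2) / (Γ (-a - n / 2 + 1)
            * Γ (a / 2 - n / 4 + 3 / 2)))) ∧
    -- excess a/2 - n/4 - 1/2
    (Reg (2 * a - 1) → Reg (a / 2 - n / 4 + 1) → Reg (a / 2 - n / 4 - 1 / 2) →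
      Reg (-1 + n / 2 + a) → Reg (-n / 2 - a + 2) →
      HasHyp3F2One (a - 1 / 2) a 1 (2 * a - 1) (a / 2 - n / 4 + 1)
        (((2 : ℂ) ^ (-1 + a - n / 2) * altGammaSum 0 (n - 1) (-n / 2 - a + 2) (a - n / 2)
            * Γ (a / 2 - n / 4 + 1) / (Γ (-a - n / 2 + 2) * sqrtPi)
            + (2 : ℂ) ^ (3 * a - 4 - n / 2) * Γ (-1 + n / 2 + a) * Γ (a / 2 - n / 4 + 1) / (sqrtPi
            * Γ (2 * a - 2))) * Γ (a / 2 - n / 4 - 1 / 2))) ∧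
    -- excess 1 - a/2 + n/2
    (Reg (-1 / 2 + 3 * a / 2 + n / 2) → Reg (2 * a) → Reg (1 - a / 2 + n / 2) → Reg (1 + a + n) →
      Reg (a - n) → (∀ k ∈ Finset.Icc 1 (2 * n - 1), Reg (-a - n + 1 + k)) →
      HasHyp3F2One (2 * a - 1) a (a - 1 / 2) (-1 / 2 + 3 * a / 2 + n / 2) (2 * a)
        (-(1 / 2) * (Γ (1 + a + n) * Γ (a - n) * altGammaSum 1 (2 * n - 1) (-a - n + 1) (a - n)
            * Γ (-1 / 2 + 3 * a / 2 + n / 2) * Γ (1 - a / 2 + n / 2) / (Γ (-a - n + 1) * Γ (a + n)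
            * Γ (a / 2 + n / 2 + 1) * Γ (a / 2 + n / 2 + 1 / 2)))
          + (2 : ℂ) ^ (3 * a + n - 3) * Γ (-1 / 2 + 3 * a / 2 + n / 2) * Γ (a - n)
            * Γ (1 - a / 2 + n / 2) / (sqrtPi * Γ (2 * a - 1)))) ∧
    -- excess 2 a - n/2
    (Reg (-1 / 2 - n / 2 + 3 * a) → Reg (1 + a) → Reg (-n / 2 + 2 * a) → Reg (2 * a + 1) →
      Reg (-n + 2 * a) → (∀ k ∈ Finset.Icc 1 (n - 1), Reg (1 - 2 * a + k)) →
      HasHyp3F2One a (-n / 2 + 2 * a) (1 / 2 + n / 2 - a) (-1 / 2 - n / 2 + 3 * a) (1 + a)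
        (-(1 / 2) * (Γ (2 * a + 1) * Γ (-n + 2 * a)
            * altGammaSum 1 (n - 1) (1 - 2 * a) (2 * a - n) * Γ (-1 / 2 - n / 2 + 3 * a)
            * Γ (-n / 2 + 2 * a) / (Γ (2 * a) * Γ (a + 1 / 2) * Γ (1 - 2 * a) * Γ (4 * a - n)))
          - (2 : ℂ) ^ (6 * a - 3 - n) * (n - 4 * a + 1) * Γ (1 + a) * Γ (-n + 2 * a)
            * Γ (-1 / 2 - n / 2 + 3 * a) * Γ (-n / 2 + 2 * a) / (sqrtPi * Γ (4 * a - n) ^ 2))) ∧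
    -- excess 3/2 - n/2 + 2 a
    (Reg (1 - n / 2 + 3 * a) → Reg (1 + a) → Reg (3 / 2 - n / 2 + 2 * a) → Reg (2 * a + 2) →
      Reg (1 + 2 * a - n) → (∀ k ∈ Finset.Icc 1 (n - 1), Reg (-2 * a + k)) →
      HasHyp3F2One a (-n / 2 + 1 / 2 + 2 * a) (-a + n / 2) (1 - n / 2 + 3 * a) (1 + a)
        (-(1 / 2) * (Γ (2 * a + 2) * Γ (1 + 2 * a - n)
            * altGammaSum 1 (n - 1) (-2 * a) (1 - n + 2 * a) * Γ (1 - n / 2 + 3 * a)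
            * Γ (3 / 2 - n / 2 + 2 * a) / (Γ (-2 * a) * Γ (2 - n + 4 * a) * Γ (2 * a + 1)
            * Γ (a + 3 / 2)))
          - (2 : ℂ) ^ (-n + 6 * a) * (n - 1 - 4 * a) * Γ (1 + 2 * a - n) * Γ (1 - n / 2 + 3 * a)
            * Γ (1 + a) * Γ (3 / 2 - n / 2 + 2 * a) / (sqrtPi * Γ (2 - n + 4 * a) ^ 2))) ∧
    -- excess 1/2 + n/4 - a/2
    (Reg (3 * a / 2 + n / 4) → Reg (2 * a) → Reg (-a / 2 + n / 4 + 1 / 2) → Reg (a - n / 2) →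
      Reg (1 + a + n / 2) → (∀ k ∈ Finset.Icc 1 (n - 1), Reg (-a - n / 2 + 1 + k)) →
      HasHyp3F2One (2 * a - 1) (a + 1 / 2) a (3 * a / 2 + n / 4) (2 * a)
        (-(1 / 2) * Γ (a - n / 2) * altGammaSum 1 (n - 1) (-a - n / 2 + 1) (a - n / 2)
            * Γ (3 * a / 2 + n / 4) * Γ (-a / 2 + n / 4 + 1 / 2) * Γ (1 + a + n / 2)
            / (Γ (-a - n / 2 + 1) * Γ (1 + a / 2 + n / 4) * Γ (1 / 2 + a / 2 + n / 4)
            * Γ (a + n / 2))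
          + (2 : ℂ) ^ (n / 2 + 3 * a - 3) * Γ (3 * a / 2 + n / 4) * Γ (a - n / 2)
            * Γ (-a / 2 + n / 4 + 1 / 2) / (sqrtPi * Γ (2 * a - 1)))) ∧
    -- excess -1/2 - n/2 + 2 a
    (Reg (-n / 2 + 3 * a) → Reg (1 + a) → Reg (-1 / 2 - n / 2 + 2 * a) → Reg (2 * a + 1) →
      Reg (-n + 2 * a) → (∀ k ∈ Finset.Icc 1 (n - 1), Reg (1 - 2 * a + k)) →
      HasHyp3F2One a (-n / 2 + 1 / 2 + 2 * a) (n / 2 + 1 - a) (-n / 2 + 3 * a) (1 + a)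
        (-(1 / 2) * (Γ (2 * a + 1) * Γ (-n + 2 * a)
            * altGammaSum 1 (n - 1) (1 - 2 * a) (2 * a - n) * Γ (-1 / 2 - n / 2 + 2 * a)
            * Γ (-n / 2 + 3 * a) / (Γ (1 - 2 * a) * Γ (4 * a - n) * Γ (2 * a) * Γ (a + 1 / 2)))
          + (2 : ℂ) ^ (-2 - n + 6 * a) * Γ (-n / 2 + 1 / 2 + 2 * a) * Γ (1 + a) * Γ (-n + 2 * a)
            * Γ (-n / 2 + 3 * a) / (sqrtPi * Γ (4 * a - n) ^ 2))) ∧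
    -- excess 1 - n/2 + 2 a
    (Reg (-n / 2 + 3 * a + 3 / 2) → Reg (1 + a) → Reg (-n / 2 + 2 * a + 1) → Reg (2 * a + 2) →
      Reg (1 + 2 * a - n) → (∀ k ∈ Finset.Icc 1 (n - 1), Reg (-2 * a + k)) →
      HasHyp3F2One a (-n / 2 + 2 * a + 1) (1 / 2 + n / 2 - a) (-n / 2 + 3 * a + 3 / 2) (1 + a)
        (-(1 / 2) * (Γ (2 * a + 2) * Γ (1 + 2 * a - n)
            * altGammaSum 1 (n - 1) (-2 * a) (1 - n + 2 * a) * Γ (-n / 2 + 2 * a + 1)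
            * Γ (-n / 2 + 3 * a + 3 / 2) / (Γ (2 * a + 1) * Γ (a + 3 / 2) * Γ (-2 * a)
            * Γ (2 - n + 4 * a)))
          - (2 : ℂ) ^ (-n + 6 * a) * (n - 1 - 4 * a) * Γ (1 + a) * Γ (1 + 2 * a - n)
            * Γ (-n / 2 + 2 * a + 1) * Γ (-n / 2 + 3 * a + 3 / 2) / (sqrtPi
            * Γ (2 - n + 4 * a) ^ 2))) ∧
    -- excess a/2 + n/4 - 1/2
    (Reg (2 * a) → Reg (1 + a / 2 + n / 4) → Reg (a / 2 + n / 4 - 1 / 2) → Reg (1 + a + n / 2) →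
      Reg (a - n / 2) → (∀ k ∈ Finset.Icc 1 (n - 1), Reg (-a - n / 2 + 1 + k)) →
      HasHyp3F2One a (a + 1 / 2) 1 (2 * a) (1 + a / 2 + n / 4)
        ((-(1 / 2) * (altGammaSum 1 (n - 1) (-a - n / 2 + 1) (a - n / 2)
            * Γ (a / 2 + n / 4 - 1 / 2) / (Γ (-a - n / 2 + 1) * Γ (a + n / 2)
            * Γ (1 / 2 + a / 2 + n / 4))) + (4 : ℂ) ^ (a - 1) / ((-1 + n / 2 + a)
            * Γ (2 * a - 1))) * Γ (1 + a + n / 2) * Γ (a - n / 2))) ∧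
    -- excess a/2 + n/4
    (Reg (2 * a) → Reg (1 / 2 + a / 2 + n / 4) → Reg (a / 2 + n / 4) → Reg (a + n / 2) →
      Reg (a - n / 2) → (∀ k ∈ Finset.Icc 1 (n - 1), Reg (-a - n / 2 + 1 + k)) →
      HasHyp3F2One (a - 1 / 2) a 1 (2 * a) (1 / 2 + a / 2 + n / 4)
        ((-(altGammaSum 1 (n - 1) (-a - n / 2 + 1) (a - n / 2) * Complex.sin (Real.pi
            * (a + n / 2)) / Real.pi) + (4 : ℂ) ^ (a - 1) / Γ (2 * a - 1)) * Γ (a + n / 2)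
            * Γ (a - n / 2))) := by
  refine ⟨?_, ?_, ?_, ?_, ?_, ?_, ?_, ?_, ?_, ?_, ?_, ?_, ?_, ?_, ?_, ?_, ?_, ?_, ?_, ?_, ?_⟩
  · exact hasHyp3F2One_quadratic a b
  · intro h1 h2 h3 h4 h5
    -- Regularity of the first argument propagates to all numerators of the sum.
    have hk : ∀ k ∈ Finset.Icc 0 (n - 1), Reg (2 * a + k) := fun k _ => h5.add_nat k
    -- 3-n-2a is twice the lower parameter 3/2-a-n/2, and the other lower parameter exceeds that one
    -- by 1/2.
    have hr : Reg (3 - n - 2 * a) := h1.two_mul h2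
    exact hasHyp3F2One_of_im_ne_zero (a := a) (fun z hz => reg3F2_quadratic_unit_sub hz hn) h1 h2
        (h3.congr (by ring))
  · intro h1 h2 h3 h4 h5
    have hr : Reg (1 + n - 2 * a) := (h4.add_nat n).congr
    have h0 : 1 + n - 4 * a ≠ 0 := h3.ne_zero
    exact hasHyp3F2One_of_im_ne_zero (a := a) (fun z hz => reg3F2_quadratic_unit_add hz hn) h1 h2
        (h3.congr (by ring))
  · intro h1 h2 h3 h4
    have hk : ∀ k ∈ Finset.Icc 0 (n - 1), Reg (1 - 2 * a - n + k) := fun k _ => h4.add_nat k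
    exact hasHyp3F2One_of_im_ne_zero (a := a) (fun z hz => reg3F2_four_mul_add_nat hz hn) h1 h2
        (reg_of_re_pos (by simp))
  · intro h1 h2 h3 h4
    have hr : Reg (2 - n + 6 * a) := h1.two_mul h2
    exact hasHyp3F2One_of_im_ne_zero (a := a) (fun z hz => reg3F2_four_mul_sub_nat hz hn) h1 h2
        (reg_of_re_pos (by simp))
  · intro h1 h2 h3 h4 h5
    have hk : ∀ k ∈ Finset.Icc 0 (n - 1), Reg (-a - n / 2 + 1 + k) := fun k _ => h5.add_nat k
    exact hasHyp3F2One_of_im_ne_zero (a := a) (fun z hz => reg3F2_two_mul_same_half hz hn) h1 h2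
        (h3.congr (by ring))
  · intro h1 h2 h3 h4 h5 h6 h7
    have hk : ∀ k ∈ Finset.Icc 0 (n - 1), Reg (1 - 2 * a - n + k) := fun k _ => h7.add_nat k
    exact hasHyp3F2One_of_im_ne_zero (a := a) (fun z hz => reg3F2_add_half_nat_lower hz hn) h1 h2
        (h3.congr (by ring))
  · intro h1 h2 h3 h4 h5 h6
    have hk : ∀ k ∈ Finset.Icc 0 (n - 1), Reg (-2 * a - n + 2 + k) := fun k _ => h6.add_nat k
    exact hasHyp3F2One_of_im_ne_zero (a := a) (fun z hz => reg3F2_add_half_nat_sub_half hz hn) h1 h2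
        (h3.congr (by ring))
  · intro h1 h2 h3 h4 h5 h6
    have hk : ∀ k ∈ Finset.Icc 0 (n - 1), Reg (-n / 2 - a / 2 + 1 + k) := fun k _ => h6.add_nat k
    exact hasHyp3F2One_of_im_ne_zero (a := a) (fun z hz => reg3F2_half_arguments hz hn) h1 h2
        (h3.congr (by ring))
  · intro h1 h2 h3 h4 h5 h6 h7
    have hk : ∀ k ∈ Finset.Icc 0 (n - 1), Reg (1 - 2 * a - n + k) := fun k _ => h7.add_nat k
    exact hasHyp3F2One_of_im_ne_zero (a := a) (fun z hz => reg3F2_add_half_nat_add_half hz hn) h1 h2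
        (h3.congr (by ring))
  · intro h1 h2 h3 h4 h5 h6
    have hk : ∀ k ∈ Finset.Icc 0 (n - 1), Reg (-2 * a - n + 2 + k) := fun k _ => h6.add_nat k
    -- This denominator is the excess itself.
    have h0 : -1 + 2 * a + n / 2 ≠ 0 := h3.ne_zero
    exact hasHyp3F2One_of_im_ne_zero (a := a) (fun z hz => reg3F2_add_half_nat_three_halves hz hn)
        h1 h2 (h3.congr (by ring))
  · intro h1 h2 h3 h4 h5 h6
    have hk : ∀ k ∈ Finset.Icc 0 (n - 1), Reg (-a - n / 2 + 1 + k) := fun k _ => h6.add_nat k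
    exact hasHyp3F2One_of_im_ne_zero (a := a) (fun z hz => reg3F2_unit_two_mul_add_one hz hn) h1 h2
        (h3.congr (by ring))
  · intro h1 h2 h3 h4 h5
    have hk : ∀ k ∈ Finset.Icc 0 (n - 1), Reg (-n / 2 - a + 2 + k) := fun k _ => h5.add_nat k
    exact hasHyp3F2One_of_im_ne_zero (a := a) (fun z hz => reg3F2_unit_two_mul_sub_one hz hn) h1 h2
        (h3.congr (by ring))
  · intro h1 h2 h3 h4 h5 h6
    exact hasHyp3F2One_of_im_ne_zero (a := a) (fun z hz => reg3F2_two_mul_sub_one_nat hz hn) h1 h2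
        (h3.congr (by ring))
  · intro h1 h2 h3 h4 h5 h6
    exact hasHyp3F2One_of_im_ne_zero (a := a) (fun z hz => reg3F2_sub_half_nat_lower hz hn) h1 h2
        (h3.congr (by ring))
  · intro h1 h2 h3 h4 h5 h6
    exact hasHyp3F2One_of_im_ne_zero (a := a) (fun z hz => reg3F2_sub_half_nat_nonneg hz hn) h1 h2
        (h3.congr (by ring))
  · intro h1 h2 h3 h4 h5 h6
    exact hasHyp3F2One_of_im_ne_zero (a := a) (fun z hz => reg3F2_two_mul_sub_one_half_nat hz hn) h1
        h2 (h3.congr (by ring))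
  · intro h1 h2 h3 h4 h5 h6
    -- This argument is the excess plus 1.
    have hr : Reg (-n / 2 + 1 / 2 + 2 * a) := (h3.add_nat 1).congr
    exact hasHyp3F2One_of_im_ne_zero (a := a) (fun z hz => reg3F2_sub_half_nat_one hz hn) h1 h2
        (h3.congr (by ring))
  · intro h1 h2 h3 h4 h5 h6
    exact hasHyp3F2One_of_im_ne_zero (a := a) (fun z hz => reg3F2_sub_half_nat_add_one hz hn) h1 h2
        (h3.congr (by ring))
  · intro h1 h2 h3 h4 h5 h6
    -- This denominator is twice the excess.
    have h0 : -1 + n / 2 + a ≠ 0 := fun h0 => h3.ne_zero (by linear_combination h0 / 2)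
    exact hasHyp3F2One_of_im_ne_zero (a := a) (fun z hz => reg3F2_unit_two_mul hz hn) h1 h2
        (h3.congr (by ring))
  · intro h1 h2 h3 h4 h5 h6
    exact hasHyp3F2One_of_im_ne_zero (a := a) (fun z hz => reg3F2_unit_two_mul_shifted hz hn) h1 h2
        (h3.congr (by ring))
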